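/- For $0\le\varepsilon<\pi/4$ let $Q_\varepsilon$ be the hyperbolic quadrilateral with four equal sides and consecutive interior angles $\frac{\pi}{4}+\varepsilon,\ \frac{\pi}{4}-\varepsilon,\ \frac{\pi}{4}+\varepsilon,\ \frac{\pi}{4}-\varepsilon$. Let $k\ge 2$ and $n\ge 4$ be integers and put $g=kn+1$. Arrange $2kn$ copies of $Q_{\pi/12}$, all placed in the same way, in a $2k\times n$ rectangular grid and identify opposite sides of the grid by translation; the result is a hyperbolic torus $T$ with $2g-2=2kn$ cone points of angle $\pi$ (the vertices of the grid). Let $S=S_g(\frac{\pi}{12})$ be any closed hyperbolic surface that carries an orientation-preserving isometric involution $\sigma$ with $S/\sigma\cong T$ isometrically, so that $S\to T$ is a double cover branched exactly over the cone points; $S$ has genus $g$. A systolic geodesic of $S$ is a closed geodesic whose length is the minimal length of a closed geodesic of $S$. Theorem. Every simple closed geodesic $\gamma$ on $S$ that is not itself systolic meets the union of all systolic geodesics of $S$ in a finite and even number of points. If $\gamma$ is itself a systolic geodesic, then it meets the union of the systolic geodesics different from $\gamma$ in a finite and even number of points. -/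

import Mathlib

open scoped UpperHalfPlane MatrixGroups

namespace BolzaLike

noncomputable section

/-! ### The square `Q_ε`

The square `Q_ε = ABCD` is the hyperbolic rhombus with equal sides and interior angles `π/4 + ε` at
`A, C` and `π/4 - ε` at `B, D`.  It is placed in the upper half-plane with centre `i`, diagonal `AC`
on the imaginary axis and diagonal `BD` on the unit circle.  The diagonals are perpendicular
bisectors of each other and of the angles, so the half-diagonals are the legs of a right triangle
with acute angles `π/8 + ε/2` (at `A`) and `π/8 - ε/2` (at `B`). -/

/-- Half the length of the diagonal `AC` of `Q_ε`. -/
def halfAC (ε : ℝ) : ℝ :=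
  Real.arcosh (Real.cos (Real.pi / 8 - ε / 2) / Real.sin (Real.pi / 8 + ε / 2))

/-- Half the length of the diagonal `BD` of `Q_ε`. -/
def halfBD (ε : ℝ) : ℝ :=
  Real.arcosh (Real.cos (Real.pi / 8 + ε / 2) / Real.sin (Real.pi / 8 - ε / 2))

/-- The vertex `A` of `Q_ε`, at the top. -/
def vertexA (ε : ℝ) : ℍ := ⟨⟨0, Real.exp (halfAC ε)⟩, Real.exp_pos _⟩

/-- The vertex `B` of `Q_ε`, on the right. -/
def vertexB (ε : ℝ) : ℍ :=
  ⟨⟨Real.sinh (halfBD ε) / Real.cosh (halfBD ε), 1 / Real.cosh (halfBD ε)⟩,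
    one_div_pos.2 (Real.cosh_pos _)⟩

/-- The vertex `C` of `Q_ε`, at the bottom. -/
def vertexC (ε : ℝ) : ℍ := ⟨⟨0, Real.exp (-halfAC ε)⟩, Real.exp_pos _⟩

/-- The vertex `D` of `Q_ε`, on the left. -/
def vertexD (ε : ℝ) : ℍ :=
  ⟨⟨-Real.sinh (halfBD ε) / Real.cosh (halfBD ε), 1 / Real.cosh (halfBD ε)⟩,
    one_div_pos.2 (Real.cosh_pos _)⟩

/-- A normalising constant. -/
def pairingNorm (ε : ℝ) : ℝ := √(2 + 2 * Real.cosh (halfAC ε) * Real.cosh (halfBD ε))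

theorem pairingNorm_pos (ε : ℝ) : 0 < pairingNorm ε := by
  have h1 := Real.cosh_pos (halfAC ε)
  have h2 := Real.cosh_pos (halfBD ε)
  unfold pairingNorm
  positivity

theorem pairingNorm_sq (ε : ℝ) :
    pairingNorm ε ^ 2 = 2 + 2 * Real.cosh (halfAC ε) * Real.cosh (halfBD ε) := by
  have h1 := Real.cosh_pos (halfAC ε)
  have h2 := Real.cosh_pos (halfBD ε)
  unfold pairingNorm
  exact Real.sq_sqrt (by positivity)

/-- The isometry gluing the side `AB` of `Q_ε` to the opposite side `DC` (see `sideU_A`,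
`sideU_B`). -/
def sideU (ε : ℝ) : SL(2, ℝ) :=
  ⟨!![(Real.cosh (halfBD ε) + Real.exp (-halfAC ε)) / pairingNorm ε,
        -Real.sinh (halfBD ε) / pairingNorm ε;
      -Real.sinh (halfBD ε) / pairingNorm ε,
        (Real.cosh (halfBD ε) + Real.exp (halfAC ε)) / pairingNorm ε], by
    have h0 := (pairingNorm_pos ε).ne'
    have h1 := pairingNorm_sq ε
    have h2 := Real.cosh_sq (halfBD ε)
    have h3 : Real.exp (-halfAC ε) * Real.exp (halfAC ε) = 1 := by
      rw [← Real.exp_add]; simp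
    rw [Real.cosh_eq (halfAC ε)] at h1
    rw [Matrix.det_fin_two_of]
    field_simp
    linear_combination h2 + h3 - h1⟩

/-- The isometry gluing the side `AD` of `Q_ε` to the opposite side `BC` (see `sideV_A`,
`sideV_D`). -/
def sideV (ε : ℝ) : SL(2, ℝ) :=
  ⟨!![(Real.cosh (halfBD ε) + Real.exp (-halfAC ε)) / pairingNorm ε,
        Real.sinh (halfBD ε) / pairingNorm ε;
      Real.sinh (halfBD ε) / pairingNorm ε,
        (Real.cosh (halfBD ε) + Real.exp (halfAC ε)) / pairingNorm ε], by
    have h0 := (pairingNorm_pos ε).ne'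
    have h1 := pairingNorm_sq ε
    have h2 := Real.cosh_sq (halfBD ε)
    have h3 : Real.exp (-halfAC ε) * Real.exp (halfAC ε) = 1 := by
      rw [← Real.exp_add]; simp
    rw [Real.cosh_eq (halfAC ε)] at h1
    rw [Matrix.det_fin_two_of]
    field_simp
    linear_combination h2 + h3 - h1⟩

theorem smul_eq_of_mul_eq (g : SL(2, ℝ)) (z w : ℍ)
    (hre : g 0 0 * z.re + g 0 1 =
      w.re * (g 1 0 * z.re + g 1 1) - w.im * (g 1 0 * z.im))
    (him : g 0 0 * z.im = w.re * (g 1 0 * z.im) + w.im * (g 1 0 * z.re + g 1 1)) :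
    g • z = w := by
  apply UpperHalfPlane.ext
  rw [UpperHalfPlane.coe_specialLinearGroup_apply]
  have hd : ((g 1 0 : ℝ) : ℂ) * z + ((g 1 1 : ℝ) : ℂ) ≠ 0 := by
    intro h
    have h1 := congrArg Complex.im h
    have h2 := congrArg Complex.re h
    simp [z.im_ne_zero] at h1 h2
    have h3 := g.det_coe
    rw [Matrix.det_fin_two] at h3
    simp [h1] at h2
    simp [h1, h2] at h3
  have h : ((g 0 0 : ℝ) : ℂ) * z + ((g 0 1 : ℝ) : ℂ) =
      (w : ℂ) * (((g 1 0 : ℝ) : ℂ) * z + ((g 1 1 : ℝ) : ℂ)) := by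
    apply Complex.ext
    · simpa using hre
    · simpa using him
  simpa [div_eq_iff hd] using h

theorem exp_halfAC_mul (ε : ℝ) : Real.exp (halfAC ε) * Real.exp (-halfAC ε) = 1 := by
  rw [← Real.exp_add]; simp

theorem sideU_A (ε : ℝ) : sideU ε • vertexA ε = vertexD ε := by
  have h0 := (pairingNorm_pos ε).ne'
  have hc := (Real.cosh_pos (halfBD ε)).ne'
  have h2 := Real.cosh_sq (halfBD ε)
  have h3 := exp_halfAC_mul ε
  apply smul_eq_of_mul_eq <;> simp [sideU, vertexA, vertexD] <;> field_simp <;>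
    grind

theorem sideU_B (ε : ℝ) : sideU ε • vertexB ε = vertexC ε := by
  have h0 := (pairingNorm_pos ε).ne'
  have hc := (Real.cosh_pos (halfBD ε)).ne'
  have h2 := Real.cosh_sq (halfBD ε)
  have h3 := exp_halfAC_mul ε
  apply smul_eq_of_mul_eq <;> simp [sideU, vertexB, vertexC] <;> field_simp <;>
    grind

theorem sideV_A (ε : ℝ) : sideV ε • vertexA ε = vertexB ε := by
  have h0 := (pairingNorm_pos ε).ne'
  have hc := (Real.cosh_pos (halfBD ε)).ne'
  have h2 := Real.cosh_sq (halfBD ε)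
  have h3 := exp_halfAC_mul ε
  apply smul_eq_of_mul_eq <;> simp [sideV, vertexA, vertexB] <;> field_simp <;>
    grind

theorem sideV_D (ε : ℝ) : sideV ε • vertexD ε = vertexC ε := by
  have h0 := (pairingNorm_pos ε).ne'
  have hc := (Real.cosh_pos (halfBD ε)).ne'
  have h2 := Real.cosh_sq (halfBD ε)
  have h3 := exp_halfAC_mul ε
  apply smul_eq_of_mul_eq <;> simp [sideV, vertexD, vertexC] <;> field_simp <;>
    grind

theorem cosh_dist_AB (ε : ℝ) : Real.cosh (dist (vertexA ε) (vertexB ε)) =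
    Real.cosh (halfAC ε) * Real.cosh (halfBD ε) := by
  have hc := (Real.cosh_pos (halfBD ε)).ne'
  have he := (Real.exp_pos (halfAC ε)).ne'
  have h2 := Real.cosh_sq (halfBD ε)
  have h3 := exp_halfAC_mul ε
  rw [UpperHalfPlane.cosh_dist', Real.cosh_eq (halfAC ε)]
  simp [vertexA, vertexB]
  field_simp
  grind

theorem cosh_dist_AD (ε : ℝ) : Real.cosh (dist (vertexA ε) (vertexD ε)) =
    Real.cosh (halfAC ε) * Real.cosh (halfBD ε) := by
  have hc := (Real.cosh_pos (halfBD ε)).ne'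
  have he := (Real.exp_pos (halfAC ε)).ne'
  have h2 := Real.cosh_sq (halfBD ε)
  have h3 := exp_halfAC_mul ε
  rw [UpperHalfPlane.cosh_dist', Real.cosh_eq (halfAC ε)]
  simp [vertexA, vertexD]
  field_simp
  grind

/-- All four sides of `Q_ε` have the same length. -/
theorem sides_eq (ε : ℝ) :
    dist (vertexA ε) (vertexD ε) = dist (vertexA ε) (vertexB ε) ∧
    dist (vertexD ε) (vertexC ε) = dist (vertexA ε) (vertexB ε) ∧
    dist (vertexB ε) (vertexC ε) = dist (vertexA ε) (vertexB ε) := by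
  have h : dist (vertexA ε) (vertexD ε) = dist (vertexA ε) (vertexB ε) :=
    Real.cosh_injOn (Set.mem_Ici.2 dist_nonneg) (Set.mem_Ici.2 dist_nonneg)
      ((cosh_dist_AD ε).trans (cosh_dist_AB ε).symm)
  refine ⟨h, ?_, ?_⟩
  · rw [← sideU_A, ← sideU_B, dist_smul]
  · rw [← sideV_A, ← sideV_D, dist_smul, sideV_A, h]

theorem cosh_dist_BD (ε : ℝ) : Real.cosh (dist (vertexB ε) (vertexD ε)) =
    2 * Real.cosh (halfBD ε) ^ 2 - 1 := by
  have hc := (Real.cosh_pos (halfBD ε)).ne'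
  have h2 := Real.cosh_sq (halfBD ε)
  rw [UpperHalfPlane.cosh_dist']
  simp [vertexB, vertexD]
  field_simp
  grind

theorem cosh_dist_AC (ε : ℝ) : Real.cosh (dist (vertexA ε) (vertexC ε)) =
    2 * Real.cosh (halfAC ε) ^ 2 - 1 := by
  have he := (Real.exp_pos (halfAC ε)).ne'
  have h3 := exp_halfAC_mul ε
  rw [UpperHalfPlane.cosh_dist', Real.cosh_eq (halfAC ε)]
  simp [vertexA, vertexC]
  field_simp
  grind

theorem cosh_half_aux {ε : ℝ} (h0 : 0 ≤ ε) (h1 : ε < Real.pi / 4) :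
    0 < Real.sin (Real.pi / 8 + ε / 2) ∧ 0 < Real.sin (Real.pi / 8 - ε / 2) ∧
    Real.cosh (halfAC ε) = Real.cos (Real.pi / 8 - ε / 2) / Real.sin (Real.pi / 8 + ε / 2) ∧
    Real.cosh (halfBD ε) = Real.cos (Real.pi / 8 + ε / 2) / Real.sin (Real.pi / 8 - ε / 2) := by
  have hpi := Real.pi_pos
  have hs1 : 0 < Real.sin (Real.pi / 8 + ε / 2) :=
    Real.sin_pos_of_pos_of_lt_pi (by linarith) (by linarith)
  have hs2 : 0 < Real.sin (Real.pi / 8 - ε / 2) :=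
    Real.sin_pos_of_pos_of_lt_pi (by linarith) (by linarith)
  refine ⟨hs1, hs2, Real.cosh_arcosh ?_, Real.cosh_arcosh ?_⟩
  · rw [one_le_div hs1, ← Real.cos_pi_div_two_sub]
    exact Real.cos_le_cos_of_nonneg_of_le_pi (by linarith) (by linarith) (by linarith)
  · rw [one_le_div hs2, ← Real.cos_pi_div_two_sub]
    exact Real.cos_le_cos_of_nonneg_of_le_pi (by linarith) (by linarith) (by linarith)

/-- The interior angle of `Q_ε` at `A` is `π/4 + ε` (hyperbolic law of cosines in `BAD`). -/
theorem angle_A {ε : ℝ} (h0 : 0 ≤ ε) (h1 : ε < Real.pi / 4) :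
    Real.cosh (dist (vertexB ε) (vertexD ε)) =
      Real.cosh (dist (vertexA ε) (vertexB ε)) * Real.cosh (dist (vertexA ε) (vertexD ε)) -
      Real.sinh (dist (vertexA ε) (vertexB ε)) * Real.sinh (dist (vertexA ε) (vertexD ε)) *
        Real.cos (Real.pi / 4 + ε) := by
  obtain ⟨hs1, hs2, hp, hr⟩ := cosh_half_aux h0 h1
  have e : Real.pi / 4 + ε = 2 * (Real.pi / 8 + ε / 2) := by ring
  have hS := Real.sinh_sq (dist (vertexA ε) (vertexB ε))
  have hq1 := Real.sin_sq_add_cos_sq (Real.pi / 8 + ε / 2)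
  have hq2 := Real.sin_sq_add_cos_sq (Real.pi / 8 - ε / 2)
  rw [(sides_eq ε).1, ← pow_two, ← pow_two, hS, cosh_dist_BD, cosh_dist_AB, hp, hr, e,
    Real.cos_two_mul]
  generalize Real.sin (Real.pi / 8 + ε / 2) = s1 at *
  generalize Real.sin (Real.pi / 8 - ε / 2) = s2 at *
  generalize Real.cos (Real.pi / 8 + ε / 2) = c1 at *
  generalize Real.cos (Real.pi / 8 - ε / 2) = c2 at *
  have hq1' : c1 ^ 2 = 1 - s1 ^ 2 := by linarith
  have hq2' : c2 ^ 2 = 1 - s2 ^ 2 := by linarith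
  simp only [mul_pow, div_pow, hq1', hq2']
  field_simp
  ring

/-- The interior angle of `Q_ε` at `B` is `π/4 - ε` (hyperbolic law of cosines in `ABC`). -/
theorem angle_B {ε : ℝ} (h0 : 0 ≤ ε) (h1 : ε < Real.pi / 4) :
    Real.cosh (dist (vertexA ε) (vertexC ε)) =
      Real.cosh (dist (vertexA ε) (vertexB ε)) * Real.cosh (dist (vertexB ε) (vertexC ε)) -
      Real.sinh (dist (vertexA ε) (vertexB ε)) * Real.sinh (dist (vertexB ε) (vertexC ε)) *
        Real.cos (Real.pi / 4 - ε) := by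
  obtain ⟨hs1, hs2, hp, hr⟩ := cosh_half_aux h0 h1
  have e : Real.pi / 4 - ε = 2 * (Real.pi / 8 - ε / 2) := by ring
  have hS := Real.sinh_sq (dist (vertexA ε) (vertexB ε))
  have hq1 := Real.sin_sq_add_cos_sq (Real.pi / 8 + ε / 2)
  have hq2 := Real.sin_sq_add_cos_sq (Real.pi / 8 - ε / 2)
  rw [(sides_eq ε).2.2, ← pow_two, ← pow_two, hS, cosh_dist_AC, cosh_dist_AB, hp, hr, e,
    Real.cos_two_mul]
  generalize Real.sin (Real.pi / 8 + ε / 2) = s1 at *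
  generalize Real.sin (Real.pi / 8 - ε / 2) = s2 at *
  generalize Real.cos (Real.pi / 8 + ε / 2) = c1 at *
  generalize Real.cos (Real.pi / 8 - ε / 2) = c2 at *
  have hq1' : c1 ^ 2 = 1 - s1 ^ 2 := by linarith
  have hq2' : c2 ^ 2 = 1 - s2 ^ 2 := by linarith
  simp only [mul_pow, div_pow, hq1', hq2']
  field_simp
  ring

/-! ### The torus `T_ε` and the surfaces `S_g(ε)`

The translates of `Q_ε` by the group generated by `sideU` and `sideV` tile the hyperbolic plane,
with eight squares (total angle `2π`) at every vertex.  Label the copy of `Q_ε` that is reached from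
`Q_ε` along a word in `sideU`, `sideV` by the two exponent sums of the word, modulo `m` and `n`.
Identifying equally labelled copies gives the torus made of an `m × n` grid of squares with opposite
sides of the grid glued by translation; its `m * n` vertices are cone points of angle `π`. -/

/-- The two exponent sums of a word in two letters, the first modulo `m`, the second modulo `n`. -/
def exponentSums (m n : ℕ) : FreeGroup (Fin 2) →* Multiplicative (ZMod m × ZMod n) :=
  FreeGroup.lift ![Multiplicative.ofAdd (1, 0), Multiplicative.ofAdd (0, 1)]

/-- The value of a word in the side pairings `sideU ε`, `sideV ε`. -/
def sideWord (ε : ℝ) : FreeGroup (Fin 2) →* SL(2, ℝ) :=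
  FreeGroup.lift ![sideU ε, sideV ε]

/-- The group `Λ` with `ℍ / Λ = T_ε`, the torus glued from an `m × n` grid of squares `Q_ε`. -/
def torusGroup (ε : ℝ) (m n : ℕ) : Subgroup SL(2, ℝ) :=
  (exponentSums m n).ker.map (sideWord ε)

/-- `Γ` uniformizes a double cover of `T_ε` by a hyperbolic surface, branched over all the cone
points: `Γ` has index two in the group of `T_ε` and acts freely (up to sign) on the hyperbolic
plane. The covering involution of `ℍ / Γ` is induced by the elements of `torusGroup ε m n` outside
`Γ`, and the quotient of `ℍ / Γ` by it is `T_ε`. -/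
structure IsSurfaceGroup (ε : ℝ) (m n : ℕ) (Γ : Subgroup SL(2, ℝ)) : Prop where
  le : Γ ≤ torusGroup ε m n
  index_two : Γ.relIndex (torusGroup ε m n) = 2
  free : ∀ g ∈ Γ, ∀ z : ℍ, g • z = z → ∀ w : ℍ, g • w = w

/-- The surface `ℍ / Γ`. -/
abbrev Surface (Γ : Subgroup SL(2, ℝ)) : Type := MulAction.orbitRel.Quotient Γ ℍ

/-- The projection of the hyperbolic plane onto `ℍ / Γ`. -/
def proj (Γ : Subgroup SL(2, ℝ)) (z : ℍ) : Surface Γ := Quotient.mk _ z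

/-! ### Closed geodesics -/

/-- `γ` is a closed geodesic of length `L` on `ℍ / Γ`, parametrized by arc length: the projection of
a complete unit speed geodesic of the hyperbolic plane that closes up after length `L`. -/
structure IsClosedGeodesic (Γ : Subgroup SL(2, ℝ)) (γ : ℝ → Surface Γ) (L : ℝ) : Prop where
  pos : 0 < L
  lift : ∃ c : ℝ → ℍ, Isometry c ∧ ∀ t, γ t = proj Γ (c t)
  periodic : Function.Periodic γ L

/-- A closed geodesic of length `L` is simple if it is injective modulo its period. -/
structure IsSimpleClosedGeodesic (Γ : Subgroup SL(2, ℝ)) (γ : ℝ → Surface Γ) (L : ℝ) : Prop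
    extends IsClosedGeodesic Γ γ L where
  simple : ∀ s t : ℝ, γ s = γ t → ∃ j : ℤ, t = s + j * L

/-- The systole of `ℍ / Γ`: the minimal length of a closed geodesic. -/
def systole (Γ : Subgroup SL(2, ℝ)) : ℝ :=
  sInf {L : ℝ | ∃ γ : ℝ → Surface Γ, IsClosedGeodesic Γ γ L}

/-- A systolic geodesic is a closed geodesic whose length is the systole. -/
def IsSystolicGeodesic (Γ : Subgroup SL(2, ℝ)) (α : ℝ → Surface Γ) : Prop :=
  IsClosedGeodesic Γ α (systole Γ)

/-- The union of all systolic geodesics of `ℍ / Γ`. -/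
def systolicUnion (Γ : Subgroup SL(2, ℝ)) : Set (Surface Γ) :=
  {x | ∃ α, IsSystolicGeodesic Γ α ∧ x ∈ Set.range α}

/-- The union of the systolic geodesics of `ℍ / Γ` that differ from `γ` as curves. -/
def otherSystolicUnion (Γ : Subgroup SL(2, ℝ)) (γ : ℝ → Surface Γ) : Set (Surface Γ) :=
  {x | ∃ α, IsSystolicGeodesic Γ α ∧ Set.range α ≠ Set.range γ ∧ x ∈ Set.range α}

end

end BolzaLike

namespace BolzaLike

/-! ### The rhombus at the equilateral parameter -/

noncomputable section

/-! At `ε = π/12` the diagonal `AC` cuts the rhombus into two equilateral triangles with angles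
`π/6`, so the hyperbolic plane is tiled by triangles, twelve at each vertex, and the edges fit
together into complete lines. The proof shows that the systolic geodesics of the surface are exactly
the images of these lines, and then counts their crossings with `γ` by two parity arguments.

Everything is done in the basis of half-turns about `A`, `B`, `C`. The trace form has entries `1`
and `3 + 2√3` there, and the half-turns about the side midpoints act on vectors with coordinates in
`ℤ[√3]`. The Galois conjugate form is positive definite, so integral vectors have bounded
conjugates. This gives local finiteness (`finite_separating`), the classification of vertices
(`vertex_cases`), and the fact that no line enters the interior of a triangle, so that two lines
meet only at vertices (`lineNormals_unique`).

Systole. Words in the side pairings with zero exponent sums are products of half-turns about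
vertices. Those in `Γ` are the products of evenly many, hence congruent to `1` modulo `2`
(`IsSurfaceGroup.parity`). Together with the conjugate bound this leaves only the scalar parts `±1`,
`±(3 + 2√3)` and larger ones (`IsSurfaceGroup.scalar_cases`), and the middle case is a translation
along a line. A word of `Γ` with a nonzero exponent sum has one of absolute value at least four,
because both sides of the grid have length at least four. Its axis crosses the disjoint lines of a
strip family at least that often per period on average, which makes it too long
(`long_of_crossing`).

Parity. If the lift of `γ` avoids all vertices, its crossings in one period correspond to the lines
separating a point from its translate. The parity of that number is additive, and each side pairing
is, up to sign, a product of two half-turns with equal counts, so it is even (`even_ncard_sep`). For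
systolic `γ` there are then no crossings with other lines at all. If the lift passes through a
vertex, the half-turn there induces the covering involution, which reverses `γ`. Its second fixed
point, half a period later, is again a vertex (`IsLift.isVertex_half`). Both fixed points are
intersection points and the others are exchanged in pairs (`even_ncard_of_reflection`). -/

/-- The angle defect `π/12` at which the triangles `ABC` and `ACD` are equilateral. -/
abbrev eqAngle : ℝ := Real.pi / 12

abbrev rt : ℝ := √3

/-- The hyperbolic cosine of half the diagonal `AC`. -/
def chA : ℝ := Real.cosh (halfAC eqAngle)

/-- The hyperbolic sine of half the diagonal `AC`. -/
def shA : ℝ := Real.sinh (halfAC eqAngle)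

theorem rt_sq : rt ^ 2 = 3 := Real.sq_sqrt (by norm_num)

theorem rt_mul_self : rt * rt = 3 := Real.mul_self_sqrt (by norm_num)

theorem rt_bounds : (1.732 : ℝ) < rt ∧ rt < 1.7321 :=
  ⟨Real.lt_sqrt_of_sq_lt (by norm_num), (Real.sqrt_lt' (by norm_num)).2 (by norm_num)⟩

theorem chA_eq : chA = 2 * Real.cos (Real.pi / 12) := by
  have h := (cosh_half_aux (ε := eqAngle) (by positivity) (by unfold eqAngle; linarith [Real.pi_pos])).2.2.1
  rw [chA, h, show Real.pi / 8 - eqAngle / 2 = Real.pi / 12 by ring,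
    show Real.pi / 8 + eqAngle / 2 = Real.pi / 6 by ring, Real.sin_pi_div_six]
  ring

theorem chA_sq : chA ^ 2 = 2 + rt := by
  have h := Real.cos_sq (Real.pi / 12)
  rw [show 2 * (Real.pi / 12) = Real.pi / 6 by ring, Real.cos_pi_div_six] at h
  rw [chA_eq, mul_pow, h]
  ring

theorem chA_pos : 0 < chA := Real.cosh_pos _

theorem shA_sq : shA ^ 2 = 1 + rt := by
  have h := Real.cosh_sq (halfAC eqAngle)
  have h2 := chA_sq
  rw [chA, h] at h2
  rw [shA]
  linarith

theorem shA_pos : 0 < shA := by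
  have h0 : 0 ≤ shA := Real.sinh_nonneg_iff.2 (Real.arcosh_nonneg (by
    have h := (cosh_half_aux (ε := eqAngle) (by positivity) (by unfold eqAngle; linarith [Real.pi_pos])).2.2.1
    rw [← h]
    exact Real.one_le_cosh _))
  rcases h0.lt_or_eq with h | h
  · exact h
  · have := shA_sq
    rw [← h] at this
    linarith [rt_bounds.1]

theorem cosh_halfBD : Real.cosh (halfBD eqAngle) = rt * chA := by
  obtain ⟨-, h1, -, h⟩ := cosh_half_aux (ε := eqAngle) (by positivity) (by unfold eqAngle; linarith [Real.pi_pos])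
  rw [show Real.pi / 8 - eqAngle / 2 = Real.pi / 12 by ring] at h1 h
  rw [show Real.pi / 8 + eqAngle / 2 = Real.pi / 6 by ring, Real.cos_pi_div_six] at h
  -- The double angle formula with `sin (π/6) = 1/2` turns `1 / sin (π/12)` into `4 cos (π/12)`.
  have h2 := Real.sin_two_mul (Real.pi / 12)
  rw [show 2 * (Real.pi / 12) = Real.pi / 6 by ring, Real.sin_pi_div_six] at h2
  rw [h, chA_eq, div_eq_iff h1.ne']
  linear_combination rt * h2

theorem sinh_halfBD : Real.sinh (halfBD eqAngle) = chA * shA := by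
  have h0 : 0 ≤ Real.sinh (halfBD eqAngle) :=
    Real.sinh_nonneg_iff.2 (Real.arcosh_nonneg (by
      have h := (cosh_half_aux (ε := eqAngle) (by positivity) (by unfold eqAngle; linarith [Real.pi_pos])).2.2.2
      rw [← h]
      exact Real.one_le_cosh _))
  have h1 := Real.cosh_sq (halfBD eqAngle)
  rw [cosh_halfBD] at h1
  refine (sq_eq_sq₀ h0 (mul_pos chA_pos shA_pos).le).1 ?_
  have h2 : Real.sinh (halfBD eqAngle) ^ 2 = (rt * chA) ^ 2 - 1 := by linarith
  rw [h2, mul_pow, mul_pow, rt_sq, chA_sq, shA_sq]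
  nlinarith [rt_sq]

theorem exp_halfAC : Real.exp (halfAC eqAngle) = chA + shA := (Real.cosh_add_sinh _).symm

theorem exp_neg_halfAC : Real.exp (-halfAC eqAngle) = chA - shA := (Real.cosh_sub_sinh _).symm

theorem pairingNorm_eq : pairingNorm eqAngle = 2 * chA := by
  refine (sq_eq_sq₀ (pairingNorm_pos _).le (by linarith [chA_pos])).1 ?_
  rw [pairingNorm_sq, cosh_halfBD]
  change 2 + 2 * chA * _ = _
  linear_combination (2 * rt - 4) * chA_sq + 2 * rt_sq

/-- Side pairing `sideU` at the equilateral parameter. -/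
def mU : SL(2, ℝ) := sideU eqAngle

/-- Side pairing `sideV` at the equilateral parameter. -/
def mV : SL(2, ℝ) := sideV eqAngle

/-- The half-turn about the centre of the square. -/
def mJ : SL(2, ℝ) := ⟨!![0, -1; 1, 0], by simp [Matrix.det_fin_two_of]⟩

/-- Since `chA ^ 2 = 2 + √3` is a unit of `ℤ[√3]`, dividing by `chA` is multiplying by `(2 - √3) *
chA`. This removes the denominator `pairingNorm` and leaves polynomial identities for later. -/
theorem mU_coe : (mU : Matrix (Fin 2) (Fin 2) ℝ) =
    !![(1 + rt - (2 - rt) * chA * shA) / 2, -shA / 2;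
      -shA / 2, (1 + rt + (2 - rt) * chA * shA) / 2] := by
  have h0 := chA_pos.ne'
  have h1 := chA_sq
  have h2 := rt_sq
  simp only [mU, sideU, cosh_halfBD, sinh_halfBD, exp_halfAC, exp_neg_halfAC, pairingNorm_eq]
  congr 1
  ext i j
  fin_cases i <;> fin_cases j <;> simp <;> field_simp <;>
    grobner

theorem mV_coe : (mV : Matrix (Fin 2) (Fin 2) ℝ) =
    !![(1 + rt - (2 - rt) * chA * shA) / 2, shA / 2;
      shA / 2, (1 + rt + (2 - rt) * chA * shA) / 2] := by
  have h0 := chA_pos.ne'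
  have h1 := chA_sq
  have h2 := rt_sq
  simp only [mV, sideV, cosh_halfBD, sinh_halfBD, exp_halfAC, exp_neg_halfAC, pairingNorm_eq]
  congr 1
  ext i j
  fin_cases i <;> fin_cases j <;> simp <;> field_simp <;>
    grobner

/-! ### Vectors and the trace form -/

/-- Sum of the three coordinates. -/
def vsum {S : Type*} [CommRing S] (x : S × S × S) : S := x.1 + x.2.1 + x.2.2

/-- The bilinear form with `1` on the diagonal and `3 + 2 t` off the diagonal. -/
def bil {S : Type*} [CommRing S] (t : S) (x y : S × S × S) : S :=
  (3 + 2 * t) * (vsum x * vsum y) -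
    (2 + 2 * t) * (x.1 * y.1 + x.2.1 * y.2.1 + x.2.2 * y.2.2)

/-- The vector part of a product of two vectors. -/
def vcross {S : Type*} [CommRing S] (t : S) (x y : S × S × S) : S × S × S :=
  (-t * (x.1 * y.2.1 - x.2.1 * y.1) + 2 * (x.2.1 * y.2.2 - x.2.2 * y.2.1)
      - t * (x.2.2 * y.1 - x.1 * y.2.2),
   -t * (x.1 * y.2.1 - x.2.1 * y.1) - t * (x.2.1 * y.2.2 - x.2.2 * y.2.1)
      + 2 * (x.2.2 * y.1 - x.1 * y.2.2),
   2 * (x.1 * y.2.1 - x.2.1 * y.1) - t * (x.2.1 * y.2.2 - x.2.2 * y.2.1)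
      - t * (x.2.2 * y.1 - x.1 * y.2.2))

/-- The traceless matrix with the given coordinates with respect to the half-turns about
`A`, `B`, `C`. -/
def vmat (x : ℝ × ℝ × ℝ) : Matrix (Fin 2) (Fin 2) ℝ :=
  !![x.2.1 * (chA * shA), -(chA + shA) * x.1 - rt * chA * x.2.1 - (chA - shA) * x.2.2;
    (chA - shA) * x.1 + rt * chA * x.2.1 + (chA + shA) * x.2.2, -(x.2.1 * (chA * shA))]

/-- Coordinates of a traceless matrix. -/
def vcoord (M : Matrix (Fin 2) (Fin 2) ℝ) : ℝ × ℝ × ℝ :=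
  let y := M 0 0 / (chA * shA)
  let b := M 0 1 + rt * chA * y
  let c := M 1 0 - rt * chA * y
  (-((chA + shA) * b + (chA - shA) * c) / (4 * (chA * shA)), y,
    ((chA - shA) * b + (chA + shA) * c) / (4 * (chA * shA)))

theorem vcoord_vmat (x : ℝ × ℝ × ℝ) : vcoord (vmat x) = x := by
  have h0 := chA_pos.ne'
  have h1 := shA_pos.ne'
  obtain ⟨a, b, c⟩ := x
  simp only [vcoord, vmat, Prod.mk.injEq, Matrix.of_apply, Matrix.cons_val', Matrix.cons_val_zero,
    Matrix.cons_val_one, Matrix.cons_val_fin_one]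
  refine ⟨?_, ?_, ?_⟩ <;> field_simp <;> ring

theorem vmat_vcoord (M : Matrix (Fin 2) (Fin 2) ℝ) (hM : M 1 1 = -M 0 0) :
    vmat (vcoord M) = M := by
  have h0 := chA_pos.ne'
  have h1 := shA_pos.ne'
  ext i j
  fin_cases i <;> fin_cases j <;> simp [vcoord, vmat, hM] <;> field_simp <;> ring

theorem vmat_injective : Function.Injective vmat := fun x y h => by
  rw [← vcoord_vmat x, h, vcoord_vmat]

/-- Traceless matrices multiply like pure quaternions: scalar part minus the form, vector part an
alternating product. Both parts have coefficients in `ℤ[√3]`, which is the source of the arithmetic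
below. -/
theorem vmat_mul_vmat (x y : ℝ × ℝ × ℝ) :
    vmat x * vmat y = (-bil rt x y) • (1 : Matrix (Fin 2) (Fin 2) ℝ) + vmat (vcross rt x y) := by
  have h1 := rt_sq
  have h2 := chA_sq
  have h3 := shA_sq
  obtain ⟨a, b, c⟩ := x
  obtain ⟨a', b', c'⟩ := y
  ext i j
  fin_cases i <;> fin_cases j <;>
    simp [vmat, bil, vcross, vsum, Matrix.mul_apply, Fin.sum_univ_two] <;> grobner

end

end BolzaLike

namespace BolzaLike

noncomputable section

/-! ### The adjoint action in coordinates -/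

/-- The adjoint action of `SL(2, ℝ)` on coordinate vectors. -/
def act (g : SL(2, ℝ)) (x : ℝ × ℝ × ℝ) : ℝ × ℝ × ℝ :=
  vcoord ((g : Matrix (Fin 2) (Fin 2) ℝ) * vmat x * ((g⁻¹ : SL(2, ℝ)) : Matrix (Fin 2) (Fin 2) ℝ))

theorem coe_mul_coe_inv (g : SL(2, ℝ)) : (g : Matrix (Fin 2) (Fin 2) ℝ) *
    ((g⁻¹ : SL(2, ℝ)) : Matrix (Fin 2) (Fin 2) ℝ) = 1 := by
  rw [← Matrix.SpecialLinearGroup.coe_mul, mul_inv_cancel, Matrix.SpecialLinearGroup.coe_one]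

theorem coe_inv_mul_coe (g : SL(2, ℝ)) : ((g⁻¹ : SL(2, ℝ)) : Matrix (Fin 2) (Fin 2) ℝ) *
    (g : Matrix (Fin 2) (Fin 2) ℝ) = 1 := by
  rw [← Matrix.SpecialLinearGroup.coe_mul, inv_mul_cancel, Matrix.SpecialLinearGroup.coe_one]

theorem trace_vmat (x : ℝ × ℝ × ℝ) : (vmat x).trace = 0 := by
  simp [vmat, Matrix.trace, Fin.sum_univ_two]

theorem vmat_act (g : SL(2, ℝ)) (x : ℝ × ℝ × ℝ) : vmat (act g x) =
    (g : Matrix (Fin 2) (Fin 2) ℝ) * vmat x * ((g⁻¹ : SL(2, ℝ)) : Matrix (Fin 2) (Fin 2) ℝ) := by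
  refine vmat_vcoord _ ?_
  have h : ((g : Matrix (Fin 2) (Fin 2) ℝ) * vmat x *
      ((g⁻¹ : SL(2, ℝ)) : Matrix (Fin 2) (Fin 2) ℝ)).trace = 0 := by
    rw [Matrix.trace_mul_cycle, coe_inv_mul_coe, one_mul, trace_vmat]
  rw [Matrix.trace, Fin.sum_univ_two] at h
  simp only [Matrix.diag_apply] at h
  linarith

theorem vmat_act_mul (g : SL(2, ℝ)) (x : ℝ × ℝ × ℝ) :
    vmat (act g x) * (g : Matrix (Fin 2) (Fin 2) ℝ) = g * vmat x := by
  rw [vmat_act, mul_assoc, coe_inv_mul_coe, mul_one]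

theorem act_eq_of_mul_eq {g : SL(2, ℝ)} {x y : ℝ × ℝ × ℝ}
    (h : (g : Matrix (Fin 2) (Fin 2) ℝ) * vmat x = vmat y * g) : act g x = y := by
  rw [act, h, mul_assoc, coe_mul_coe_inv, mul_one, vcoord_vmat]

theorem act_mul (g h : SL(2, ℝ)) (x : ℝ × ℝ × ℝ) : act (g * h) x = act g (act h x) := by
  apply act_eq_of_mul_eq
  rw [Matrix.SpecialLinearGroup.coe_mul, mul_assoc, ← vmat_act_mul, ← mul_assoc, ← vmat_act_mul,
    mul_assoc]

theorem act_one (x : ℝ × ℝ × ℝ) : act 1 x = x := by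
  apply act_eq_of_mul_eq
  simp

theorem act_inv_act (g : SL(2, ℝ)) (x : ℝ × ℝ × ℝ) : act g⁻¹ (act g x) = x := by
  rw [← act_mul, inv_mul_cancel, act_one]

theorem act_act_inv (g : SL(2, ℝ)) (x : ℝ × ℝ × ℝ) : act g (act g⁻¹ x) = x := by
  rw [← act_mul, mul_inv_cancel, act_one]

theorem vmat_add (x y : ℝ × ℝ × ℝ) : vmat (x + y) = vmat x + vmat y := by
  ext i j
  fin_cases i <;> fin_cases j <;> simp [vmat] <;> ring

theorem vmat_smul (a : ℝ) (x : ℝ × ℝ × ℝ) : vmat (a • x) = a • vmat x := by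
  ext i j
  fin_cases i <;> fin_cases j <;> simp [vmat] <;> ring

theorem vmat_neg (x : ℝ × ℝ × ℝ) : vmat (-x) = -vmat x := by
  rw [← neg_one_smul ℝ, vmat_smul, neg_one_smul]

theorem act_add (g : SL(2, ℝ)) (x y : ℝ × ℝ × ℝ) : act g (x + y) = act g x + act g y := by
  apply vmat_injective
  simp only [vmat_act, vmat_add, mul_add, add_mul]

theorem act_smul (g : SL(2, ℝ)) (a : ℝ) (x : ℝ × ℝ × ℝ) : act g (a • x) = a • act g x := by
  apply vmat_injective
  simp only [vmat_act, vmat_smul, Matrix.mul_smul, Matrix.smul_mul]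

theorem act_neg (g : SL(2, ℝ)) (x : ℝ × ℝ × ℝ) : act g (-x) = -act g x := by
  rw [← neg_one_smul ℝ, act_smul, neg_one_smul]

theorem trace_vmat_mul (x y : ℝ × ℝ × ℝ) : (vmat x * vmat y).trace = -2 * bil rt x y := by
  rw [vmat_mul_vmat, Matrix.trace_add, Matrix.trace_smul, trace_vmat]
  simp
  ring

/-- The form is minus half the trace of a product, and conjugation preserves traces. -/
theorem bil_act (g : SL(2, ℝ)) (x y : ℝ × ℝ × ℝ) : bil rt (act g x) (act g y) = bil rt x y := by
  have h := trace_vmat_mul (act g x) (act g y)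
  have h' : (vmat (act g x) * vmat (act g y)).trace = (vmat x * vmat y).trace := by
    rw [vmat_act g y, ← mul_assoc, ← mul_assoc, vmat_act_mul, Matrix.trace_mul_cycle,
      ← mul_assoc, coe_inv_mul_coe, one_mul]
  rw [h', trace_vmat_mul] at h
  linarith

/-! ### Bilinearity over any coefficient ring -/

section bilinear

variable {S : Type*} [CommRing S] (t : S) (x y z : S × S × S)

theorem bil_comm : bil t x y = bil t y x := by simp only [bil]; ring

theorem bil_add_left : bil t (x + y) z = bil t x z + bil t y z := by
  simp only [bil, vsum, Prod.fst_add, Prod.snd_add]; ring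

theorem bil_smul_left (a : S) : bil t (a • x) z = a * bil t x z := by
  simp only [bil, vsum, Prod.smul_fst, Prod.smul_snd, smul_eq_mul]; ring

theorem bil_add_right : bil t z (x + y) = bil t z x + bil t z y := by
  simp only [bil, vsum, Prod.fst_add, Prod.snd_add]; ring

theorem bil_smul_right (a : S) : bil t z (a • x) = a * bil t z x := by
  simp only [bil, vsum, Prod.smul_fst, Prod.smul_snd, smul_eq_mul]; ring

theorem bil_neg_left : bil t (-x) z = -bil t x z := by
  simp only [bil, vsum, Prod.fst_neg, Prod.snd_neg]; ring

theorem bil_neg_right : bil t z (-x) = -bil t z x := by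
  simp only [bil, vsum, Prod.fst_neg, Prod.snd_neg]; ring

end bilinear

/-! ### The side pairings and midpoint half-turns in coordinates -/

theorem act_neg_group (g : SL(2, ℝ)) (x : ℝ × ℝ × ℝ) : act (-g) x = act g x := by
  apply act_eq_of_mul_eq
  simp only [Matrix.SpecialLinearGroup.coe_neg, neg_mul, mul_neg, vmat_act_mul]

/-- This half-turn exchanges `A` and `C`. The formulas for `mJ * mU` (exchanging `A`, `B`) and `mV *
mJ` (exchanging `B`, `C`) differ from it by a permutation of the coordinates, and all three have
coefficients in `ℤ[√3]`. -/
theorem act_mJ (x : ℝ × ℝ × ℝ) :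
    act mJ x = (x.2.2 + rt * x.2.1, -x.2.1, x.1 + rt * x.2.1) := by
  apply act_eq_of_mul_eq
  ext i j
  fin_cases i <;> fin_cases j <;>
    simp [vmat, mJ, Matrix.mul_apply, Fin.sum_univ_two] <;> ring

theorem act_mU (x : ℝ × ℝ × ℝ) :
    act mU x = act mJ (x.2.1 + rt * x.2.2, x.1 + rt * x.2.2, -x.2.2) := by
  have h1 := rt_sq
  have h2 := chA_sq
  have h3 := shA_sq
  rw [act_mJ]
  apply act_eq_of_mul_eq
  rw [mU_coe]
  ext i j
  fin_cases i <;> fin_cases j <;>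
    simp [vmat, Matrix.mul_apply, Fin.sum_univ_two] <;> grobner

theorem mJ_coe : (mJ : Matrix (Fin 2) (Fin 2) ℝ) = !![0, -1; 1, 0] := rfl

theorem mJ_mul_mJ : mJ * mJ = -1 := by
  apply Subtype.ext
  rw [Matrix.SpecialLinearGroup.coe_mul, mJ_coe]
  simp [Matrix.one_fin_two]

theorem act_mJ_mJ (x : ℝ × ℝ × ℝ) : act mJ (act mJ x) = x := by
  rw [← act_mul, mJ_mul_mJ, act_neg_group, act_one]

theorem act_mJU (x : ℝ × ℝ × ℝ) :
    act (mJ * mU) x = (x.2.1 + rt * x.2.2, x.1 + rt * x.2.2, -x.2.2) := by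
  rw [act_mul, act_mU, act_mJ_mJ]

theorem act_mVJ (x : ℝ × ℝ × ℝ) :
    act (mV * mJ) x = (-x.1, x.2.2 + rt * x.1, x.2.1 + rt * x.1) := by
  have h1 := rt_sq
  have h2 := chA_sq
  have h3 := shA_sq
  apply act_eq_of_mul_eq
  rw [Matrix.SpecialLinearGroup.coe_mul, mV_coe]
  ext i j
  fin_cases i <;> fin_cases j <;>
    simp [vmat, mJ, Matrix.mul_apply, Fin.sum_univ_two] <;> grobner

theorem act_mV (x : ℝ × ℝ × ℝ) : act mV x = act (mV * mJ) (act mJ x) := by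
  rw [← act_mul, mul_assoc, mJ_mul_mJ, mul_neg_one, act_neg_group]

theorem det_one_apply (g : SL(2, ℝ)) : g 0 0 * g 1 1 - g 0 1 * g 1 0 = 1 := by
  have h := g.det_coe
  rwa [Matrix.det_fin_two] at h

/-! ### Half-turns -/

/-- The matrix of the half-turn about `z`. -/
def turnMat (z : ℍ) : Matrix (Fin 2) (Fin 2) ℝ :=
  !![z.re / z.im, -(z.re ^ 2 + z.im ^ 2) / z.im; 1 / z.im, -(z.re / z.im)]

/-- The hyperboloid vector of `z`: the coordinates of the half-turn about `z`. -/
def hv (z : ℍ) : ℝ × ℝ × ℝ := vcoord (turnMat z)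

theorem vmat_hv (z : ℍ) : vmat (hv z) = turnMat z := vmat_vcoord _ (by simp [turnMat])

theorem hv_injective : Function.Injective hv := fun z w h => by
  have h1 : turnMat z = turnMat w := by rw [← vmat_hv, h, vmat_hv]
  have h2 := congrFun (congrFun h1 1) 0
  have h3 := congrFun (congrFun h1 0) 0
  have hz := z.im_pos.ne'
  have hw := w.im_pos.ne'
  simp [turnMat] at h2 h3
  rw [h2] at h3
  field_simp at h3
  exact UpperHalfPlane.ext (Complex.ext h3 h2)

theorem smul_re_im (g : SL(2, ℝ)) (z : ℍ) :
    g 0 0 * z.re + g 0 1 =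
      (g • z).re * (g 1 0 * z.re + g 1 1) - (g • z).im * (g 1 0 * z.im) ∧
    g 0 0 * z.im = (g • z).re * (g 1 0 * z.im) + (g • z).im * (g 1 0 * z.re + g 1 1) := by
  have hd : ((g 1 0 : ℝ) : ℂ) * z + ((g 1 1 : ℝ) : ℂ) ≠ 0 := by
    intro h
    have h1 := congrArg Complex.im h
    have h2 := congrArg Complex.re h
    simp [z.im_ne_zero] at h1 h2
    have h3 := det_one_apply g
    simp [h1] at h2
    simp [h1, h2] at h3
  have h := UpperHalfPlane.coe_specialLinearGroup_apply g z
  simp only [Algebra.algebraMap_self, RingHom.id_apply] at h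
  rw [eq_div_iff hd] at h
  have h1 := congrArg Complex.re h
  have h2 := congrArg Complex.im h
  simp at h1 h2
  constructor
  · linarith
  · linarith

theorem turnMat_smul (g : SL(2, ℝ)) (z : ℍ) :
    (g : Matrix (Fin 2) (Fin 2) ℝ) * turnMat z = turnMat (g • z) * g := by
  obtain ⟨h1, h2⟩ := smul_re_im g z
  have hd := det_one_apply g
  have hy := z.im_pos.ne'
  have hv := (g • z).im_pos.ne'
  rw [← Matrix.ext_iff]
  simp only [Fin.forall_fin_two, Matrix.mul_apply, Fin.sum_univ_two, turnMat, Matrix.of_apply,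
    Matrix.cons_val', Matrix.cons_val_zero, Matrix.cons_val_one, Matrix.cons_val_fin_one]
  generalize (g • z).re = u at *
  generalize (g • z).im = v at *
  have ha : g 0 0 = u * g 1 0 + v * (g 1 0 * z.re + g 1 1) / z.im := by
    field_simp
    linear_combination h2
  have hb : g 0 1 = u * (g 1 0 * z.re + g 1 1) - v * (g 1 0 * z.im) - g 0 0 * z.re := by
    linear_combination h1
  rw [ha] at hb
  simp only [hb, ha]
  refine ⟨⟨?_, ?_⟩, ?_, ?_⟩ <;> field_simp <;> ring

theorem hv_smul (g : SL(2, ℝ)) (z : ℍ) : hv (g • z) = act g (hv z) := by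
  symm
  apply act_eq_of_mul_eq
  rw [vmat_hv, vmat_hv, turnMat_smul]

theorem bil_hv (z w : ℍ) : bil rt (hv z) (hv w) = Real.cosh (dist z w) := by
  have h := trace_vmat_mul (hv z) (hv w)
  rw [vmat_hv, vmat_hv] at h
  have hz := z.im_pos.ne'
  have hw := w.im_pos.ne'
  rw [UpperHalfPlane.cosh_dist']
  have h2 : bil rt (hv z) (hv w) = -(turnMat z * turnMat w).trace / 2 := by rw [h]; ring
  rw [h2]
  simp [turnMat, Matrix.trace, Fin.sum_univ_two]
  field_simp
  ring

theorem bil_hv_self (z : ℍ) : bil rt (hv z) (hv z) = 1 := by rw [bil_hv]; simp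

theorem bil_hv_pos (z w : ℍ) : 0 < bil rt (hv z) (hv w) := by
  rw [bil_hv]; exact Real.cosh_pos _

end

end BolzaLike

namespace BolzaLike

noncomputable section

/-! ### The hyperboloid -/

theorem vertex_relation : (chA + shA) * (chA - shA) = 1 := by
  have h2 := chA_sq
  have h3 := shA_sq
  linear_combination h2 - h3

theorem chA_sub_shA_pos : 0 < chA - shA := by
  rw [← exp_neg_halfAC]; exact Real.exp_pos _

theorem hv_vertexA : hv (vertexA eqAngle) = (1, 0, 0) := by
  apply vmat_injective
  rw [vmat_hv]
  have h := vertex_relation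
  have h0 : chA + shA ≠ 0 := by have := chA_pos; have := shA_pos; positivity
  have h1 : (vertexA eqAngle).re = 0 := rfl
  have h2 : (vertexA eqAngle).im = chA + shA := exp_halfAC
  ext i j
  fin_cases i <;> fin_cases j <;> simp [turnMat, vmat, h1, h2]
  · field_simp; ring
  · field_simp; linarith

theorem hv_vertexC : hv (vertexC eqAngle) = (0, 0, 1) := by
  apply vmat_injective
  rw [vmat_hv]
  have h := vertex_relation
  have h0 : chA - shA ≠ 0 := chA_sub_shA_pos.ne'
  have h1 : (vertexC eqAngle).re = 0 := rfl
  have h2 : (vertexC eqAngle).im = chA - shA := exp_neg_halfAC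
  ext i j
  fin_cases i <;> fin_cases j <;> simp [turnMat, vmat, h1, h2]
  · field_simp; ring
  · field_simp; linarith

theorem hv_vertexB : hv (vertexB eqAngle) = (0, 1, 0) := by
  have h : vertexB eqAngle = mV • vertexA eqAngle := (sideV_A eqAngle).symm
  rw [h, hv_smul, hv_vertexA, act_mV, act_mJ, act_mVJ]
  simp

/-- A Gram determinant is the determinant of the form times the square of a coordinate determinant.
The form has eigenvalues `7 + 4√3` and, twice, `-(2 + 2√3)`, so its determinant is positive. This
single inequality replaces hyperbolic trigonometry in all distance estimates. -/
theorem gram_nonneg (n x y : ℝ × ℝ × ℝ) :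
    0 ≤ bil rt n n * (bil rt x x * bil rt y y - bil rt x y ^ 2)
      - bil rt n x * (bil rt n x * bil rt y y - bil rt x y * bil rt n y)
      + bil rt n y * (bil rt n x * bil rt x y - bil rt x x * bil rt n y) := by
  have h : bil rt n n * (bil rt x x * bil rt y y - bil rt x y ^ 2)
      - bil rt n x * (bil rt n x * bil rt y y - bil rt x y * bil rt n y)
      + bil rt n y * (bil rt n x * bil rt x y - bil rt x x * bil rt n y) =
      (2 + 2 * rt) ^ 2 * (7 + 4 * rt) * (n.1 * (x.2.1 * y.2.2 - x.2.2 * y.2.1)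
        - n.2.1 * (x.1 * y.2.2 - x.2.2 * y.1) + n.2.2 * (x.1 * y.2.1 - x.2.1 * y.1)) ^ 2 := by
    simp only [bil, vsum]
    ring
  rw [h]
  have := rt_bounds.1
  positivity

/-- The signature is `(1, 2)`. Concretely, the form is a multiple of the product of coordinate sums
minus a multiple of the dot product, and Cauchy–Schwarz for the latter gives the sign. -/
theorem bil_neg_of_orthogonal {x y : ℝ × ℝ × ℝ} (hx : 0 < bil rt x x) (hxy : bil rt x y = 0)
    (hy : y ≠ 0) : bil rt y y < 0 := by
  obtain ⟨a, b, c⟩ := x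
  obtain ⟨a', b', c'⟩ := y
  have hN' : 0 < a' * a' + b' * b' + c' * c' := by
    by_contra hcon
    apply hy
    have h1 : a' = 0 := by nlinarith [mul_self_nonneg a', mul_self_nonneg b', mul_self_nonneg c']
    have h2 : b' = 0 := by nlinarith [mul_self_nonneg a', mul_self_nonneg b', mul_self_nonneg c']
    have h3 : c' = 0 := by nlinarith [mul_self_nonneg a', mul_self_nonneg b', mul_self_nonneg c']
    rw [h1, h2, h3]; rfl
  have hP : (a * a' + b * b' + c * c') ^ 2 ≤
      (a * a + b * b + c * c) * (a' * a' + b' * b' + c' * c') := by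
    nlinarith [sq_nonneg (a * b' - b * a'), sq_nonneg (a * c' - c * a'),
      sq_nonneg (b * c' - c * b')]
  have hk : 0 < 2 + 2 * rt := by linarith [rt_bounds.1]
  have hc : 0 < 3 + 2 * rt := by linarith [rt_bounds.1]
  simp only [bil] at *
  generalize vsum (a, b, c) = s at *
  generalize vsum (a', b', c') = s' at *
  generalize a' * a' + b' * b' + c' * c' = N' at *
  generalize a * a + b * b + c * c = N at *
  generalize a * a' + b * b' + c * c' = Q at *
  generalize 2 + 2 * rt = k at *
  generalize 3 + 2 * rt = l at *
  have h1 : (l * (s * s')) ^ 2 ≤ k ^ 2 * (N * N') := by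
    have : l * (s * s') = k * Q := by linarith
    rw [this, mul_pow]
    exact mul_le_mul_of_nonneg_left hP (by positivity)
  have h2 : k ^ 2 * (N * N') < k * (l * (s * s)) * N' := by
    have := mul_lt_mul_of_pos_right (show k * N < l * (s * s) by linarith) (mul_pos hk hN')
    nlinarith
  have h3 : 0 < s * s := by
    rcases (mul_self_nonneg s).lt_or_eq with h | h
    · exact h
    · rw [← h] at hx
      have h6 : N < 0 := by nlinarith
      nlinarith [sq_nonneg Q, mul_neg_of_neg_of_pos h6 hN']
  have h4 : (l * (s * s)) * (l * (s' * s')) < (l * (s * s)) * (k * N') := by nlinarith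
  have := lt_of_mul_lt_mul_left h4 (by positivity)
  linarith

theorem eq_zero_of_orthogonal {x y : ℝ × ℝ × ℝ} (hx : 0 < bil rt x x) (hxy : bil rt x y = 0)
    (hy : 0 ≤ bil rt y y) : y = 0 := by
  by_contra h
  exact absurd (bil_neg_of_orthogonal hx hxy h) (not_lt.2 hy)

theorem vsum_ne_zero_of_bil_pos {x : ℝ × ℝ × ℝ} (hx : 0 < bil rt x x) : vsum x ≠ 0 := by
  intro h
  simp only [bil, h] at hx
  nlinarith [rt_bounds.1, mul_self_nonneg x.1, mul_self_nonneg x.2.1, mul_self_nonneg x.2.2]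

/-- The sign of the coordinate sum tells the two sheets of the hyperboloid apart, so it serves as
time orientation. -/
theorem bil_pos_of_vsum_pos {x y : ℝ × ℝ × ℝ} (hx : 0 < bil rt x x) (hy : 0 < bil rt y y)
    (hsx : 0 < vsum x) (hsy : 0 < vsum y) : 0 < bil rt x y := by
  obtain ⟨a, b, c⟩ := x
  obtain ⟨a', b', c'⟩ := y
  have hP : (a * a' + b * b' + c * c') ^ 2 ≤
      (a * a + b * b + c * c) * (a' * a' + b' * b' + c' * c') := by
    nlinarith [sq_nonneg (a * b' - b * a'), sq_nonneg (a * c' - c * a'),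
      sq_nonneg (b * c' - c * b')]
  have hN : 0 ≤ a * a + b * b + c * c := by
    linarith [mul_self_nonneg a, mul_self_nonneg b, mul_self_nonneg c]
  have hN' : 0 ≤ a' * a' + b' * b' + c' * c' := by
    linarith [mul_self_nonneg a', mul_self_nonneg b', mul_self_nonneg c']
  have hk : 0 < 2 + 2 * rt := by linarith [rt_bounds.1]
  have hl : 0 < 3 + 2 * rt := by linarith [rt_bounds.1]
  simp only [bil] at *
  generalize vsum (a, b, c) = s at *
  generalize vsum (a', b', c') = s' at *
  generalize a' * a' + b' * b' + c' * c' = N' at *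
  generalize a * a + b * b + c * c = N at *
  generalize a * a' + b * b' + c * c' = Q at *
  generalize 2 + 2 * rt = k at *
  generalize 3 + 2 * rt = l at *
  have h1 : (k * N) * (k * N') < (l * (s * s)) * (l * (s' * s')) :=
    mul_lt_mul'' (by linarith) (by linarith) (by positivity) (by positivity)
  have h2 : (k * Q) ^ 2 < (l * (s * s')) ^ 2 := by
    have := mul_le_mul_of_nonneg_left hP (sq_nonneg k)
    calc (k * Q) ^ 2 = k ^ 2 * Q ^ 2 := by ring
      _ ≤ k ^ 2 * (N * N') := this
      _ = (k * N) * (k * N') := by ring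
      _ < (l * (s * s)) * (l * (s' * s')) := h1
      _ = _ := by ring
  have h3 := abs_lt_of_sq_lt_sq h2 (by positivity)
  linarith [(abs_lt.1 h3).2]

theorem hv_vsum_pos (z : ℍ) : 0 < vsum (hv z) := by
  have hA := bil_hv_pos z (vertexA eqAngle)
  have hB := bil_hv_pos z (vertexB eqAngle)
  have hC := bil_hv_pos z (vertexC eqAngle)
  rw [hv_vertexA] at hA
  rw [hv_vertexB] at hB
  rw [hv_vertexC] at hC
  simp only [bil, vsum] at *
  nlinarith [rt_bounds.1]

theorem exists_hv_eq {x : ℝ × ℝ × ℝ} (hx : bil rt x x = 1) (hs : 0 < vsum x) :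
    ∃ z : ℍ, hv z = x := by
  -- The point is read off from the lower-left entry `r` of the matrix: imaginary part `1 / r`, real
  -- part the diagonal entry over `r`. If `r < 0` then `-x` comes from a point, against the sign of
  -- the coordinate sum; `r = 0` contradicts the determinant.
  have key : ∀ y : ℝ × ℝ × ℝ, bil rt y y = 1 → 0 < vmat y 1 0 → ∃ z : ℍ, hv z = y := by
    intro y hy hr
    have htr : vmat y 1 1 = -vmat y 0 0 := by simp [vmat]
    have hdet : vmat y 0 0 ^ 2 + vmat y 0 1 * vmat y 1 0 = -1 := by
      have h := trace_vmat_mul y y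
      rw [hy, Matrix.trace, Fin.sum_univ_two] at h
      simp only [Matrix.diag_apply, Matrix.mul_apply, Fin.sum_univ_two, htr] at h
      linarith
    refine ⟨⟨⟨vmat y 0 0 / vmat y 1 0, 1 / vmat y 1 0⟩, one_div_pos.2 hr⟩, ?_⟩
    apply vmat_injective
    rw [vmat_hv]
    have hr' := hr.ne'
    ext i j
    fin_cases i <;> fin_cases j <;>
      simp only [turnMat, UpperHalfPlane.mk_re, UpperHalfPlane.mk_im, Fin.zero_eta, Fin.mk_one,
        Fin.isValue, Matrix.of_apply, Matrix.cons_val', Matrix.cons_val_zero, Matrix.cons_val_one,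
        Matrix.cons_val_fin_one]
    · field_simp
    · field_simp; linarith
    · field_simp
    · rw [htr]; field_simp
  rcases lt_trichotomy (vmat x 1 0) 0 with h | h | h
  · obtain ⟨z, hz⟩ := key (-x) (by rw [bil_neg_left, bil_neg_right, neg_neg, hx])
      (by rw [vmat_neg]; simpa using h)
    have := hv_vsum_pos z
    rw [hz] at this
    simp only [vsum, Prod.fst_neg, Prod.snd_neg] at this hs
    linarith
  · exfalso
    have h1 := trace_vmat_mul x x
    have htr : vmat x 1 1 = -vmat x 0 0 := by simp [vmat]
    rw [hx, Matrix.trace, Fin.sum_univ_two] at h1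
    simp only [Matrix.diag_apply, Matrix.mul_apply, Fin.sum_univ_two, htr, h] at h1
    nlinarith [sq_nonneg (vmat x 0 0)]
  · exact key x hx h

/-! ### Geodesics -/

/-- The unit speed hyperbola through `p` in direction `v`. -/
def hyp (p v : ℝ × ℝ × ℝ) (t : ℝ) : ℝ × ℝ × ℝ := Real.cosh t • p + Real.sinh t • v

/-- `p` is a unit timelike vector and `v` a unit tangent vector at `p`. -/
structure IsFrame (p v : ℝ × ℝ × ℝ) : Prop where
  pp : bil rt p p = 1
  pv : bil rt p v = 0
  vv : bil rt v v = -1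

theorem bil_hyp (n p v : ℝ × ℝ × ℝ) (t : ℝ) : bil rt n (hyp p v t) =
    Real.cosh t * bil rt n p + Real.sinh t * bil rt n v := by
  simp only [hyp, bil_add_right, bil_smul_right]

theorem IsFrame.bil_hyp_hyp {p v : ℝ × ℝ × ℝ} (h : IsFrame p v) (s t : ℝ) :
    bil rt (hyp p v s) (hyp p v t) = Real.cosh (s - t) := by
  have h1 : bil rt v p = 0 := by rw [bil_comm, h.pv]
  rw [bil_hyp, bil_comm, bil_comm _ _ v, bil_hyp, bil_hyp, h.pp, h.pv, h.vv, h1, Real.cosh_sub]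
  ring

/-- The tangent vector is obtained from the points at times `0` and `1`. The difference between `hv
(c t)` and the hyperbola is orthogonal to `hv (c 0)` and has norm zero, hence vanishes because the
orthogonal complement is definite. -/
theorem exists_frame_of_isometry {c : ℝ → ℍ} (hc : Isometry c) :
    ∃ v, IsFrame (hv (c 0)) v ∧ ∀ t, hv (c t) = hyp (hv (c 0)) v t := by
  have hX : ∀ s t, bil rt (hv (c s)) (hv (c t)) = Real.cosh (s - t) := fun s t => by
    rw [bil_hv, hc.dist_eq, Real.dist_eq, Real.cosh_abs]
  have hs : Real.sinh 1 ≠ 0 := (Real.sinh_pos_iff.2 one_pos).ne'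
  set v := (Real.sinh 1)⁻¹ • (hv (c 1) + (-Real.cosh 1) • hv (c 0)) with hvdef
  have hv1 : ∀ t, bil rt v (hv (c t)) = -Real.sinh t := by
    intro t
    rw [hvdef, bil_smul_left, bil_add_left, bil_smul_left, hX, hX, zero_sub, Real.cosh_neg,
      Real.cosh_sub]
    field_simp
    ring
  have hvv : bil rt v v = -1 := by
    conv_lhs => rw [hvdef, bil_smul_left, bil_add_left, bil_smul_left, bil_comm, hv1, bil_comm,
      hv1]
    simp [hs]
  have hfr : IsFrame (hv (c 0)) v :=
    ⟨bil_hv_self _, by rw [bil_comm, hv1]; simp, hvv⟩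
  refine ⟨v, hfr, fun t => ?_⟩
  have h0 : hv (c t) + (-1 : ℝ) • hyp (hv (c 0)) v t = 0 := by
    apply eq_zero_of_orthogonal (x := hv (c 0)) (by rw [bil_hv_self]; exact one_pos)
    · rw [bil_add_right, bil_smul_right, bil_hyp, hX, bil_hv_self, hfr.pv, zero_sub,
        Real.cosh_neg]
      ring
    · apply le_of_eq
      have e1 : bil rt (hyp (hv (c 0)) v t) (hyp (hv (c 0)) v t) = 1 := by
        rw [hfr.bil_hyp_hyp]; simp
      have e2 : bil rt (hv (c t)) (hyp (hv (c 0)) v t) = 1 := by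
        rw [bil_hyp, hX, bil_comm, hv1, sub_zero]
        nlinarith [Real.cosh_sq t]
      rw [bil_add_left, bil_add_right, bil_add_right, bil_smul_left, bil_smul_left, bil_smul_right,
        bil_smul_right, e1, e2, bil_comm _ (hyp _ _ _), e2, bil_hv_self]
      ring
  rw [neg_one_smul] at h0
  exact add_neg_eq_zero.1 h0

theorem exists_isometry_of_frame {z : ℍ} {v : ℝ × ℝ × ℝ} (h : IsFrame (hv z) v) :
    ∃ c : ℝ → ℍ, Isometry c ∧ ∀ t, hv (c t) = hyp (hv z) v t := by
  have key : ∀ t, ∃ w : ℍ, hv w = hyp (hv z) v t := by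
    intro t
    have h1 : bil rt (hyp (hv z) v t) (hyp (hv z) v t) = 1 := by rw [h.bil_hyp_hyp]; simp
    have h2 : 0 < bil rt (hv z) (hyp (hv z) v t) := by
      rw [bil_hyp, h.pp, h.pv]
      have := Real.cosh_pos t
      linarith
    apply exists_hv_eq h1
    by_contra hcon
    have hne := vsum_ne_zero_of_bil_pos (x := hyp (hv z) v t) (by rw [h1]; exact one_pos)
    have h3 : 0 < vsum (-hyp (hv z) v t) := by
      have : vsum (hyp (hv z) v t) < 0 := lt_of_le_of_ne (not_lt.1 hcon) hne
      simp only [vsum, Prod.fst_neg, Prod.snd_neg] at this ⊢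
      linarith
    have h4 := bil_pos_of_vsum_pos (x := hv z) (y := -hyp (hv z) v t) (by rw [h.pp]; exact one_pos)
      (by rw [bil_neg_left, bil_neg_right, neg_neg, h1]; exact one_pos) (hv_vsum_pos z) h3
    rw [bil_neg_right] at h4
    linarith
  choose c hc using key
  refine ⟨c, Isometry.of_dist_eq fun s t => ?_, hc⟩
  have h1 := bil_hv (c s) (c t)
  rw [hc, hc, h.bil_hyp_hyp, ← Real.cosh_abs] at h1
  rw [Real.dist_eq]
  exact (Real.cosh_injOn (Set.mem_Ici.2 (abs_nonneg _)) (Set.mem_Ici.2 dist_nonneg) h1).symm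

theorem exists_mem_hyp {p v n x : ℝ × ℝ × ℝ} (h : IsFrame p v) (hn : bil rt n n < 0)
    (hnp : bil rt n p = 0) (hnv : bil rt n v = 0) (hnx : bil rt n x = 0)
    (hx : bil rt x x = 1) (hpx : 0 < bil rt p x) : ∃ t, x = hyp p v t := by
  set t := Real.arsinh (-bil rt v x) with ht
  have hst : Real.sinh t = -bil rt v x := Real.sinh_arsinh _
  have hvp : bil rt v p = 0 := by rw [bil_comm, h.pv]
  have hpn : bil rt p n = 0 := by rw [bil_comm, hnp]
  have hvn : bil rt v n = 0 := by rw [bil_comm, hnv]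
  set y := x + ((-bil rt p x) • p + bil rt v x • v) with hy
  have hyp' : bil rt p y = 0 := by
    simp only [hy, bil_add_right, bil_smul_right, h.pp, h.pv]; ring
  have hyv : bil rt v y = 0 := by
    simp only [hy, bil_add_right, bil_smul_right, h.vv, hvp]; ring
  have hyn : bil rt n y = 0 := by
    simp only [hy, bil_add_right, bil_smul_right, hnp, hnv, hnx]; ring
  -- The part `y` of `x` orthogonal to `p` and `v` is also orthogonal to `n`. As `v` and `n` are
  -- both negative, the Gram determinant forces `y` to have nonnegative norm, so `y = 0`.
  have hg := gram_nonneg y v n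
  rw [bil_comm _ y v, bil_comm _ y n, hyv, hyn, hvn, h.vv] at hg
  have hyy : 0 ≤ bil rt y y := by nlinarith
  have hy0 := eq_zero_of_orthogonal (by rw [h.pp]; exact one_pos) hyp' hyy
  have hx' : x = bil rt p x • p + (-bil rt v x) • v := by
    rw [hy, neg_smul] at hy0
    rw [neg_smul, ← sub_eq_zero, ← hy0]
    abel
  have hxx : bil rt p x ^ 2 - bil rt v x ^ 2 = 1 := by
    rw [← hx]
    conv_rhs => rw [hx', bil_add_left, bil_smul_left, bil_smul_left]
    rw [← hx']
    ring
  have hch : Real.cosh t = bil rt p x := by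
    have := Real.cosh_sq t
    refine (sq_eq_sq₀ (Real.cosh_pos t).le hpx.le).1 ?_
    rw [this, hst]
    linarith
  exact ⟨t, by rw [hyp, hch, hst]; exact hx'⟩

end

end BolzaLike

namespace BolzaLike

noncomputable section

/-! ### Hyperbolic translations -/

theorem vmat_mul_self (x : ℝ × ℝ × ℝ) :
    vmat x * vmat x = (-bil rt x x) • (1 : Matrix (Fin 2) (Fin 2) ℝ) := by
  rw [vmat_mul_vmat]
  have : vcross rt x x = 0 := by
    simp only [vcross]
    refine Prod.ext ?_ (Prod.ext ?_ ?_) <;> simp <;> ring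
  rw [this, show vmat 0 = 0 by ext i j; fin_cases i <;> fin_cases j <;> simp [vmat], add_zero]

theorem vmat_mul_of_orthogonal {x y : ℝ × ℝ × ℝ} (h : bil rt x y = 0) :
    vmat x * vmat y = vmat (vcross rt x y) := by
  rw [vmat_mul_vmat, h]; simp

theorem vcross_swap (x y : ℝ × ℝ × ℝ) : vcross rt y x = -vcross rt x y := by
  simp only [vcross]
  refine Prod.ext ?_ (Prod.ext ?_ ?_) <;> simp <;> ring

theorem bil_vcross_left (x y : ℝ × ℝ × ℝ) : bil rt (vcross rt x y) x = 0 := by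
  have h := rt_sq
  simp only [bil, vcross, vsum]
  grobner

theorem bil_vcross_right (x y : ℝ × ℝ × ℝ) : bil rt (vcross rt x y) y = 0 := by
  rw [vcross_swap, bil_neg_left, bil_vcross_left, neg_zero]

theorem IsFrame.bil_cross {p v : ℝ × ℝ × ℝ} (h : IsFrame p v) :
    bil rt (vcross rt p v) (vcross rt p v) = -1 := by
  have h1 := vmat_mul_self (vcross rt p v)
  have hvp : bil rt v p = 0 := by rw [bil_comm, h.pv]
  have e : vmat (vcross rt p v) * vmat (vcross rt p v) = 1 := by
    conv_lhs =>
      lhs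
      rw [← vmat_mul_of_orthogonal h.pv]
    rw [← neg_neg (vcross rt p v), ← vcross_swap, vmat_neg, ← vmat_mul_of_orthogonal hvp, mul_neg,
      mul_assoc, ← mul_assoc (vmat v), vmat_mul_self, h.vv]
    simp [vmat_mul_self, h.pp]
  rw [e] at h1
  have h2 := congrFun (congrFun h1 0) 0
  simp at h2
  linarith

theorem det_scalar_add_vmat (a : ℝ) (m : ℝ × ℝ × ℝ) :
    (a • (1 : Matrix (Fin 2) (Fin 2) ℝ) + vmat m).det = a ^ 2 + bil rt m m := by
  have h := trace_vmat_mul m m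
  have htr : vmat m 1 1 = -vmat m 0 0 := by simp [vmat]
  rw [Matrix.trace, Fin.sum_univ_two] at h
  simp only [Matrix.diag_apply, Matrix.mul_apply, Fin.sum_univ_two, htr] at h
  rw [Matrix.det_fin_two]
  simp [htr]
  linarith

/-- The element `a + m` of `SL(2, ℝ)` with scalar part `a` and vector part `m`. -/
def slMk (a : ℝ) (m : ℝ × ℝ × ℝ) (h : a ^ 2 + bil rt m m = 1) : SL(2, ℝ) :=
  ⟨a • 1 + vmat m, by rw [det_scalar_add_vmat, h]⟩

theorem slMk_coe (a : ℝ) (m : ℝ × ℝ × ℝ) (h : a ^ 2 + bil rt m m = 1) :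
    (slMk a m h : Matrix (Fin 2) (Fin 2) ℝ) = a • 1 + vmat m := rfl

theorem exists_decomposition (M : Matrix (Fin 2) (Fin 2) ℝ) :
    ∃ (a : ℝ) (m : ℝ × ℝ × ℝ), M = a • (1 : Matrix (Fin 2) (Fin 2) ℝ) + vmat m := by
  refine ⟨(M 0 0 + M 1 1) / 2,
    vcoord (M - ((M 0 0 + M 1 1) / 2) • (1 : Matrix (Fin 2) (Fin 2) ℝ)), ?_⟩
  rw [vmat_vcoord _ (by simp; ring)]
  abel

/-- The translation along a frame. -/
def transl {p v : ℝ × ℝ × ℝ} (h : IsFrame p v) (L : ℝ) : SL(2, ℝ) :=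
  slMk (Real.cosh (L / 2)) (Real.sinh (L / 2) • vcross rt p v) (by
    rw [bil_smul_left, bil_smul_right, h.bil_cross, Real.cosh_sq]; ring)

/-- The product of `p` and `v` squares to `1` and anticommutes with both of them, so conjugation by
`cosh (L/2) + sinh (L/2) * p v` is a boost by `L` in their plane. -/
theorem act_transl {p v : ℝ × ℝ × ℝ} (h : IsFrame p v) (L t : ℝ) :
    act (transl h L) (hyp p v t) = hyp p v (t + L) := by
  have hvp : bil rt v p = 0 := by rw [bil_comm, h.pv]
  have hP := vmat_mul_self p
  have hV := vmat_mul_self v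
  have hC := vmat_mul_of_orthogonal h.pv
  have hC' := vmat_mul_of_orthogonal hvp
  rw [vcross_swap, vmat_neg, ← hC] at hC'
  rw [h.pp] at hP
  rw [h.vv, neg_neg, one_smul] at hV
  rw [neg_one_smul] at hP
  apply act_eq_of_mul_eq
  rw [transl, slMk_coe, hyp, hyp, vmat_smul, vmat_add, vmat_add, vmat_smul, vmat_smul, vmat_smul,
    vmat_smul, ← hC]
  have e1 : vmat p * vmat v * vmat p = vmat v := by
    rw [mul_assoc, hC', mul_neg, ← mul_assoc, hP]; simp
  have e2 : vmat p * vmat v * vmat v = vmat p := by rw [mul_assoc, hV, mul_one]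
  have e3 : vmat p * (vmat p * vmat v) = -vmat v := by rw [← mul_assoc, hP]; simp
  have e4 : vmat v * (vmat p * vmat v) = -vmat p := by
    rw [← mul_assoc, hC', neg_mul, mul_assoc, hV, mul_one]
  simp only [add_mul, mul_add, smul_mul_assoc, mul_smul_comm, one_mul, mul_one, e1, e2, e3, e4,
    smul_neg, smul_add]
  have hL : L = L / 2 + L / 2 := by ring
  have c1 : Real.cosh (t + L) = Real.cosh t * (Real.cosh (L / 2) ^ 2 + Real.sinh (L / 2) ^ 2) +
      Real.sinh t * (2 * Real.sinh (L / 2) * Real.cosh (L / 2)) := by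
    conv_lhs => rw [Real.cosh_add, hL, Real.cosh_add, Real.sinh_add]
    ring
  have c2 : Real.sinh (t + L) = Real.sinh t * (Real.cosh (L / 2) ^ 2 + Real.sinh (L / 2) ^ 2) +
      Real.cosh t * (2 * Real.sinh (L / 2) * Real.cosh (L / 2)) := by
    conv_lhs => rw [Real.sinh_add, hL, Real.cosh_add, Real.sinh_add]
    ring
  rw [c1, c2]
  have hcs := Real.cosh_sq (L / 2)
  match_scalars <;> grobner

theorem act_eq_iff_commute {g : SL(2, ℝ)} {x : ℝ × ℝ × ℝ} : act g x = x ↔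
    (g : Matrix (Fin 2) (Fin 2) ℝ) * vmat x = vmat x * g :=
  ⟨fun h => by rw [← vmat_act_mul, h], act_eq_of_mul_eq⟩

theorem vmat_zero : vmat 0 = 0 := by ext i j; fin_cases i <;> fin_cases j <;> simp [vmat]

theorem eq_one_or_eq_neg_one {g : SL(2, ℝ)} {a : ℝ}
    (h : (g : Matrix (Fin 2) (Fin 2) ℝ) = a • 1) : g = 1 ∨ g = -1 := by
  have hd := g.det_coe
  rw [h] at hd
  simp at hd
  rcases hd with rfl | rfl
  · left; apply Subtype.ext; rw [h]; simp
  · right; apply Subtype.ext; rw [h]; simp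

/-- Commuting vectors have zero alternating product; multiplying by `x` once more then exhibits `m`
as a multiple of `x`. -/
theorem vector_part_of_commute {m x : ℝ × ℝ × ℝ} {b : ℝ} (hx : bil rt x x = b) (hb : b ≠ 0)
    (h : vmat m * vmat x = vmat x * vmat m) : m = (bil rt m x / b) • x := by
  have h1 : vcross rt m x = 0 := by
    rw [vmat_mul_vmat, vmat_mul_vmat, bil_comm, vcross_swap m x, vmat_neg] at h
    have h2 : vmat (vcross rt m x) = 0 := by
      have := add_left_cancel h
      have h3 : (2 : ℝ) • vmat (vcross rt m x) = 0 := by rw [two_smul]; nth_rw 1 [this]; simp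
      simpa using h3
    exact vmat_injective (h2.trans vmat_zero.symm)
  apply vmat_injective
  have h2 : vmat m * vmat x * vmat x = (-bil rt m x) • vmat x := by
    rw [vmat_mul_vmat, h1, vmat_zero]; simp
  rw [mul_assoc, vmat_mul_self, hx] at h2
  rw [vmat_smul, div_eq_inv_mul, mul_smul]
  have h3 : b • vmat m = bil rt m x • vmat x := by simpa using h2
  rw [← h3, smul_smul, inv_mul_cancel₀ hb, one_smul]

theorem IsFrame.eq_one_or_of_act {p v : ℝ × ℝ × ℝ} (h : IsFrame p v) {g : SL(2, ℝ)}
    (hp : act g p = p) (hv : act g v = v) : g = 1 ∨ g = -1 := by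
  obtain ⟨a, m, hm⟩ := exists_decomposition (g : Matrix (Fin 2) (Fin 2) ℝ)
  rw [act_eq_iff_commute, hm, add_mul, mul_add] at hp hv
  simp only [smul_mul_assoc, mul_smul_comm, one_mul, mul_one, add_right_inj] at hp hv
  have h1 := vector_part_of_commute h.pp one_ne_zero hp
  have h2 := vector_part_of_commute h.vv (by norm_num) hv
  have h3 : bil rt m p = 0 := by
    conv_lhs => rw [h2, bil_smul_left, bil_comm _ v p, h.pv, mul_zero]
  rw [h3, zero_div, zero_smul] at h1
  rw [h1, vmat_zero, add_zero] at hm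
  exact eq_one_or_eq_neg_one hm

theorem hyp_interpolate (p v : ℝ × ℝ × ℝ) (s t u : ℝ) : Real.sinh (t - s) • hyp p v u =
    Real.sinh (t - u) • hyp p v s + Real.sinh (u - s) • hyp p v t := by
  simp only [hyp, Real.sinh_sub]
  have h1 := Real.cosh_sq s
  have h2 := Real.cosh_sq t
  match_scalars <;> ring

theorem hyp_eq_zero_smul (p v : ℝ × ℝ × ℝ) : hyp p v 0 = p := by simp [hyp]

/-- Every point of a hyperbola is a fixed linear combination of two given ones, and the action is
linear. -/
theorem act_hyp_of_two {p v q w : ℝ × ℝ × ℝ} {g : SL(2, ℝ)} {s t s' : ℝ} (hst : s ≠ t)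
    (h1 : act g (hyp p v s) = hyp q w (s + s')) (h2 : act g (hyp p v t) = hyp q w (t + s'))
    (u : ℝ) : act g (hyp p v u) = hyp q w (u + s') := by
  have h0 : Real.sinh (t - s) ≠ 0 := by
    rw [Ne, Real.sinh_eq_zero, sub_eq_zero]; exact hst.symm
  have e1 := hyp_interpolate p v s t u
  have e2 := hyp_interpolate q w (s + s') (t + s') (u + s')
  have e3 := congrArg (act g) e1
  simp only [act_smul, act_add, h1, h2] at e3
  simp only [add_sub_add_right_eq_sub] at e2
  rw [← e2] at e3
  exact smul_right_injective _ h0 e3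

theorem IsFrame.eq_transl_of_act {p v : ℝ × ℝ × ℝ} (h : IsFrame p v) {g : SL(2, ℝ)} {L : ℝ}
    (hg : ∀ t, act g (hyp p v t) = hyp p v (t + L)) : g = transl h L ∨ g = -transl h L := by
  have key : ∀ t, act ((transl h L)⁻¹ * g) (hyp p v t) = hyp p v t := by
    intro t
    rw [act_mul, hg, ← act_transl h, act_inv_act]
  have hp := key 0
  rw [hyp_eq_zero_smul] at hp
  have hv : act ((transl h L)⁻¹ * g) v = v := by
    have h1 := key 1
    rw [hyp, act_add, act_smul, act_smul, hp] at h1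
    exact smul_right_injective _ (Real.sinh_pos_iff.2 one_pos).ne' (add_left_cancel h1)
  rcases h.eq_one_or_of_act hp hv with h1 | h1
  · left; rw [inv_mul_eq_one] at h1; exact h1.symm
  · right; rw [inv_mul_eq_iff_eq_mul] at h1; rw [h1, mul_neg_one]

/-! ### Countable groups -/

/-- This pigeonhole principle stands in for covering theory: of the group elements chosen separately
for each time, two coincide, and agreement at two points of a geodesic is agreement along all of it.
-/
theorem exists_ne_of_countable {ι : Type*} [Countable ι] (f : ℝ → ι) :
    ∃ s t, s ≠ t ∧ f s = f t := by
  by_contra! h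
  have : Function.Injective f := fun s t hst => by
    by_contra hne
    exact h s t hne hst
  exact not_countable (α := ℝ) this.countable

theorem proj_eq_iff {Γ : Subgroup SL(2, ℝ)} {z w : ℍ} :
    proj Γ z = proj Γ w ↔ ∃ g ∈ Γ, g • w = z := by
  rw [proj, proj, Quotient.eq, MulAction.orbitRel_apply, MulAction.mem_orbit_iff]
  exact ⟨fun ⟨g, h⟩ => ⟨g, g.2, h⟩, fun ⟨g, hg, h⟩ => ⟨⟨g, hg⟩, h⟩⟩

theorem exists_deck_of_periodic {Γ : Subgroup SL(2, ℝ)} [Countable Γ] {c : ℝ → ℍ}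
    (hc : Isometry c) {L : ℝ} (h : ∀ t, proj Γ (c (t + L)) = proj Γ (c t)) :
    ∃ g ∈ Γ, ∀ t, g • c t = c (t + L) := by
  have h' : ∀ t, ∃ g : Γ, (g : SL(2, ℝ)) • c t = c (t + L) := fun t => by
    obtain ⟨g, hg, e⟩ := proj_eq_iff.1 (h t)
    exact ⟨⟨g, hg⟩, e⟩
  choose f hf using h'
  obtain ⟨s, t, hst, e⟩ := exists_ne_of_countable f
  obtain ⟨v, hv, hct⟩ := exists_frame_of_isometry hc
  refine ⟨f s, (f s).2, fun u => hv_injective ?_⟩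
  rw [hv_smul, hct u, hct (u + L)]
  refine act_hyp_of_two hst ?_ ?_ u
  · rw [← hct s, ← hct (s + L), ← hv_smul, hf]
  · rw [← hct t, ← hct (t + L), ← hv_smul, e, hf]

end

end BolzaLike

namespace BolzaLike

noncomputable section

/-! ### The ring `ℤ[√3]` and its two real embeddings -/

abbrev Z3 : Type := Zsqrtd 3

/-- The square root of three in `ℤ[√3]`. -/
abbrev tz : Z3 := Zsqrtd.sqrtd

theorem tz_sq : tz ^ 2 = 3 := by rw [pow_two, Zsqrtd.dmuld]; rfl

/-- The embedding of `ℤ[√3]` into `ℝ` with `√3 ↦ √3`. -/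
def emb : Z3 →+* ℝ := Zsqrtd.lift ⟨rt, by rw [rt_mul_self]; norm_num⟩

/-- The embedding of `ℤ[√3]` into `ℝ` with `√3 ↦ -√3`. -/
def cmb : Z3 →+* ℝ := Zsqrtd.lift ⟨-rt, by rw [neg_mul_neg, rt_mul_self]; norm_num⟩

theorem emb_apply (x : Z3) : emb x = x.re + x.im * rt := rfl

theorem cmb_apply (x : Z3) : cmb x = x.re - x.im * rt := by
  change (x.re : ℝ) + x.im * -rt = _
  ring

theorem emb_tz : emb tz = rt := by rw [emb_apply]; simp

theorem cmb_tz : cmb tz = -rt := by rw [cmb_apply]; simp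

theorem emb_injective : Function.Injective emb :=
  Zsqrtd.lift_injective _ (fun n h => by
    have h1 : n ≤ 1 := by nlinarith
    have h2 : -1 ≤ n := by nlinarith
    interval_cases n <;> omega)

/-- Coordinatewise embedding of integral vectors. -/
def embv (x : Z3 × Z3 × Z3) : ℝ × ℝ × ℝ := (emb x.1, emb x.2.1, emb x.2.2)

/-- Coordinatewise conjugate embedding of integral vectors. -/
def cmbv (x : Z3 × Z3 × Z3) : ℝ × ℝ × ℝ := (cmb x.1, cmb x.2.1, cmb x.2.2)

theorem emb_bil (x y : Z3 × Z3 × Z3) : bil rt (embv x) (embv y) = emb (bil tz x y) := by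
  simp only [bil, vsum, embv, map_add, map_sub, map_mul, emb_tz, map_ofNat]

theorem cmb_bil (x y : Z3 × Z3 × Z3) : bil (-rt) (cmbv x) (cmbv y) = cmb (bil tz x y) := by
  simp only [bil, vsum, cmbv, map_add, map_sub, map_mul, cmb_tz, map_ofNat]

theorem embv_neg (x : Z3 × Z3 × Z3) : embv (-x) = -embv x := by
  simp [embv]

theorem cmbv_neg (x : Z3 × Z3 × Z3) : cmbv (-x) = -cmbv x := by
  simp [cmbv]

theorem cmbv_add (x y : Z3 × Z3 × Z3) : cmbv (x + y) = cmbv x + cmbv y := by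
  simp [cmbv]

/-- The constant `7 - 4√3` is the smallest eigenvalue of the conjugate form. The difference of the
two sides is `2√3 - 3` times the sum of the squared coordinate differences. Positive definiteness
here is what makes the integral structure discrete. -/
theorem bil_conj_ge (x : ℝ × ℝ × ℝ) :
    (7 - 4 * rt) * (x.1 ^ 2 + x.2.1 ^ 2 + x.2.2 ^ 2) ≤ bil (-rt) x x := by
  have h := rt_bounds.1
  simp only [bil, vsum]
  nlinarith [mul_nonneg (show 0 ≤ 2 * rt - 3 by linarith) (sq_nonneg (x.1 - x.2.1)),
    mul_nonneg (show 0 ≤ 2 * rt - 3 by linarith) (sq_nonneg (x.1 - x.2.2)),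
    mul_nonneg (show 0 ≤ 2 * rt - 3 by linarith) (sq_nonneg (x.2.1 - x.2.2))]

theorem seven_sub_pos : 0 < 7 - 4 * rt := by linarith [rt_bounds.2]

theorem bil_conj_nonneg (x : ℝ × ℝ × ℝ) : 0 ≤ bil (-rt) x x :=
  le_trans (mul_nonneg seven_sub_pos.le (by positivity)) (bil_conj_ge x)

theorem eq_zero_of_bil_conj {x : ℝ × ℝ × ℝ} (h : bil (-rt) x x ≤ 0) : x = 0 := by
  have h1 := bil_conj_ge x
  have h2 := seven_sub_pos
  have h3 : x.1 ^ 2 + x.2.1 ^ 2 + x.2.2 ^ 2 ≤ 0 := by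
    by_contra hcon
    nlinarith [mul_pos h2 (not_le.1 hcon)]
  have e1 : x.1 = 0 := by nlinarith [sq_nonneg x.1, sq_nonneg x.2.1, sq_nonneg x.2.2]
  have e2 : x.2.1 = 0 := by nlinarith [sq_nonneg x.1, sq_nonneg x.2.1, sq_nonneg x.2.2]
  have e3 : x.2.2 = 0 := by nlinarith [sq_nonneg x.1, sq_nonneg x.2.1, sq_nonneg x.2.2]
  exact Prod.ext e1 (Prod.ext e2 e3)

theorem cmb_injective : Function.Injective cmb := fun x y h => by
  have h1 : emb (star x) = emb (star y) := by
    rw [emb_apply, emb_apply, Zsqrtd.re_star, Zsqrtd.re_star, Zsqrtd.im_star, Zsqrtd.im_star]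
    rw [cmb_apply, cmb_apply] at h
    push_cast
    linarith
  exact star_injective (emb_injective h1)

theorem eq_zero_of_cmbv {x : Z3 × Z3 × Z3} (h : cmbv x = 0) : x = 0 := by
  have h1 := congrArg Prod.fst h
  have h2 := congrArg (fun y => y.2.1) h
  have h3 := congrArg (fun y => y.2.2) h
  simp only [cmbv, Prod.fst_zero, Prod.snd_zero] at h1 h2 h3
  exact Prod.ext (cmb_injective (by simpa using h1))
    (Prod.ext (cmb_injective (by simpa using h2)) (cmb_injective (by simpa using h3)))

theorem bil_conj_sq_le (x y : ℝ × ℝ × ℝ) :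
    bil (-rt) x y ^ 2 ≤ bil (-rt) x x * bil (-rt) y y := by
  have h := fun s : ℝ => bil_conj_nonneg (s • x + y)
  simp only [bil_add_left, bil_add_right, bil_smul_left, bil_smul_right, bil_comm _ y x] at h
  have h' : discrim (bil (-rt) x x) (2 * bil (-rt) x y) (bil (-rt) y y) ≤ 0 :=
    discrim_le_zero fun s => by have := h s; nlinarith
  rw [discrim] at h'
  linarith

/-! ### Finiteness -/

theorem finite_bounded_int (C : ℝ) : {x : Z3 | |emb x| ≤ C ∧ |cmb x| ≤ C}.Finite := by
  have hf : ((fun p : ℤ × ℤ => (⟨p.1, p.2⟩ : Z3)) ''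
      (Set.Icc (-⌈C⌉) ⌈C⌉ ×ˢ Set.Icc (-⌈C⌉) ⌈C⌉)).Finite :=
    ((Set.finite_Icc _ _).prod (Set.finite_Icc _ _)).image _
  refine hf.subset ?_
  rintro ⟨a, b⟩ ⟨h1, h2⟩
  rw [emb_apply] at h1
  rw [cmb_apply] at h2
  obtain ⟨h1, h1'⟩ := abs_le.1 h1
  obtain ⟨h2, h2'⟩ := abs_le.1 h2
  have hC := Int.le_ceil C
  have hr := rt_bounds.1
  simp only at h1 h1' h2 h2'
  refine ⟨(a, b), ⟨⟨?_, ?_⟩, ⟨?_, ?_⟩⟩, rfl⟩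
  · have : (-⌈C⌉ : ℝ) ≤ a := by linarith
    exact_mod_cast this
  · have : (a : ℝ) ≤ ⌈C⌉ := by linarith
    exact_mod_cast this
  · have : (-⌈C⌉ : ℝ) ≤ b := by
      by_contra hcon
      nlinarith
    exact_mod_cast this
  · have : (b : ℝ) ≤ ⌈C⌉ := by
      by_contra hcon
      nlinarith
    exact_mod_cast this

theorem finite_bounded_vec (C : ℝ) : {x : Z3 × Z3 × Z3 |
    (|emb x.1| ≤ C ∧ |cmb x.1| ≤ C) ∧ (|emb x.2.1| ≤ C ∧ |cmb x.2.1| ≤ C) ∧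
      (|emb x.2.2| ≤ C ∧ |cmb x.2.2| ≤ C)}.Finite :=
  ((finite_bounded_int C).prod ((finite_bounded_int C).prod (finite_bounded_int C))).subset
    fun _ h => h

theorem coord_bound_conj {x : Z3 × Z3 × Z3} {Q : Z3} (h : bil tz x x = Q) :
    |cmb x.1| ≤ 1 + cmb Q / (7 - 4 * rt) ∧ |cmb x.2.1| ≤ 1 + cmb Q / (7 - 4 * rt) ∧
      |cmb x.2.2| ≤ 1 + cmb Q / (7 - 4 * rt) := by
  have h1 := bil_conj_ge (cmbv x)
  rw [cmb_bil, h, mul_comm, ← le_div_iff₀ seven_sub_pos] at h1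
  simp only [cmbv] at h1
  -- A crude bound that avoids square roots.
  have key : ∀ a K : ℝ, a ^ 2 ≤ K → |a| ≤ 1 + K := fun a K hK =>
    abs_le.2 ⟨by nlinarith [sq_nonneg (a + 1)], by nlinarith [sq_nonneg (a - 1)]⟩
  refine ⟨key _ _ ?_, key _ _ ?_, key _ _ ?_⟩ <;>
    nlinarith [sq_nonneg (cmb x.1), sq_nonneg (cmb x.2.1), sq_nonneg (cmb x.2.2)]

theorem gram_hv (n : ℝ × ℝ × ℝ) (z w : ℍ) :
    bil rt n (hv z) ^ 2 + bil rt n (hv w) ^ 2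
      - 2 * Real.cosh (dist z w) * (bil rt n (hv z) * bil rt n (hv w)) ≤
    -bil rt n n * (Real.cosh (dist z w) ^ 2 - 1) := by
  have h := gram_nonneg n (hv z) (hv w)
  rw [bil_hv_self, bil_hv_self, bil_hv z w] at h
  linarith

/-- By the Gram inequality, a bound on the product with one point of `ℍ` gives bounds on the
products with `A`, `B`, `C`, hence on the coordinates. The norm `Q` bounds the conjugate
coordinates, and only finitely many elements of `ℤ[√3]` satisfy both bounds. -/
theorem finite_bil_bounded (Q : Z3) (z : ℍ) (M : ℝ) :
    {n : Z3 × Z3 × Z3 | bil tz n n = Q ∧ |bil rt (embv n) (hv z)| ≤ M}.Finite := by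
  have hK : ∀ w : ℍ, ∃ K, ∀ n : Z3 × Z3 × Z3, bil tz n n = Q → |bil rt (embv n) (hv z)| ≤ M →
      |bil rt (embv n) (hv w)| ≤ K := by
    intro w
    set D := Real.cosh (dist z w)
    have hD : 1 ≤ D := Real.one_le_cosh _
    refine ⟨1 + (2 * ((D ^ 2 - 1) * (|emb Q| + M ^ 2)) + 2 * (D ^ 2 * M ^ 2)), fun n hn hM => ?_⟩
    have h1 := gram_hv (embv n) z w
    rw [emb_bil, hn] at h1
    set a := bil rt (embv n) (hv z)
    set b := bil rt (embv n) (hv w)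
    have ha : a ^ 2 ≤ M ^ 2 := sq_le_sq' (neg_le_of_abs_le hM) (le_of_abs_le hM)
    have hQ : -emb Q ≤ |emb Q| := neg_le_abs _
    have hD2 : 0 ≤ D ^ 2 - 1 := by nlinarith
    have h2 : (b - D * a) ^ 2 ≤ (D ^ 2 - 1) * (|emb Q| + M ^ 2) := by
      have : (b - D * a) ^ 2 ≤ (D ^ 2 - 1) * (-emb Q + a ^ 2) := by
        change a ^ 2 + b ^ 2 - 2 * D * (a * b) ≤ -emb Q * (D ^ 2 - 1) at h1
        linarith
      exact this.trans (mul_le_mul_of_nonneg_left (by linarith) hD2)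
    have h3 : b ^ 2 ≤ 2 * ((D ^ 2 - 1) * (|emb Q| + M ^ 2)) + 2 * (D ^ 2 * M ^ 2) := by
      have := mul_le_mul_of_nonneg_left ha (sq_nonneg D)
      nlinarith [sq_nonneg (b - D * a - D * a)]
    exact abs_le.2 ⟨by nlinarith [sq_nonneg (b + 1)], by nlinarith [sq_nonneg (b - 1)]⟩
  obtain ⟨KA, hA⟩ := hK (vertexA eqAngle)
  obtain ⟨KB, hB⟩ := hK (vertexB eqAngle)
  obtain ⟨KC, hC⟩ := hK (vertexC eqAngle)
  set K := max KA (max KB KC)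
  refine (finite_bounded_vec (max (3 * K) (1 + cmb Q / (7 - 4 * rt)))).subset ?_
  rintro n ⟨hn, hM⟩
  obtain ⟨c1, c2, c3⟩ := coord_bound_conj hn
  have a1 := abs_le.1 ((hA n hn hM).trans (le_max_left KA (max KB KC)))
  have a2 := abs_le.1 ((hB n hn hM).trans ((le_max_left _ _).trans (le_max_right KA (max KB KC))))
  have a3 := abs_le.1 ((hC n hn hM).trans ((le_max_right _ _).trans (le_max_right KA (max KB KC))))
  rw [hv_vertexA] at a1
  rw [hv_vertexB] at a2
  rw [hv_vertexC] at a3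
  change -K ≤ _ ∧ _ ≤ K at a1
  change -K ≤ _ ∧ _ ≤ K at a2
  change -K ≤ _ ∧ _ ≤ K at a3
  simp only [bil, vsum, embv] at a1 a2 a3
  have hr := rt_bounds.1
  have hr2 := rt_bounds.2
  have hK0 : 0 ≤ K := by linarith
  simp only [Set.mem_ofPred_eq]
  generalize emb n.1 = x at *
  generalize emb n.2.1 = y at *
  generalize emb n.2.2 = u at *
  have hs : |x + y + u| ≤ K := by
    rw [abs_le]
    constructor <;> by_contra hcon <;> nlinarith
  have hs' : |(3 + 2 * rt) * (x + y + u)| ≤ 7 * K := by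
    rw [abs_mul, abs_of_pos (by linarith)]
    nlinarith [abs_nonneg (x + y + u)]
  rw [abs_le] at hs'
  have hcoord : ∀ a b : ℝ, -(7 * K) ≤ b → b ≤ 7 * K → -K ≤ b - (2 + 2 * rt) * a →
      b - (2 + 2 * rt) * a ≤ K → |a| ≤ 3 * K := by
    intro a b h1 h2 h3 h4
    rw [abs_le]
    constructor <;> by_contra hcon <;> nlinarith
  have b1 := hcoord x _ hs'.1 hs'.2 (by linarith) (by linarith)
  have b2 := hcoord y _ hs'.1 hs'.2 (by linarith) (by linarith)
  have b3 := hcoord u _ hs'.1 hs'.2 (by linarith) (by linarith)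
  exact ⟨⟨le_max_of_le_left b1, le_max_of_le_right c1⟩, ⟨le_max_of_le_left b2,
    le_max_of_le_right c2⟩, ⟨le_max_of_le_left b3, le_max_of_le_right c3⟩⟩

/-- When the two products have opposite signs, no cancellation is possible in the Gram inequality,
and each of them is bounded by the norm and the distance. -/
theorem finite_separating (Q : Z3) (z w : ℍ) :
    {n : Z3 × Z3 × Z3 | bil tz n n = Q ∧
      bil rt (embv n) (hv z) * bil rt (embv n) (hv w) ≤ 0}.Finite := by
  set D := Real.cosh (dist z w)
  have hD : 0 < D := Real.cosh_pos _
  refine (finite_bil_bounded Q z (1 + -emb Q * (D ^ 2 - 1))).subset ?_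
  rintro n ⟨hn, h⟩
  refine ⟨hn, ?_⟩
  have h1 := gram_hv (embv n) z w
  rw [emb_bil, hn] at h1
  set a := bil rt (embv n) (hv z)
  set b := bil rt (embv n) (hv w)
  change a ^ 2 + b ^ 2 - 2 * D * (a * b) ≤ -emb Q * (D ^ 2 - 1) at h1
  have h2 : a ^ 2 ≤ -emb Q * (D ^ 2 - 1) := by nlinarith [sq_nonneg b]
  exact abs_le.2 ⟨by nlinarith [sq_nonneg (a + 1)], by nlinarith [sq_nonneg (a - 1)]⟩

end

end BolzaLike

namespace BolzaLike

noncomputable section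

/-! ### The group generated by the half-turns about the midpoints of the edges -/

/-- The group generated by the half-turns about the midpoints of the sides of `ABC`. -/
def gridGroup : Subgroup SL(2, ℝ) := Subgroup.closure {mJ, mJ * mU, mV * mJ}

theorem mJ_mem : mJ ∈ gridGroup := Subgroup.subset_closure (by simp)

theorem mJU_mem : mJ * mU ∈ gridGroup := Subgroup.subset_closure (by simp)

theorem mVJ_mem : mV * mJ ∈ gridGroup := Subgroup.subset_closure (by simp)

theorem mU_mem : mU ∈ gridGroup := by
  have := mul_mem (inv_mem mJ_mem) mJU_mem
  rwa [inv_mul_cancel_left] at this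

theorem mV_mem : mV ∈ gridGroup := by
  have := mul_mem mVJ_mem (inv_mem mJ_mem)
  rwa [mul_inv_cancel_right] at this

theorem act_mJU_mJU (x : ℝ × ℝ × ℝ) : act (mJ * mU) (act (mJ * mU) x) = x := by
  rw [act_mJU, act_mJU]
  refine Prod.ext ?_ (Prod.ext ?_ ?_) <;> simp

theorem act_mVJ_mVJ (x : ℝ × ℝ × ℝ) : act (mV * mJ) (act (mV * mJ) x) = x := by
  rw [act_mVJ, act_mVJ]
  refine Prod.ext ?_ (Prod.ext ?_ ?_) <;> simp

/-- The three generators act as involutions, so inverses need no separate hypotheses. -/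
theorem gridGroup_invariant {S : Set (ℝ × ℝ × ℝ)} (h0 : ∀ x ∈ S, act mJ x ∈ S)
    (h1 : ∀ x ∈ S, act (mJ * mU) x ∈ S) (h2 : ∀ x ∈ S, act (mV * mJ) x ∈ S)
    {g : SL(2, ℝ)} (hg : g ∈ gridGroup) {x : ℝ × ℝ × ℝ} (hx : x ∈ S) : act g x ∈ S := by
  have inv_of : ∀ k : SL(2, ℝ), (∀ y, act k (act k y) = y) → ∀ y, act k⁻¹ y = act k y :=
    fun k hk y => by nth_rw 1 [← hk y]; rw [act_inv_act]
  suffices h : (∀ y ∈ S, act g y ∈ S) ∧ ∀ y ∈ S, act g⁻¹ y ∈ S from h.1 x hx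
  induction hg using Subgroup.closure_induction with
  | mem k hk =>
    simp only [Set.mem_insert_iff, Set.mem_singleton_iff] at hk
    rcases hk with rfl | rfl | rfl
    · exact ⟨h0, fun y hy => by rw [inv_of _ act_mJ_mJ]; exact h0 y hy⟩
    · exact ⟨h1, fun y hy => by rw [inv_of _ act_mJU_mJU]; exact h1 y hy⟩
    · exact ⟨h2, fun y hy => by rw [inv_of _ act_mVJ_mVJ]; exact h2 y hy⟩
  | one => simp [act_one]
  | mul a b _ _ ha hb =>
    refine ⟨fun y hy => ?_, fun y hy => ?_⟩
    · rw [act_mul]; exact ha.1 _ (hb.1 _ hy)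
    · rw [mul_inv_rev, act_mul]; exact hb.2 _ (ha.2 _ hy)
  | inv a _ ha => exact ⟨ha.2, by rw [inv_inv]; exact ha.1⟩

theorem act_mJ_embv (n : Z3 × Z3 × Z3) :
    act mJ (embv n) = embv (n.2.2 + tz * n.2.1, -n.2.1, n.1 + tz * n.2.1) := by
  rw [act_mJ]; simp [embv, emb_tz]

theorem act_mJU_embv (n : Z3 × Z3 × Z3) : act (mJ * mU) (embv n) =
    embv (n.2.1 + tz * n.2.2, n.1 + tz * n.2.2, -n.2.2) := by
  rw [act_mJU]; simp [embv, emb_tz]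

theorem act_mVJ_embv (n : Z3 × Z3 × Z3) : act (mV * mJ) (embv n) =
    embv (-n.1, n.2.2 + tz * n.1, n.2.1 + tz * n.1) := by
  rw [act_mVJ]; simp [embv, emb_tz]

theorem act_range_embv {g : SL(2, ℝ)} (hg : g ∈ gridGroup) (n : Z3 × Z3 × Z3) :
    ∃ n', act g (embv n) = embv n' := by
  have := gridGroup_invariant (S := Set.range embv) (by rintro _ ⟨n, rfl⟩; exact ⟨_, (act_mJ_embv n).symm⟩)
    (by rintro _ ⟨n, rfl⟩; exact ⟨_, (act_mJU_embv n).symm⟩)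
    (by rintro _ ⟨n, rfl⟩; exact ⟨_, (act_mVJ_embv n).symm⟩) hg ⟨n, rfl⟩
  obtain ⟨n', h⟩ := this
  exact ⟨n', h.symm⟩

theorem bil_of_act_embv {g : SL(2, ℝ)} {n n' : Z3 × Z3 × Z3} (h : act g (embv n) = embv n') :
    bil tz n' n' = bil tz n n := by
  apply emb_injective
  rw [← emb_bil, ← emb_bil, ← h, bil_act]

theorem embv_e0 : embv (1, 0, 0) = (1, 0, 0) := by simp [embv]

theorem embv_e1 : embv (0, 1, 0) = (0, 1, 0) := by simp [embv]

theorem embv_e2 : embv (0, 0, 1) = (0, 0, 1) := by simp [embv]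

/-! ### The triangle is a fundamental domain up to symmetry -/

theorem vsum_hv_eq (x : ℝ × ℝ × ℝ) : (7 + 4 * rt) * vsum x =
    bil rt x (1, 0, 0) + bil rt x (0, 1, 0) + bil rt x (0, 0, 1) := by
  simp only [bil, vsum]; ring

/-- The coordinate sum of a point is, up to a factor, the sum of its products with `A`, `B`, `C`.
Moving the group element to the other side makes these products of `z` with integral vectors of norm
one, of which finitely many are relevant. -/
theorem finite_vsum_orbit (z : ℍ) (M : ℝ) :
    {s : ℝ | ∃ g ∈ gridGroup, s = vsum (act g (hv z)) ∧ s ≤ M}.Finite := by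
  have hF := finite_bil_bounded 1 z ((7 + 4 * rt) * M)
  set F := {n : Z3 × Z3 × Z3 | bil tz n n = 1 ∧ |bil rt (embv n) (hv z)| ≤ (7 + 4 * rt) * M}
  have h7 : 0 < 7 + 4 * rt := by linarith [rt_bounds.1]
  refine ((hF.prod (hF.prod hF)).image (fun p => (bil rt (embv p.1) (hv z) +
    bil rt (embv p.2.1) (hv z) + bil rt (embv p.2.2) (hv z)) / (7 + 4 * rt))).subset ?_
  rintro s ⟨g, hg, rfl, hs⟩
  have hinv : ∀ w : ℍ, bil rt (act g (hv z)) (hv w) = bil rt (act g⁻¹ (hv w)) (hv z) := by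
    intro w
    rw [← bil_act g⁻¹, act_inv_act, bil_comm]
  have hpos : ∀ w : ℍ, 0 < bil rt (act g⁻¹ (hv w)) (hv z) := fun w => by
    rw [← hv_smul]; exact bil_hv_pos _ _
  obtain ⟨n0, e0⟩ := act_range_embv (inv_mem hg) (1, 0, 0)
  obtain ⟨n1, e1⟩ := act_range_embv (inv_mem hg) (0, 1, 0)
  obtain ⟨n2, e2⟩ := act_range_embv (inv_mem hg) (0, 0, 1)
  have b0 := bil_of_act_embv e0
  have b1 := bil_of_act_embv e1
  have b2 := bil_of_act_embv e2
  rw [embv_e0] at e0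
  rw [embv_e1] at e1
  rw [embv_e2] at e2
  have hsum := vsum_hv_eq (act g (hv z))
  rw [← hv_vertexA, ← hv_vertexB, ← hv_vertexC, hinv, hinv, hinv] at hsum
  have p0 := hpos (vertexA eqAngle)
  have p1 := hpos (vertexB eqAngle)
  have p2 := hpos (vertexC eqAngle)
  have hM : (7 + 4 * rt) * vsum (act g (hv z)) ≤ (7 + 4 * rt) * M :=
    mul_le_mul_of_nonneg_left hs h7.le
  rw [hv_vertexA, e0] at p0 hsum
  rw [hv_vertexB, e1] at p1 hsum
  rw [hv_vertexC, e2] at p2 hsum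
  refine ⟨(n0, n1, n2), ⟨⟨?_, ?_⟩, ⟨?_, ?_⟩, ⟨?_, ?_⟩⟩, ?_⟩
  · rw [b0]; simp [bil, vsum]; ring
  · rw [abs_of_pos p0]; linarith
  · rw [b1]; simp [bil, vsum]; ring
  · rw [abs_of_pos p1]; linarith
  · rw [b2]; simp [bil, vsum]; ring
  · rw [abs_of_pos p2]; linarith
  · simp only
    rw [← hsum, mul_div_cancel_left₀ _ h7.ne']

/-- Take the point of the orbit with smallest coordinate sum. Each of the three half-turns changes
this sum by `2√3 - 2` times one coordinate, so minimality makes all coordinates nonnegative. -/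
theorem exists_grid_nonneg (z : ℍ) : ∃ g ∈ gridGroup,
    0 ≤ (hv (g • z)).1 ∧ 0 ≤ (hv (g • z)).2.1 ∧ 0 ≤ (hv (g • z)).2.2 := by
  obtain ⟨s, ⟨g, hg, hgs, hs⟩, hmin⟩ := Set.exists_min_image _ id
    (finite_vsum_orbit z (vsum (hv z))) ⟨vsum (hv z), 1, one_mem _, by rw [act_one], le_rfl⟩
  have key : ∀ k ∈ gridGroup, vsum (act g (hv z)) ≤ vsum (act k (act g (hv z))) := by
    intro k hk
    by_contra hcon
    push Not at hcon
    rw [← act_mul] at hcon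
    have h2 := hmin (vsum (act (k * g) (hv z))) ⟨k * g, mul_mem hk hg, rfl, by linarith⟩
    simp only [id] at h2
    linarith
  have h0 := key _ mJ_mem
  have h1 := key _ mJU_mem
  have h2 := key _ mVJ_mem
  rw [act_mJ] at h0
  rw [act_mJU] at h1
  rw [act_mVJ] at h2
  have hr := rt_bounds.1
  simp only [vsum] at h0 h1 h2
  refine ⟨g, hg, ?_⟩
  rw [hv_smul]
  refine ⟨?_, ?_, ?_⟩ <;> by_contra hcon <;> push Not at hcon <;> nlinarith

/-! ### Vertices -/

/-- The vertices of the triangulation: the points with integral coordinates. -/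
def IsVertex (z : ℍ) : Prop := ∃ n, hv z = embv n

theorem IsVertex.smul {z : ℍ} (h : IsVertex z) {g : SL(2, ℝ)} (hg : g ∈ gridGroup) :
    IsVertex (g • z) := by
  obtain ⟨n, hn⟩ := h
  obtain ⟨n', hn'⟩ := act_range_embv hg n
  exact ⟨n', by rw [hv_smul, hn, hn']⟩

/-- The nearest exception is `1 - √3`, whose conjugate `1 + √3` exceeds `2.3`. -/
theorem eq_zero_of_emb_lt_one {n : Z3} (h1 : |emb n| < 1) (h2 : cmb n ^ 2 ≤ 5.2) : n = 0 := by
  rw [emb_apply] at h1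
  rw [cmb_apply] at h2
  obtain ⟨h1, h1'⟩ := abs_lt.1 h1
  have hr := rt_bounds.1
  have h3 : |(n.re : ℝ) - n.im * rt| < 2.3 := abs_lt_of_sq_lt_sq (by linarith) (by norm_num)
  obtain ⟨h3, h3'⟩ := abs_lt.1 h3
  have i1 : n.im < 1 := by
    by_contra hcon
    have : (1 : ℝ) ≤ n.im := by exact_mod_cast not_lt.1 hcon
    nlinarith
  have i2 : -1 < n.im := by
    by_contra hcon
    have : (n.im : ℝ) ≤ -1 := by exact_mod_cast not_lt.1 hcon
    nlinarith
  have i0 : n.im = 0 := by omega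
  rw [i0] at h1 h1'
  simp only [Int.cast_zero, zero_mul, add_zero] at h1 h1'
  have j1 : n.re < 1 := by exact_mod_cast h1'
  have j2 : -1 < n.re := by exact_mod_cast h1
  exact Zsqrtd.ext (by simp; omega) (by simp [i0])

theorem conj_coord_sq_le {n : Z3 × Z3 × Z3} (h : bil tz n n = 1) :
    cmb n.1 ^ 2 ≤ 5.2 ∧ cmb n.2.1 ^ 2 ≤ 5.2 ∧ cmb n.2.2 ^ 2 ≤ 5.2 := by
  have hn : bil (-rt) (cmbv n) (cmbv n) = 1 := by rw [cmb_bil, h, map_one]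
  have hr := rt_bounds.1
  have hr' := rt_bounds.2
  have hsq := rt_sq
  have key : ∀ a : ℝ, ((2 * rt - 2) * a) ^ 2 ≤ (2 * rt - 2) * (4 + 2 * rt) → a ^ 2 ≤ 5.2 := by
    intro a ha
    have h0 : (2 * rt - 2) * a ^ 2 ≤ 4 + 2 * rt := by
      by_contra hcon
      nlinarith
    by_contra hcon
    nlinarith
  -- These vectors are multiples of the dual basis for the conjugate form, so Cauchy–Schwarz bounds
  -- each squared coordinate by `(4 + 2√3) / (2√3 - 2) < 5.2`.
  have h0 := bil_conj_sq_le (cmbv n) (4 + 2 * rt, 3 + 2 * rt, 3 + 2 * rt)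
  have h1 := bil_conj_sq_le (cmbv n) (3 + 2 * rt, 4 + 2 * rt, 3 + 2 * rt)
  have h2 := bil_conj_sq_le (cmbv n) (3 + 2 * rt, 3 + 2 * rt, 4 + 2 * rt)
  rw [hn, one_mul] at h0 h1 h2
  have w0 : bil (-rt) (4 + 2 * rt, 3 + 2 * rt, 3 + 2 * rt) (4 + 2 * rt, 3 + 2 * rt, 3 + 2 * rt) =
      (2 * rt - 2) * (4 + 2 * rt) := by simp only [bil, vsum]; grobner
  have w1 : bil (-rt) (3 + 2 * rt, 4 + 2 * rt, 3 + 2 * rt) (3 + 2 * rt, 4 + 2 * rt, 3 + 2 * rt) =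
      (2 * rt - 2) * (4 + 2 * rt) := by simp only [bil, vsum]; grobner
  have w2 : bil (-rt) (3 + 2 * rt, 3 + 2 * rt, 4 + 2 * rt) (3 + 2 * rt, 3 + 2 * rt, 4 + 2 * rt) =
      (2 * rt - 2) * (4 + 2 * rt) := by simp only [bil, vsum]; grobner
  have v0 : bil (-rt) (cmbv n) (4 + 2 * rt, 3 + 2 * rt, 3 + 2 * rt) = (2 * rt - 2) * cmb n.1 := by
    simp only [bil, vsum, cmbv]; grobner
  have v1 : bil (-rt) (cmbv n) (3 + 2 * rt, 4 + 2 * rt, 3 + 2 * rt) =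
      (2 * rt - 2) * cmb n.2.1 := by
    simp only [bil, vsum, cmbv]; grobner
  have v2 : bil (-rt) (cmbv n) (3 + 2 * rt, 3 + 2 * rt, 4 + 2 * rt) =
      (2 * rt - 2) * cmb n.2.2 := by
    simp only [bil, vsum, cmbv]; grobner
  rw [w0, v0] at h0
  rw [w1, v1] at h1
  rw [w2, v2] at h2
  exact ⟨key _ h0, key _ h1, key _ h2⟩

/-- Each nonnegative coordinate is either `0` or at least `1`. The norm is `1` and the cross terms
are nonnegative, so only one coordinate survives. -/
theorem vertex_cases {z : ℍ} (hz : IsVertex z) (h0 : 0 ≤ (hv z).1) (h1 : 0 ≤ (hv z).2.1)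
    (h2 : 0 ≤ (hv z).2.2) : z = vertexA eqAngle ∨ z = vertexB eqAngle ∨ z = vertexC eqAngle := by
  obtain ⟨n, hn⟩ := hz
  have hb : bil tz n n = 1 := emb_injective (by rw [← emb_bil, ← hn, bil_hv_self, map_one])
  obtain ⟨k0, k1, k2⟩ := conj_coord_sq_le hb
  have hb' := bil_hv_self z
  have hr := rt_bounds.1
  have gap : ∀ m : Z3, cmb m ^ 2 ≤ 5.2 → 0 ≤ emb m → emb m = 0 ∨ 1 ≤ emb m := by
    intro m hm h0
    by_contra! hcon
    exact hcon.1 (by rw [eq_zero_of_emb_lt_one (abs_lt.2 ⟨by linarith, hcon.2⟩) hm, map_zero])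
  rw [hn] at h0 h1 h2 hb'
  have g0 := gap _ k0 h0
  have g1 := gap _ k1 h1
  have g2 := gap _ k2 h2
  have hsplit : embv n = (1, 0, 0) ∨ embv n = (0, 1, 0) ∨ embv n = (0, 0, 1) := by
    simp only [embv, bil, vsum, Prod.mk.injEq] at *
    generalize emb n.1 = x at *
    generalize emb n.2.1 = y at *
    generalize emb n.2.2 = u at *
    have hxy : 0 ≤ x * y := mul_nonneg h0 h1
    have hxu : 0 ≤ x * u := mul_nonneg h0 h2
    have hyu : 0 ≤ y * u := mul_nonneg h1 h2
    have hq : x ^ 2 + y ^ 2 + u ^ 2 + 2 * (3 + 2 * rt) * (x * y + x * u + y * u) = 1 := by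
      linarith
    have hle : x ^ 2 + y ^ 2 + u ^ 2 ≤ 1 := by
      nlinarith [mul_nonneg (show (0:ℝ) ≤ 3 + 2 * rt by linarith) hxy,
        mul_nonneg (show (0:ℝ) ≤ 3 + 2 * rt by linarith) hxu,
        mul_nonneg (show (0:ℝ) ≤ 3 + 2 * rt by linarith) hyu]
    rcases g0 with rfl | g0
    · rcases g1 with rfl | g1
      · right; right
        refine ⟨rfl, rfl, ?_⟩
        nlinarith
      · have hu : u = 0 := by nlinarith [sq_nonneg u]
        right; left
        refine ⟨rfl, ?_, hu⟩
        subst hu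
        nlinarith
    · have hu : u = 0 := by nlinarith [sq_nonneg y]
      have hy : y = 0 := by nlinarith [sq_nonneg u]
      left
      refine ⟨?_, hy, hu⟩
      subst hu hy
      nlinarith
  rcases hsplit with h | h | h
  · left; exact hv_injective (by rw [hn, h, hv_vertexA])
  · right; left; exact hv_injective (by rw [hn, h, hv_vertexB])
  · right; right; exact hv_injective (by rw [hn, h, hv_vertexC])

theorem IsVertex.exists_grid {z : ℍ} (hz : IsVertex z) : ∃ g ∈ gridGroup,
    g • z = vertexA eqAngle ∨ g • z = vertexB eqAngle ∨ g • z = vertexC eqAngle := by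
  obtain ⟨g, hg, h0, h1, h2⟩ := exists_grid_nonneg z
  exact ⟨g, hg, vertex_cases (hz.smul hg) h0 h1 h2⟩

instance : Countable Z3 :=
  Function.Injective.countable (f := fun x : Z3 => (x.re, x.im)) fun x y h => by
    simp only [Prod.mk.injEq] at h
    exact Zsqrtd.ext h.1 h.2

theorem exists_not_isVertex {c : ℝ → ℍ} (hc : Isometry c) : ∃ t, ¬ IsVertex (c t) := by
  by_contra! h
  choose n hn using h
  obtain ⟨s, t, hst, e⟩ := exists_ne_of_countable n
  exact hst (hc.injective (hv_injective (by rw [hn, hn, e])))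

end

end BolzaLike

namespace BolzaLike

noncomputable section

/-! ### The lines of the triangulation -/

/-- Integral normal vectors of the lines formed by the edges. -/
def edgeNormals : Set (Z3 × Z3 × Z3) :=
  {m | bil tz m m = ⟨-20, -12⟩ ∧ ∃ k, vsum m = 2 * k}

/-- Real normal vectors of the lines formed by the edges. -/
def lineNormals : Set (ℝ × ℝ × ℝ) := embv '' edgeNormals

/-- The norm is chosen because `20 + 12√3 = (3 + 2√3) ^ 2 - 1`: it is the norm of the vector part of
an element of determinant one with scalar part `3 + 2√3`. -/
theorem emb_norm_edge : emb ⟨-20, -12⟩ = -(20 + 12 * rt) := by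
  rw [emb_apply]; push_cast; ring

theorem bil_lineNormals {m : ℝ × ℝ × ℝ} (hm : m ∈ lineNormals) :
    bil rt m m = -(20 + 12 * rt) := by
  obtain ⟨n, hn, rfl⟩ := hm
  rw [emb_bil, hn.1, emb_norm_edge]

theorem bil_lineNormals_neg {m : ℝ × ℝ × ℝ} (hm : m ∈ lineNormals) : bil rt m m < 0 := by
  rw [bil_lineNormals hm]; linarith [rt_bounds.1]

theorem neg_mem_lineNormals {m : ℝ × ℝ × ℝ} (hm : m ∈ lineNormals) : -m ∈ lineNormals := by
  obtain ⟨n, ⟨h1, k, hk⟩, rfl⟩ := hm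
  refine ⟨-n, ⟨by rw [bil_neg_left, bil_neg_right, neg_neg, h1], -k, ?_⟩, embv_neg n⟩
  simp only [vsum, Prod.fst_neg, Prod.snd_neg] at *
  linear_combination -hk

theorem act_mem_lineNormals {g : SL(2, ℝ)} (hg : g ∈ gridGroup) {m : ℝ × ℝ × ℝ}
    (hm : m ∈ lineNormals) : act g m ∈ lineNormals := by
  refine gridGroup_invariant ?_ ?_ ?_ hg hm
  · rintro _ ⟨n, ⟨h1, k, hk⟩, rfl⟩
    refine ⟨_, ⟨(bil_of_act_embv (act_mJ_embv n)).trans h1, k + (tz - 1) * n.2.1, ?_⟩,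
      (act_mJ_embv n).symm⟩
    simp only [vsum] at *
    linear_combination hk
  · rintro _ ⟨n, ⟨h1, k, hk⟩, rfl⟩
    refine ⟨_, ⟨(bil_of_act_embv (act_mJU_embv n)).trans h1, k + (tz - 1) * n.2.2, ?_⟩,
      (act_mJU_embv n).symm⟩
    simp only [vsum] at *
    linear_combination hk
  · rintro _ ⟨n, ⟨h1, k, hk⟩, rfl⟩
    refine ⟨_, ⟨(bil_of_act_embv (act_mVJ_embv n)).trans h1, k + (tz - 1) * n.1, ?_⟩,
      (act_mVJ_embv n).symm⟩
    simp only [vsum] at *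
    linear_combination hk

/-- Dividing the norm equation by `4` shows that `k ^ 2` is divisible by `1 + √3`. This is a prime
with residue field of two elements, where divisibility means that the two integer components have
even sum; hence it divides `k`. -/
theorem edgeNormals_vsum {m : Z3 × Z3 × Z3} (hm : m ∈ edgeNormals) :
    ∃ k, vsum m = 2 * (1 + tz) * k := by
  obtain ⟨h1, k, hk⟩ := hm
  have h2 : k ^ 2 + (1 + tz) * (m.1 * m.2.1 + m.1 * m.2.2 + m.2.1 * m.2.2) = ⟨-5, -3⟩ := by
    have h4 : (4 : Z3) * (k ^ 2 + (1 + tz) * (m.1 * m.2.1 + m.1 * m.2.2 + m.2.1 * m.2.2)) =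
        4 * ⟨-5, -3⟩ := by
      have e : (4 : Z3) * ⟨-5, -3⟩ = ⟨-20, -12⟩ := by decide
      rw [e, ← h1]
      simp only [bil]
      simp only [vsum] at *
      linear_combination (-(m.1 + m.2.1 + m.2.2) - 2 * k) * hk
    have h4' := congrArg emb h4
    rw [map_mul, map_mul, map_ofNat] at h4'
    exact emb_injective (mul_left_cancel₀ (by norm_num) h4')
  generalize m.1 * m.2.1 + m.1 * m.2.2 + m.2.1 * m.2.2 = e at h2
  have hre := congrArg Zsqrtd.re h2
  have him := congrArg Zsqrtd.im h2
  simp only [pow_two, Zsqrtd.re_add, Zsqrtd.im_add, Zsqrtd.re_mul, Zsqrtd.im_mul,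
    Zsqrtd.re_one, Zsqrtd.im_one, Zsqrtd.re_sqrtd, Zsqrtd.im_sqrtd] at hre him
  have hpar : (k.re + k.im) % 2 = 0 := by
    have h3 : (k.re + k.im) * (k.re + k.im) = 2 * (-4 - e.re - 2 * e.im - k.im * k.im) := by
      linear_combination hre + him
    rcases Int.emod_two_eq_zero_or_one (k.re + k.im) with h | h
    · exact h
    · have := Int.mul_emod (k.re + k.im) (k.re + k.im) 2
      rw [h, h3] at this
      omega
  -- The quotient `a + b√3` solves `a + 3 b = k.re`, `a + b = k.im`.
  refine ⟨⟨k.im - (k.re - k.im) / 2, (k.re - k.im) / 2⟩, ?_⟩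
  rw [hk, mul_assoc]
  congr 1
  refine Zsqrtd.ext ?_ ?_
  · simp only [Zsqrtd.re_mul, Zsqrtd.re_add, Zsqrtd.im_add, Zsqrtd.re_one, Zsqrtd.im_one,
      Zsqrtd.re_sqrtd, Zsqrtd.im_sqrtd]
    omega
  · simp only [Zsqrtd.im_mul, Zsqrtd.re_add, Zsqrtd.im_add, Zsqrtd.re_one, Zsqrtd.im_one,
      Zsqrtd.re_sqrtd, Zsqrtd.im_sqrtd]
    omega

/-- The bounds are tight: `2 + √3` has a small conjugate but is just too large, and `1 + √3` has
conjugate of absolute value above `0.61`. -/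
theorem gap_of_small_conj {k : Z3} (h1 : |emb k| < 2 + rt) (h2 : cmb k ^ 2 ≤ 0.37) : k = 0 := by
  rw [emb_apply] at h1
  rw [cmb_apply] at h2
  obtain ⟨h1, h1'⟩ := abs_lt.1 h1
  have hr := rt_bounds.1
  have hr' := rt_bounds.2
  have h3 : |(k.re : ℝ) - k.im * rt| < 0.61 :=
    abs_lt_of_sq_lt_sq (h2.trans_lt (by norm_num)) (by norm_num)
  obtain ⟨h3, h3'⟩ := abs_lt.1 h3
  have i1 : k.im < 2 := by
    by_contra hcon
    have : (2 : ℝ) ≤ k.im := by exact_mod_cast not_lt.1 hcon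
    nlinarith
  have i2 : -2 < k.im := by
    by_contra hcon
    have : (k.im : ℝ) ≤ -2 := by exact_mod_cast not_lt.1 hcon
    nlinarith
  obtain h | h | h : k.im = -1 ∨ k.im = 0 ∨ k.im = 1 := by omega
  · exfalso
    rw [h] at h1 h1' h3 h3'
    push_cast at *
    have j1 : (k.re : ℝ) < -1 := by linarith
    have j2 : (-2 : ℝ) < k.re := by linarith
    have : k.re < -1 := by exact_mod_cast j1
    have : -2 < k.re := by exact_mod_cast j2
    omega
  · rw [h] at h1 h1' h3 h3'
    push_cast at *
    have j1 : (k.re : ℝ) < 1 := by linarith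
    have j2 : (-1 : ℝ) < k.re := by linarith
    have : k.re < 1 := by exact_mod_cast j1
    have : -1 < k.re := by exact_mod_cast j2
    exact Zsqrtd.ext (by simp; omega) (by simp [h])
  · exfalso
    rw [h] at h1 h1' h3 h3'
    push_cast at *
    have j1 : (k.re : ℝ) < 2 := by linarith
    have j2 : (1 : ℝ) < k.re := by linarith
    have : k.re < 2 := by exact_mod_cast j1
    have : 1 < k.re := by exact_mod_cast j2
    omega

/-- The product is `2 (1 + √3)` times an integer `y`. Cauchy–Schwarz for the conjugate form makes
the conjugate of `y` so small that `y` is zero or at least `2 + √3` in absolute value, and `2 (1 +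
√3) (2 + √3) > 20`. -/
theorem lineNormals_gap {m : ℝ × ℝ × ℝ} (hm : m ∈ lineNormals) {v : Z3 × Z3 × Z3}
    (hv : bil tz v v = 1) : bil rt m (embv v) = 0 ∨ 20 ≤ |bil rt m (embv v)| := by
  obtain ⟨n, hn, rfl⟩ := hm
  obtain ⟨k, hk⟩ := edgeNormals_vsum hn
  have hr := rt_bounds.1
  have hr' := rt_bounds.2
  set y := (3 + 2 * tz) * (k * vsum v) -
    (n.1 * v.1 + n.2.1 * v.2.1 + n.2.2 * v.2.2) with hy
  have hb : bil tz n v = 2 * (1 + tz) * y := by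
    simp only [bil, hk, hy]; ring
  have hc := bil_conj_sq_le (cmbv n) (cmbv v)
  rw [cmb_bil, cmb_bil, cmb_bil, hn.1, hv, map_one, hb, map_mul, map_mul, map_add, cmb_tz,
    map_one, map_ofNat, mul_one, cmb_apply ⟨-20, -12⟩] at hc
  push_cast at hc
  have hc' : cmb y ^ 2 ≤ 0.37 := by
    by_contra hcon
    push Not at hcon
    nlinarith [rt_sq, mul_lt_mul_of_pos_left hcon (show 0 < (2 * (1 - rt)) ^ 2 by nlinarith)]
  rw [emb_bil, hb, map_mul, map_mul, map_add, emb_tz, map_one, map_ofNat]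
  by_cases h : |emb y| < 2 + rt
  · left
    rw [gap_of_small_conj h hc', map_zero, mul_zero]
  · right
    rw [abs_mul, abs_of_pos (by linarith)]
    nlinarith [rt_sq]

/-- A line of the triangulation does not separate two adjacent vertices. -/
theorem lineNormals_edge {m : ℝ × ℝ × ℝ} (hm : m ∈ lineNormals) {v w : Z3 × Z3 × Z3}
    (hv : bil tz v v = 1) (hw : bil tz w w = 1) (hvw : bil tz v w = 3 + 2 * tz)
    (h1 : 0 < bil rt m (embv v)) (h2 : bil rt m (embv w) < 0) : False := by
  have hr := rt_bounds.1
  have hr' := rt_bounds.2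
  have g1 := (lineNormals_gap hm hv).resolve_left h1.ne'
  have g2 := (lineNormals_gap hm hw).resolve_left h2.ne
  rw [abs_of_pos h1] at g1
  rw [abs_of_neg h2] at g2
  -- Two products of opposite signs and size at least `20` would make this Gram determinant
  -- negative, since its only positive term is `(20 + 12√3) ^ 2 ≤ 41 ^ 2`.
  have hg := gram_nonneg m (embv v) (embv w)
  rw [emb_bil v v, emb_bil w w, emb_bil v w, hv, hw, hvw, bil_lineNormals hm, map_one, map_add,
    map_mul, emb_tz, map_ofNat, map_ofNat] at hg
  generalize bil rt m (embv v) = a at *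
  generalize bil rt m (embv w) = b at *
  have hsq := rt_sq
  have e : (3 + 2 * rt) ^ 2 = 21 + 12 * rt := by linear_combination 4 * hsq
  have hab : 400 ≤ a * (-b) := by nlinarith
  have ha : 400 ≤ a ^ 2 := by nlinarith
  have hb : 400 ≤ b ^ 2 := by nlinarith
  have h3 : (20 + 12 * rt) * (20 + 12 * rt) ≤ 41 * 41 := by nlinarith
  nlinarith

theorem e_basis : bil tz ((1, 0, 0) : Z3 × Z3 × Z3) (1, 0, 0) = 1 ∧
    bil tz ((0, 1, 0) : Z3 × Z3 × Z3) (0, 1, 0) = 1 ∧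
    bil tz ((0, 0, 1) : Z3 × Z3 × Z3) (0, 0, 1) = 1 ∧
    bil tz ((1, 0, 0) : Z3 × Z3 × Z3) (0, 1, 0) = 3 + 2 * tz ∧
    bil tz ((1, 0, 0) : Z3 × Z3 × Z3) (0, 0, 1) = 3 + 2 * tz ∧
    bil tz ((0, 1, 0) : Z3 × Z3 × Z3) (0, 0, 1) = 3 + 2 * tz := by
  refine ⟨?_, ?_, ?_, ?_, ?_, ?_⟩ <;> simp [bil, vsum] <;> ring

/-- The values of a line normal on the vertices of the base triangle have weakly the same sign. -/
theorem lineNormals_same_sign {m : ℝ × ℝ × ℝ} (hm : m ∈ lineNormals) :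
    (0 ≤ bil rt m (1, 0, 0) ∧ 0 ≤ bil rt m (0, 1, 0) ∧ 0 ≤ bil rt m (0, 0, 1)) ∨
    (bil rt m (1, 0, 0) ≤ 0 ∧ bil rt m (0, 1, 0) ≤ 0 ∧ bil rt m (0, 0, 1) ≤ 0) := by
  obtain ⟨h00, h11, h22, h01, h02, h12⟩ := e_basis
  have h10 := (bil_comm tz _ _).trans h01
  have h20 := (bil_comm tz _ _).trans h02
  have h21 := (bil_comm tz _ _).trans h12
  have k01 := lineNormals_edge hm h00 h11 h01
  have k02 := lineNormals_edge hm h00 h22 h02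
  have k12 := lineNormals_edge hm h11 h22 h12
  have k10 := lineNormals_edge hm h11 h00 h10
  have k20 := lineNormals_edge hm h22 h00 h20
  have k21 := lineNormals_edge hm h22 h11 h21
  rw [embv_e0, embv_e1] at k01 k10
  rw [embv_e0, embv_e2] at k02 k20
  rw [embv_e1, embv_e2] at k12 k21
  by_contra! hcon
  grind

theorem bil_eq_comb (m x : ℝ × ℝ × ℝ) : bil rt m x = x.1 * bil rt m (1, 0, 0) +
    x.2.1 * bil rt m (0, 1, 0) + x.2.2 * bil rt m (0, 0, 1) := by
  simp only [bil, vsum]; ring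

theorem lineNormals_of_two_zero {m : ℝ × ℝ × ℝ} (hm : m ∈ lineNormals) :
    (bil rt m (1, 0, 0) = 0 → bil rt m (0, 1, 0) = 0 →
      m = (-rt, -rt, 2) ∨ m = -(-rt, -rt, 2)) ∧
    (bil rt m (1, 0, 0) = 0 → bil rt m (0, 0, 1) = 0 →
      m = (-rt, 2, -rt) ∨ m = -(-rt, 2, -rt)) ∧
    (bil rt m (0, 1, 0) = 0 → bil rt m (0, 0, 1) = 0 →
      m = (2, -rt, -rt) ∨ m = -(2, -rt, -rt)) := by
  have hb := bil_lineNormals hm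
  obtain ⟨x, y, u⟩ := m
  have hr := rt_bounds.1
  have hsq := rt_sq
  have key : ∀ a b d : ℝ, (3 + 2 * rt) * (a + b + d) = (2 + 2 * rt) * a →
      (3 + 2 * rt) * (a + b + d) = (2 + 2 * rt) * b →
      (3 + 2 * rt) * (a + b + d) ^ 2 - (2 + 2 * rt) * (a ^ 2 + b ^ 2 + d ^ 2) =
        -(20 + 12 * rt) → (a = -rt ∧ b = -rt ∧ d = 2) ∨ (a = rt ∧ b = rt ∧ d = -2) := by
    intro a b d h1 h2 h3
    have hab : a = b := mul_left_cancel₀ (show 2 + 2 * rt ≠ 0 by linarith) (h1.symm.trans h2)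
    subst hab
    have hd : d = -(2 * rt / 3) * a := by
      have : (3 + 2 * rt) * d = (3 + 2 * rt) * (-(2 * rt / 3) * a) := by
        linear_combination h1 + 4 / 3 * a * hsq
      exact mul_left_cancel₀ (by linarith) this
    have ha : a ^ 2 = 3 := by
      rw [hd] at h3
      have h4 : (20 + 12 * rt) * a ^ 2 = (20 + 12 * rt) * 3 := by grobner
      exact mul_left_cancel₀ (by linarith) h4
    have : (a - rt) * (a + rt) = 0 := by linear_combination ha - hsq
    rcases mul_eq_zero.1 this with h | h
    · right
      have h5 : a = rt := by linarith
      exact ⟨h5, h5, by rw [hd, h5]; linear_combination -2 / 3 * hsq⟩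
    · left
      have h5 : a = -rt := by linarith
      exact ⟨h5, h5, by rw [hd, h5]; linear_combination 2 / 3 * hsq⟩
  simp only [bil, vsum] at *
  simp only [Prod.mk.injEq, Prod.neg_mk, neg_neg]
  refine ⟨fun h1 h2 => ?_, fun h1 h2 => ?_, fun h1 h2 => ?_⟩
  · exact key x y u (by linarith) (by linarith) (by linarith)
  · have := key x u y (by linarith) (by linarith) (by linarith)
    tauto
  · have := key y u x (by linarith) (by linarith) (by linarith)
    tauto

theorem not_isVertex_two_pos {z : ℍ} (hz : ¬ IsVertex z) (h0 : 0 ≤ (hv z).1)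
    (h1 : 0 ≤ (hv z).2.1) (h2 : 0 ≤ (hv z).2.2) :
    (0 < (hv z).1 ∧ 0 < (hv z).2.1) ∨ (0 < (hv z).1 ∧ 0 < (hv z).2.2) ∨
      (0 < (hv z).2.1 ∧ 0 < (hv z).2.2) := by
  have hb := bil_hv_self z
  have hne : ∀ v : Z3 × Z3 × Z3, hv z ≠ embv v := fun v hv => hz ⟨v, hv⟩
  have n0 := hne (1, 0, 0)
  have n1 := hne (0, 1, 0)
  have n2 := hne (0, 0, 1)
  rw [embv_e0] at n0
  rw [embv_e1] at n1
  rw [embv_e2] at n2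
  generalize hv z = x at *
  obtain ⟨a, b, d⟩ := x
  simp only [bil, vsum, Prod.mk.injEq, ne_eq] at *
  rcases h0.eq_or_lt with rfl | h0
  · rcases h1.eq_or_lt with rfl | h1
    · exfalso
      apply n2
      refine ⟨rfl, rfl, ?_⟩
      nlinarith
    · rcases h2.eq_or_lt with rfl | h2
      · exfalso
        apply n1
        refine ⟨rfl, ?_, rfl⟩
        nlinarith
      · exact Or.inr (Or.inr ⟨h1, h2⟩)
  · rcases h1.eq_or_lt with rfl | h1
    · rcases h2.eq_or_lt with rfl | h2
      · exfalso
        apply n0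
        refine ⟨?_, rfl, rfl⟩
        nlinarith
      · exact Or.inr (Or.inl ⟨h0, h2⟩)
    · exact Or.inl ⟨h0, h1⟩

/-- Through a point of the base triangle that is not a vertex passes at most one line, and it
contains a side. -/
theorem lineNormals_side {z : ℍ} (hz : ¬ IsVertex z) (h0 : 0 ≤ (hv z).1)
    (h1 : 0 ≤ (hv z).2.1) (h2 : 0 ≤ (hv z).2.2) :
    ∃ s ∈ ({(-rt, -rt, 2), (-rt, 2, -rt), (2, -rt, -rt)} : Set (ℝ × ℝ × ℝ)),
      ∀ m ∈ lineNormals, bil rt m (hv z) = 0 → m = s ∨ m = -s := by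
  rcases not_isVertex_two_pos hz h0 h1 h2 with ⟨p, q⟩ | ⟨p, q⟩ | ⟨p, q⟩
  · refine ⟨(-rt, -rt, 2), by simp, fun m hm hmz => ?_⟩
    rw [bil_eq_comb] at hmz
    apply (lineNormals_of_two_zero hm).1
    · rcases lineNormals_same_sign hm with ⟨a, b, c⟩ | ⟨a, b, c⟩ <;> nlinarith
    · rcases lineNormals_same_sign hm with ⟨a, b, c⟩ | ⟨a, b, c⟩ <;> nlinarith
  · refine ⟨(-rt, 2, -rt), by simp, fun m hm hmz => ?_⟩
    rw [bil_eq_comb] at hmz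
    apply (lineNormals_of_two_zero hm).2.1
    · rcases lineNormals_same_sign hm with ⟨a, b, c⟩ | ⟨a, b, c⟩ <;> nlinarith
    · rcases lineNormals_same_sign hm with ⟨a, b, c⟩ | ⟨a, b, c⟩ <;> nlinarith
  · refine ⟨(2, -rt, -rt), by simp, fun m hm hmz => ?_⟩
    rw [bil_eq_comb] at hmz
    apply (lineNormals_of_two_zero hm).2.2
    · rcases lineNormals_same_sign hm with ⟨a, b, c⟩ | ⟨a, b, c⟩ <;> nlinarith
    · rcases lineNormals_same_sign hm with ⟨a, b, c⟩ | ⟨a, b, c⟩ <;> nlinarith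

theorem act_injective (g : SL(2, ℝ)) : Function.Injective (act g) := fun x y h => by
  rw [← act_inv_act g x, h, act_inv_act]

/-- Two different lines of the triangulation meet only at vertices. -/
theorem lineNormals_unique {z : ℍ} (hz : ¬ IsVertex z) {m m' : ℝ × ℝ × ℝ}
    (hm : m ∈ lineNormals) (hm' : m' ∈ lineNormals) (h : bil rt m (hv z) = 0)
    (h' : bil rt m' (hv z) = 0) : m' = m ∨ m' = -m := by
  obtain ⟨g, hg, h0, h1, h2⟩ := exists_grid_nonneg z
  have hgz : ¬ IsVertex (g • z) := fun hcon => hz (by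
    have := hcon.smul (inv_mem hg)
    rwa [inv_smul_smul] at this)
  obtain ⟨s, -, hs⟩ := lineNormals_side hgz h0 h1 h2
  have k := hs _ (act_mem_lineNormals hg hm) (by rw [hv_smul, bil_act, h])
  have k' := hs _ (act_mem_lineNormals hg hm') (by rw [hv_smul, bil_act, h'])
  have key : act g m' = act g m ∨ act g m' = act g (-m) := by
    rw [act_neg]
    rcases k with k | k <;> rcases k' with k' | k' <;> simp [k, k']
  exact key.imp (fun e => act_injective g e) (fun e => act_injective g e)

theorem bil_vcross_self (x y : ℝ × ℝ × ℝ) : bil rt (vcross rt x y) (vcross rt x y) =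
    bil rt x x * bil rt y y - bil rt x y ^ 2 := by
  have h := rt_sq
  simp only [bil, vcross, vsum]
  grobner

/-- A line through a point has a unit tangent vector there. -/
theorem exists_frame_of_orthogonal {m : ℝ × ℝ × ℝ} {z : ℍ} (hm : bil rt m m < 0)
    (h : bil rt m (hv z) = 0) : ∃ v, IsFrame (hv z) v ∧ bil rt m v = 0 := by
  set q := √(-bil rt m m) with hq
  have hq0 : 0 < q := Real.sqrt_pos.2 (by linarith)
  have hqq : q * q = -bil rt m m := Real.mul_self_sqrt (by linarith)
  refine ⟨q⁻¹ • vcross rt m (hv z), ⟨bil_hv_self z, ?_, ?_⟩, ?_⟩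
  · rw [bil_smul_right, bil_comm, bil_vcross_right, mul_zero]
  · rw [bil_smul_left, bil_smul_right, bil_vcross_self, h, bil_hv_self]
    have : bil rt m m = -(q * q) := by linarith
    rw [this]
    field_simp
    ring
  · rw [bil_smul_right, bil_comm, bil_vcross_left, mul_zero]

/-- Every line of the triangulation can be moved to a side of the base triangle. -/
theorem exists_grid_side {m : ℝ × ℝ × ℝ} (hm : m ∈ lineNormals) {z : ℍ}
    (h : bil rt m (hv z) = 0) : ∃ g ∈ gridGroup,
    ∃ s ∈ ({(-rt, -rt, 2), (-rt, 2, -rt), (2, -rt, -rt)} : Set (ℝ × ℝ × ℝ)),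
      act g m = s ∨ act g m = -s := by
  obtain ⟨v, hfr, hmv⟩ := exists_frame_of_orthogonal (bil_lineNormals_neg hm) h
  obtain ⟨c, hc, hct⟩ := exists_isometry_of_frame hfr
  -- A point of the line that is not a vertex is moved into the base triangle, where the only line
  -- available is that of a side.
  obtain ⟨t, ht⟩ := exists_not_isVertex hc
  obtain ⟨g, hg, h0, h1, h2⟩ := exists_grid_nonneg (c t)
  have hgz : ¬ IsVertex (g • c t) := fun hcon => ht (by
    have := hcon.smul (inv_mem hg)
    rwa [inv_smul_smul] at this)
  obtain ⟨s, hs, hs'⟩ := lineNormals_side hgz h0 h1 h2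
  refine ⟨g, hg, s, hs, hs' _ (act_mem_lineNormals hg hm) ?_⟩
  rw [hv_smul, bil_act, hct, bil_hyp, h, hmv]
  ring

end

end BolzaLike

namespace BolzaLike

noncomputable section

/-! ### Half-turns as group elements -/

/-- The half-turn about `z`. -/
def turn (z : ℍ) : SL(2, ℝ) := slMk 0 (hv z) (by rw [bil_hv_self]; norm_num)

theorem turn_coe (z : ℍ) : (turn z : Matrix (Fin 2) (Fin 2) ℝ) = vmat (hv z) := by
  rw [turn, slMk_coe, zero_smul, zero_add]

theorem turn_smul_eq (g : SL(2, ℝ)) (z : ℍ) : turn (g • z) = g * turn z * g⁻¹ := by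
  apply Subtype.ext
  rw [Matrix.SpecialLinearGroup.coe_mul, Matrix.SpecialLinearGroup.coe_mul, turn_coe, turn_coe,
    hv_smul, vmat_act]

theorem turn_mul_self (z : ℍ) : turn z * turn z = -1 := by
  apply Subtype.ext
  rw [Matrix.SpecialLinearGroup.coe_mul, turn_coe, vmat_mul_self, bil_hv_self,
    Matrix.SpecialLinearGroup.coe_neg, Matrix.SpecialLinearGroup.coe_one, neg_one_smul]

theorem turn_smul_self (z : ℍ) : turn z • z = z := by
  apply hv_injective
  rw [hv_smul, act_eq_iff_commute, turn_coe]

theorem eq_of_turn_smul {z w : ℍ} (h : turn z • w = w) : w = z := by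
  have h1 := congrArg hv h
  rw [hv_smul, act_eq_iff_commute, turn_coe] at h1
  have h2 := vector_part_of_commute (bil_hv_self w) one_ne_zero h1
  rw [div_one] at h2
  have h3 := bil_hv_pos z w
  have h4 := bil_hv_self z
  set l := bil rt (hv z) (hv w)
  rw [h2, bil_smul_left, bil_smul_right, bil_hv_self, mul_one] at h4
  have hl : l = 1 := by nlinarith
  rw [hl, one_smul] at h2
  exact hv_injective h2.symm

theorem isVertex_A : IsVertex (vertexA eqAngle) := ⟨(1, 0, 0), by rw [hv_vertexA, embv_e0]⟩

theorem isVertex_B : IsVertex (vertexB eqAngle) := ⟨(0, 1, 0), by rw [hv_vertexB, embv_e1]⟩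

theorem isVertex_C : IsVertex (vertexC eqAngle) := ⟨(0, 0, 1), by rw [hv_vertexC, embv_e2]⟩

theorem vertexA_ne_vertexB : vertexA eqAngle ≠ vertexB eqAngle := fun h => by
  have := congrArg hv h
  rw [hv_vertexA, hv_vertexB] at this
  simp at this

/-! ### Words with vanishing exponent sums -/

/-- The two integral exponent sums of a word. -/
def intExp : FreeGroup (Fin 2) →* Multiplicative ℤ × Multiplicative ℤ :=
  FreeGroup.lift ![(Multiplicative.ofAdd 1, 1), (1, Multiplicative.ofAdd 1)]

theorem exponentSums_eq (m n : ℕ) (w : FreeGroup (Fin 2)) : exponentSums m n w =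
    Multiplicative.ofAdd (((intExp w).1.toAdd : ZMod m), ((intExp w).2.toAdd : ZMod n)) := by
  let φ : Multiplicative ℤ × Multiplicative ℤ →* Multiplicative (ZMod m × ZMod n) :=
    { toFun := fun p => Multiplicative.ofAdd ((p.1.toAdd : ZMod m), (p.2.toAdd : ZMod n))
      map_one' := by simp
      map_mul' := fun a b => by simp [← ofAdd_add] }
  have h : exponentSums m n = φ.comp intExp := by
    apply FreeGroup.ext_hom
    intro i
    fin_cases i <;> simp [exponentSums, intExp, φ]
  rw [h]
  rfl

/-- The commutator of the two letters. -/
def letterComm : FreeGroup (Fin 2) :=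
  FreeGroup.of 0 * FreeGroup.of 1 * (FreeGroup.of 0)⁻¹ * (FreeGroup.of 1)⁻¹

/-- Modulo the normal closure of the commutator the two letters commute, so the quotient map factors
through the exponent sums. -/
theorem ker_intExp_le : intExp.ker ≤ Subgroup.normalClosure {letterComm} := by
  intro w hw
  let N := Subgroup.normalClosure {letterComm}
  have hc : (QuotientGroup.mk' N (FreeGroup.of 0)) * QuotientGroup.mk' N (FreeGroup.of 1) =
      QuotientGroup.mk' N (FreeGroup.of 1) * QuotientGroup.mk' N (FreeGroup.of 0) := by
    have h1 : QuotientGroup.mk' N letterComm = 1 :=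
      (QuotientGroup.eq_one_iff _).2 (Subgroup.subset_normalClosure (Set.mem_singleton _))
    change QuotientGroup.mk' N (FreeGroup.of 0 * FreeGroup.of 1 * (FreeGroup.of 0)⁻¹ *
      (FreeGroup.of 1)⁻¹) = 1 at h1
    rw [map_mul, map_mul, map_mul, map_inv, map_inv, mul_inv_eq_one,
      mul_inv_eq_iff_eq_mul] at h1
    exact h1
  let ψ : Multiplicative ℤ × Multiplicative ℤ →* (FreeGroup (Fin 2) ⧸ N) :=
    MonoidHom.noncommCoprod (zpowersHom _ (QuotientGroup.mk' N (FreeGroup.of 0)))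
      (zpowersHom _ (QuotientGroup.mk' N (FreeGroup.of 1)))
      (fun a b => by
        simp only [zpowersHom_apply]
        exact (show Commute _ _ from hc).zpow_zpow _ _)
  have h : QuotientGroup.mk' N = ψ.comp intExp := by
    apply FreeGroup.ext_hom
    intro i
    fin_cases i <;> simp [intExp, ψ]
  have h2 := DFunLike.congr_fun h w
  rw [MonoidHom.comp_apply, MonoidHom.mem_ker.1 hw, map_one] at h2
  exact (QuotientGroup.eq_one_iff _).1 h2

/-- The value of a word in the side pairings. -/
abbrev word : FreeGroup (Fin 2) →* SL(2, ℝ) := sideWord eqAngle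

theorem word_zero : word (FreeGroup.of 0) = mU := by simp [sideWord, mU]

theorem word_one : word (FreeGroup.of 1) = mV := by simp [sideWord, mV]

theorem word_mem (w : FreeGroup (Fin 2)) : word w ∈ gridGroup := by
  induction w using FreeGroup.induction_on with
  | C1 => rw [map_one]; exact one_mem _
  | of i =>
    fin_cases i
    · exact word_zero ▸ mU_mem
    · exact word_one ▸ mV_mem
  | inv_of i h => rw [map_inv]; exact inv_mem h
  | mul a b ha hb => rw [map_mul]; exact mul_mem ha hb

/-- The commutator of the side pairings goes once around the cone point of the one-square torus,
whose angle is the angle sum `π` of the rhombus; hence it is a half-turn. -/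
theorem word_letterComm : word letterComm = turn (vertexC eqAngle) := by
  have h : mU * mV = turn (vertexC eqAngle) * (mV * mU) := by
    apply Subtype.ext
    have h1 := rt_sq
    have h2 := chA_sq
    have h3 := shA_sq
    rw [Matrix.SpecialLinearGroup.coe_mul, Matrix.SpecialLinearGroup.coe_mul,
      Matrix.SpecialLinearGroup.coe_mul, turn_coe, hv_vertexC, mU_coe, mV_coe]
    ext i j
    fin_cases i <;> fin_cases j <;>
      simp [vmat, Matrix.mul_apply, Fin.sum_univ_two] <;> grobner
  rw [letterComm, map_mul, map_mul, map_mul, map_inv, map_inv, word_zero, word_one, h]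
  group

/-- The group of the words with vanishing exponent sums. -/
def commGroup : Subgroup SL(2, ℝ) := intExp.ker.map word

theorem commGroup_le (m n : ℕ) : commGroup ≤ torusGroup eqAngle m n := by
  apply Subgroup.map_mono
  intro w hw
  rw [MonoidHom.mem_ker] at hw ⊢
  rw [exponentSums_eq, hw]
  simp

theorem mJ_inv : mJ⁻¹ = -mJ := by
  rw [inv_eq_iff_mul_eq_one, mul_neg, mJ_mul_mJ, neg_neg]

/-- The half-turn about the centre of the square inverts both side pairings, so it negates the
exponent sums. -/
theorem conj_mJ_word (w : FreeGroup (Fin 2)) : ∃ w', mJ * word w * mJ⁻¹ = word w' ∧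
    intExp w' = (intExp w)⁻¹ := by
  have hU : mJ * mU * mJ⁻¹ = mU⁻¹ := by
    rw [eq_inv_iff_mul_eq_one, mJ_inv]
    apply Subtype.ext
    have h1 := rt_sq
    have h2 := chA_sq
    have h3 := shA_sq
    simp only [Matrix.SpecialLinearGroup.coe_mul, Matrix.SpecialLinearGroup.coe_neg, mJ_coe,
      mU_coe, Matrix.SpecialLinearGroup.coe_one]
    ext i j
    fin_cases i <;> fin_cases j <;>
      simp [Matrix.mul_apply, Fin.sum_univ_two] <;> grobner
  have hV : mJ * mV * mJ⁻¹ = mV⁻¹ := by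
    rw [eq_inv_iff_mul_eq_one, mJ_inv]
    apply Subtype.ext
    have h1 := rt_sq
    have h2 := chA_sq
    have h3 := shA_sq
    simp only [Matrix.SpecialLinearGroup.coe_mul, Matrix.SpecialLinearGroup.coe_neg, mJ_coe,
      mV_coe, Matrix.SpecialLinearGroup.coe_one]
    ext i j
    fin_cases i <;> fin_cases j <;>
      simp [Matrix.mul_apply, Fin.sum_univ_two] <;> grobner
  let θ : FreeGroup (Fin 2) →* FreeGroup (Fin 2) :=
    FreeGroup.lift (fun i => (FreeGroup.of i)⁻¹)
  refine ⟨θ w, ?_, ?_⟩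
  · have h : (MulAut.conj mJ).toMonoidHom.comp word = word.comp θ := by
      apply FreeGroup.ext_hom
      intro i
      fin_cases i
      · simp only [MonoidHom.comp_apply, Fin.zero_eta, word_zero, θ, FreeGroup.lift_apply_of,
          map_inv]
        exact hU
      · simp only [MonoidHom.comp_apply, Fin.mk_one, word_one, θ, FreeGroup.lift_apply_of, map_inv]
        exact hV
    exact DFunLike.congr_fun h w
  · have h : intExp.comp θ = intExp⁻¹ := by
      apply FreeGroup.ext_hom
      intro i
      simp [θ]
    exact DFunLike.congr_fun h w

theorem conj_mem_commGroup {g : SL(2, ℝ)} (hg : g ∈ gridGroup) {x : SL(2, ℝ)}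
    (hx : x ∈ commGroup) : g * x * g⁻¹ ∈ commGroup := by
  have hw : ∀ w : FreeGroup (Fin 2), ∀ x ∈ commGroup, word w * x * (word w)⁻¹ ∈ commGroup := by
    rintro w _ ⟨u, hu, rfl⟩
    refine ⟨w * u * w⁻¹, ?_, by simp⟩
    exact (inferInstance : intExp.ker.Normal).conj_mem u hu w
  have hJ : ∀ x ∈ commGroup, mJ * x * mJ⁻¹ ∈ commGroup := by
    rintro _ ⟨u, hu, rfl⟩
    obtain ⟨u', h1, h2⟩ := conj_mJ_word u
    refine ⟨u', ?_, h1.symm⟩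
    change intExp u' = 1
    rw [h2, MonoidHom.mem_ker.1 hu, inv_one]
  have hJ' : ∀ x ∈ commGroup, mJ⁻¹ * x * mJ⁻¹⁻¹ ∈ commGroup := by
    intro x hx
    have := hJ x hx
    rw [inv_inv]
    rw [mJ_inv] at this ⊢
    simpa using this
  have hU := hw (FreeGroup.of 0)
  have hV := hw (FreeGroup.of 1)
  have hU' := hw (FreeGroup.of 0)⁻¹
  have hV' := hw (FreeGroup.of 1)⁻¹
  rw [map_inv] at hU' hV'
  rw [word_zero] at hU hU'
  rw [word_one] at hV hV'
  suffices h : (∀ x ∈ commGroup, g * x * g⁻¹ ∈ commGroup) ∧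
      ∀ x ∈ commGroup, g⁻¹ * x * g⁻¹⁻¹ ∈ commGroup from h.1 x hx
  have hmul : ∀ a b : SL(2, ℝ), (∀ x ∈ commGroup, a * x * a⁻¹ ∈ commGroup) →
      (∀ x ∈ commGroup, b * x * b⁻¹ ∈ commGroup) →
      ∀ x ∈ commGroup, (a * b) * x * (a * b)⁻¹ ∈ commGroup := by
    intro a b ha hb x hx
    have := ha _ (hb x hx)
    have e : a * b * x * (a * b)⁻¹ = a * (b * x * b⁻¹) * a⁻¹ := by group
    rwa [e]
  induction hg using Subgroup.closure_induction with
  | mem k hk =>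
    simp only [Set.mem_insert_iff, Set.mem_singleton_iff] at hk
    rcases hk with rfl | rfl | rfl
    · exact ⟨hJ, hJ'⟩
    · refine ⟨hmul _ _ hJ hU, ?_⟩
      rw [mul_inv_rev]
      exact hmul _ _ hU' hJ'
    · refine ⟨hmul _ _ hV hJ, ?_⟩
      rw [mul_inv_rev]
      exact hmul _ _ hJ' hV'
  | one => simp
  | mul a b _ _ ha hb =>
    refine ⟨hmul _ _ ha.1 hb.1, ?_⟩
    rw [mul_inv_rev]
    exact hmul _ _ hb.2 ha.2
  | inv a _ ha => exact ⟨ha.2, by rw [inv_inv]; exact ha.1⟩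

theorem turn_smul_mem {g : SL(2, ℝ)} (hg : g ∈ gridGroup) {z : ℍ} (hz : turn z ∈ commGroup) :
    turn (g • z) ∈ commGroup := by
  rw [turn_smul_eq]; exact conj_mem_commGroup hg hz

/-- Every vertex can be moved by `gridGroup` to `A`, `B` or `C`, and these are related by the side
pairings. The half-turn about `C` is a commutator, and `gridGroup` normalises `commGroup`. -/
theorem IsVertex.turn_mem {z : ℍ} (hz : IsVertex z) : turn z ∈ commGroup := by
  have hC : turn (vertexC eqAngle) ∈ commGroup := by
    refine ⟨letterComm, ?_, word_letterComm⟩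
    change intExp letterComm = 1
    simp [letterComm]
  have hB : turn (vertexB eqAngle) ∈ commGroup := by
    have e : vertexB eqAngle = mU⁻¹ • vertexC eqAngle := by
      rw [eq_inv_smul_iff]; exact sideU_B eqAngle
    rw [e]
    exact turn_smul_mem (inv_mem mU_mem) hC
  have hA : turn (vertexA eqAngle) ∈ commGroup := by
    have e : vertexA eqAngle = mV⁻¹ • vertexB eqAngle := by
      rw [eq_inv_smul_iff]; exact sideV_A eqAngle
    rw [e]
    exact turn_smul_mem (inv_mem mV_mem) hB
  obtain ⟨g, hg, h⟩ := hz.exists_grid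
  have e : z = g⁻¹ • g • z := (inv_smul_smul g z).symm
  rw [e]
  apply turn_smul_mem (inv_mem hg)
  rcases h with h | h | h <;> rw [h] <;> assumption

/-! ### The surface group -/

variable {m n : ℕ} {Γ : Subgroup SL(2, ℝ)}

theorem IsSurfaceGroup.turn_notMem (hΓ : IsSurfaceGroup eqAngle m n Γ) (z : ℍ) :
    turn z ∉ Γ := by
  intro h
  have h1 := hΓ.free _ h z (turn_smul_self z)
  exact vertexA_ne_vertexB ((eq_of_turn_smul (h1 _)).trans (eq_of_turn_smul (h1 _)).symm)

theorem IsSurfaceGroup.mul_mem_iff (hΓ : IsSurfaceGroup eqAngle m n Γ) {x y : SL(2, ℝ)}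
    (hx : x ∈ torusGroup eqAngle m n) (hy : y ∈ torusGroup eqAngle m n) :
    x * y ∈ Γ ↔ (x ∈ Γ ↔ y ∈ Γ) := by
  have h : (Γ.subgroupOf (torusGroup eqAngle m n)).index = 2 := hΓ.index_two
  exact Subgroup.mul_mem_iff_of_index_two h (a := ⟨x, hx⟩) (b := ⟨y, hy⟩)

/-- `-1` is the square of a vertex half-turn, and squares lie in a subgroup of index two. Signs of
matrices therefore never matter for membership in `Γ`. -/
theorem IsSurfaceGroup.neg_one_mem (hΓ : IsSurfaceGroup eqAngle m n Γ) : -1 ∈ Γ := by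
  rw [← turn_mul_self (vertexA eqAngle), hΓ.mul_mem_iff] <;>
    exact commGroup_le m n isVertex_A.turn_mem

theorem IsSurfaceGroup.turn_mul_turn_mem (hΓ : IsSurfaceGroup eqAngle m n Γ) {z w : ℍ}
    (hz : IsVertex z) (hw : IsVertex w) : turn z * turn w ∈ Γ := by
  rw [hΓ.mul_mem_iff (commGroup_le m n hz.turn_mem) (commGroup_le m n hw.turn_mem)]
  exact iff_of_false (hΓ.turn_notMem z) (hΓ.turn_notMem w)

theorem IsSurfaceGroup.neg_mem (hΓ : IsSurfaceGroup eqAngle m n Γ) {g : SL(2, ℝ)} (hg : g ∈ Γ) :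
    -g ∈ Γ := by
  rw [← neg_one_mul]; exact mul_mem hΓ.neg_one_mem hg

theorem IsSurfaceGroup.le_grid (hΓ : IsSurfaceGroup eqAngle m n Γ) : Γ ≤ gridGroup := by
  intro g hg
  obtain ⟨w, -, rfl⟩ := hΓ.le hg
  exact word_mem w

end

end BolzaLike

namespace BolzaLike

noncomputable section

/-! ### Integral elements -/

/-- `g = a + x` with integral scalar part `a` and integral vector part `x`. -/
def IsIntegralElt (g : SL(2, ℝ)) (a : Z3) (x : Z3 × Z3 × Z3) : Prop :=
  (g : Matrix (Fin 2) (Fin 2) ℝ) = emb a • 1 + vmat (embv x)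

/-- Integral elements congruent to `1` modulo `2`. -/
def IsEvenElt (g : SL(2, ℝ)) : Prop :=
  ∃ a x, IsIntegralElt g a x ∧ (∃ k, a = 1 + 2 * k) ∧ ∃ k, vsum x = 2 * k

/-- Integral elements congruent to a half-turn modulo `2`. -/
def IsOddElt (g : SL(2, ℝ)) : Prop :=
  ∃ a x, IsIntegralElt g a x ∧ (∃ k, a = 2 * k) ∧ ∃ k, vsum x = 1 + 2 * k

theorem embv_vcross (x y : Z3 × Z3 × Z3) :
    embv (vcross tz x y) = vcross rt (embv x) (embv y) := by
  simp only [embv, vcross, map_add, map_sub, map_mul, map_neg, emb_tz, map_ofNat]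

theorem embv_add (x y : Z3 × Z3 × Z3) : embv (x + y) = embv x + embv y := by
  simp [embv]

theorem embv_smul (a : Z3) (x : Z3 × Z3 × Z3) : embv (a • x) = emb a • embv x := by
  simp [embv]

theorem IsIntegralElt.mul {g h : SL(2, ℝ)} {a b : Z3} {x y : Z3 × Z3 × Z3}
    (hg : IsIntegralElt g a x) (hh : IsIntegralElt h b y) :
    IsIntegralElt (g * h) (a * b - bil tz x y) (a • y + b • x + vcross tz x y) := by
  unfold IsIntegralElt at *
  rw [Matrix.SpecialLinearGroup.coe_mul, hg, hh, embv_add, embv_add, embv_smul, embv_smul,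
    embv_vcross, vmat_add, vmat_add, vmat_smul, vmat_smul, map_sub, map_mul, ← emb_bil]
  simp only [add_mul, mul_add, smul_mul_assoc, mul_smul_comm, one_mul, mul_one, vmat_mul_vmat]
  match_scalars <;> ring

theorem IsIntegralElt.norm {g : SL(2, ℝ)} {a : Z3} {x : Z3 × Z3 × Z3}
    (hg : IsIntegralElt g a x) : a ^ 2 + bil tz x x = 1 := by
  apply emb_injective
  rw [map_add, map_pow, ← emb_bil, ← det_scalar_add_vmat, ← hg, g.det_coe, map_one]

theorem IsIntegralElt.inv {g : SL(2, ℝ)} {a : Z3} {x : Z3 × Z3 × Z3}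
    (hg : IsIntegralElt g a x) : IsIntegralElt g⁻¹ a (-x) := by
  have hn := hg.norm
  have h1 : a ^ 2 + bil tz (-x) (-x) = 1 := by rw [bil_neg_left, bil_neg_right, neg_neg, hn]
  have h2 : (emb a) ^ 2 + bil rt (embv (-x)) (embv (-x)) = 1 := by
    rw [emb_bil, ← map_pow, ← map_add, h1, map_one]
  have h3 : g * slMk (emb a) (embv (-x)) h2 = 1 := by
    apply Subtype.ext
    rw [Matrix.SpecialLinearGroup.coe_mul, slMk_coe, hg, embv_neg, vmat_neg]
    simp only [add_mul, mul_add, smul_mul_assoc, mul_smul_comm, one_mul, mul_one, mul_neg,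
      vmat_mul_self]
    have h4 : emb a ^ 2 + bil rt (embv x) (embv x) = 1 := by
      rw [emb_bil, ← map_pow, ← map_add, hn, map_one]
    rw [Matrix.SpecialLinearGroup.coe_one]
    match_scalars <;> linarith
  rw [inv_eq_of_mul_eq_one_right h3]
  exact slMk_coe _ _ _

/-- Modulo `2`, the coordinate sum of the alternating product vanishes. So scalar part and
coordinate sum multiply as in the group ring of a group of order two, which makes even and odd
elements behave like the values of a homomorphism. -/
theorem vsum_mul_part (a b : Z3) (x y : Z3 × Z3 × Z3) :
    ∃ q, vsum (a • y + b • x + vcross tz x y) = a * vsum y + b * vsum x + 2 * q := by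
  refine ⟨(1 - tz) * ((x.1 * y.2.1 - x.2.1 * y.1) + (x.2.1 * y.2.2 - x.2.2 * y.2.1) +
    (x.2.2 * y.1 - x.1 * y.2.2)), ?_⟩
  simp only [vsum, vcross, Prod.fst_add, Prod.snd_add, Prod.smul_fst, Prod.smul_snd, smul_eq_mul]
  ring

theorem IsEvenElt.mul {g h : SL(2, ℝ)} (hg : IsEvenElt g) (hh : IsEvenElt h) :
    IsEvenElt (g * h) := by
  obtain ⟨a, x, hx, ⟨k, hk⟩, l, hl⟩ := hg
  obtain ⟨b, y, hy, ⟨k', hk'⟩, l', hl'⟩ := hh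
  refine ⟨_, _, hx.mul hy, ?_, ?_⟩
  · refine ⟨k + k' + 2 * k * k' - (3 + 2 * tz) * 2 * l * l' +
      (1 + tz) * (x.1 * y.1 + x.2.1 * y.2.1 + x.2.2 * y.2.2), ?_⟩
    rw [bil, hk, hk', hl, hl']; ring
  · obtain ⟨q, hq⟩ := vsum_mul_part a b x y
    rw [hq, hl, hl']
    exact ⟨a * l' + b * l + q, by ring⟩

theorem IsEvenElt.mul_odd {g h : SL(2, ℝ)} (hg : IsEvenElt g) (hh : IsOddElt h) :
    IsOddElt (g * h) := by
  obtain ⟨a, x, hx, ⟨k, hk⟩, l, hl⟩ := hg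
  obtain ⟨b, y, hy, ⟨k', hk'⟩, l', hl'⟩ := hh
  refine ⟨_, _, hx.mul hy, ?_, ?_⟩
  · refine ⟨(1 + 2 * k) * k' - (3 + 2 * tz) * l * (1 + 2 * l') +
      (1 + tz) * (x.1 * y.1 + x.2.1 * y.2.1 + x.2.2 * y.2.2), ?_⟩
    rw [bil, hk, hk', hl, hl']; ring
  · obtain ⟨q, hq⟩ := vsum_mul_part a b x y
    rw [hq, hl, hl', hk, hk']
    exact ⟨k + l' + 2 * k * l' + 2 * k' * l + q, by ring⟩

theorem IsOddElt.mul_even {g h : SL(2, ℝ)} (hg : IsOddElt g) (hh : IsEvenElt h) :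
    IsOddElt (g * h) := by
  obtain ⟨a, x, hx, ⟨k, hk⟩, l, hl⟩ := hg
  obtain ⟨b, y, hy, ⟨k', hk'⟩, l', hl'⟩ := hh
  refine ⟨_, _, hx.mul hy, ?_, ?_⟩
  · refine ⟨k * (1 + 2 * k') - (3 + 2 * tz) * (1 + 2 * l) * l' +
      (1 + tz) * (x.1 * y.1 + x.2.1 * y.2.1 + x.2.2 * y.2.2), ?_⟩
    rw [bil, hk, hk', hl, hl']; ring
  · obtain ⟨q, hq⟩ := vsum_mul_part a b x y
    rw [hq, hl, hl', hk, hk']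
    exact ⟨k' + l + 2 * k * l' + 2 * k' * l + q, by ring⟩

theorem IsOddElt.mul {g h : SL(2, ℝ)} (hg : IsOddElt g) (hh : IsOddElt h) :
    IsEvenElt (g * h) := by
  obtain ⟨a, x, hx, ⟨k, hk⟩, l, hl⟩ := hg
  obtain ⟨b, y, hy, ⟨k', hk'⟩, l', hl'⟩ := hh
  refine ⟨_, _, hx.mul hy, ?_, ?_⟩
  · refine ⟨2 * k * k' - 2 - tz - (3 + 2 * tz) * (l + l' + 2 * l * l') +
      (1 + tz) * (x.1 * y.1 + x.2.1 * y.2.1 + x.2.2 * y.2.2), ?_⟩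
    rw [bil, hk, hk', hl, hl']; ring
  · obtain ⟨q, hq⟩ := vsum_mul_part a b x y
    rw [hq, hl, hl', hk, hk']
    exact ⟨k + k' + 2 * k * l' + 2 * k' * l + q, by ring⟩

theorem IsEvenElt.inv {g : SL(2, ℝ)} (hg : IsEvenElt g) : IsEvenElt g⁻¹ := by
  obtain ⟨a, x, hx, hk, l, hl⟩ := hg
  refine ⟨_, _, hx.inv, hk, -l, ?_⟩
  simp only [vsum, Prod.fst_neg, Prod.snd_neg] at *
  linear_combination -hl

theorem IsOddElt.inv {g : SL(2, ℝ)} (hg : IsOddElt g) : IsOddElt g⁻¹ := by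
  obtain ⟨a, x, hx, hk, l, hl⟩ := hg
  refine ⟨_, _, hx.inv, hk, -1 - l, ?_⟩
  simp only [vsum, Prod.fst_neg, Prod.snd_neg] at *
  linear_combination -hl

theorem isEvenElt_one : IsEvenElt 1 := by
  refine ⟨1, 0, ?_, ⟨0, by ring⟩, 0, by simp [vsum]⟩
  simp [IsIntegralElt, embv, show ((0 : ℝ), (0 : ℝ), (0 : ℝ)) = 0 from rfl, vmat_zero]

theorem isOddElt_turn_smul {g : SL(2, ℝ)} (hg : g ∈ gridGroup) :
    IsOddElt (turn (g • vertexC eqAngle)) := by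
  have h : act g (0, 0, 1) ∈ {x | ∃ y, x = embv y ∧ ∃ k, vsum y = 1 + 2 * k} := by
    refine gridGroup_invariant ?_ ?_ ?_ hg ⟨(0, 0, 1), embv_e2.symm, 0, by simp [vsum]⟩
    · rintro _ ⟨y, rfl, k, hk⟩
      refine ⟨_, act_mJ_embv y, k + (tz - 1) * y.2.1, ?_⟩
      simp only [vsum] at *
      linear_combination hk
    · rintro _ ⟨y, rfl, k, hk⟩
      refine ⟨_, act_mJU_embv y, k + (tz - 1) * y.2.2, ?_⟩
      simp only [vsum] at *
      linear_combination hk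
    · rintro _ ⟨y, rfl, k, hk⟩
      refine ⟨_, act_mVJ_embv y, k + (tz - 1) * y.1, ?_⟩
      simp only [vsum] at *
      linear_combination hk
  obtain ⟨y, hy, hk⟩ := h
  refine ⟨0, y, ?_, ⟨0, by ring⟩, hk⟩
  rw [IsIntegralElt, turn_coe, hv_smul, hv_vertexC, hy, map_zero, zero_smul, zero_add]

variable {m n : ℕ} {Γ : Subgroup SL(2, ℝ)}

/-- `commGroup` is generated by conjugates of one half-turn. These generators are odd, and they are
outside `Γ` because they have a fixed point. Congruence modulo `2` and membership in the subgroup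
`Γ` of index two obey the same multiplication rule, so they agree throughout. -/
theorem IsSurfaceGroup.parity (hΓ : IsSurfaceGroup eqAngle m n Γ) {g : SL(2, ℝ)}
    (hg : g ∈ commGroup) : (IsEvenElt g ∧ g ∈ Γ) ∨ (IsOddElt g ∧ g ∉ Γ) := by
  suffices h : g ∈ commGroup ∧ ((IsEvenElt g ∧ g ∈ Γ) ∨ (IsOddElt g ∧ g ∉ Γ)) from h.2
  obtain ⟨w, hw, rfl⟩ := hg
  have hmem : ∀ {x}, x ∈ commGroup → x ∈ torusGroup eqAngle m n := fun h => commGroup_le m n h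
  have hw' := ker_intExp_le hw
  clear hw
  rw [Subgroup.normalClosure] at hw'
  induction hw' using Subgroup.closure_induction with
  | mem u hu =>
    rw [Group.mem_conjugatesOfSet_iff] at hu
    obtain ⟨_, rfl, hu⟩ := hu
    obtain ⟨v, rfl⟩ := isConj_iff.1 hu
    have e : word (v * letterComm * v⁻¹) = turn (word v • vertexC eqAngle) := by
      rw [map_mul, map_mul, map_inv, word_letterComm, turn_smul_eq]
    have hv := isVertex_C.smul (word_mem v)
    rw [e]
    exact ⟨hv.turn_mem, Or.inr ⟨isOddElt_turn_smul (word_mem v), hΓ.turn_notMem _⟩⟩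
  | one => rw [map_one]; exact ⟨one_mem _, Or.inl ⟨isEvenElt_one, one_mem _⟩⟩
  | mul u v _ _ hu hv =>
    rw [map_mul]
    refine ⟨mul_mem hu.1 hv.1, ?_⟩
    rw [hΓ.mul_mem_iff (hmem hu.1) (hmem hv.1)]
    rcases hu.2 with ⟨hu1, hu2⟩ | ⟨hu1, hu2⟩ <;> rcases hv.2 with ⟨hv1, hv2⟩ | ⟨hv1, hv2⟩
    · exact Or.inl ⟨hu1.mul hv1, by tauto⟩
    · exact Or.inr ⟨hu1.mul_odd hv1, by tauto⟩
    · exact Or.inr ⟨hu1.mul_even hv1, by tauto⟩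
    · exact Or.inl ⟨hu1.mul hv1, by tauto⟩
  | inv u _ hu =>
    rw [map_inv]
    refine ⟨inv_mem hu.1, ?_⟩
    rw [inv_mem_iff]
    rcases hu.2 with ⟨hu1, hu2⟩ | ⟨hu1, hu2⟩
    · exact Or.inl ⟨hu1.inv, hu2⟩
    · exact Or.inr ⟨hu1.inv, hu2⟩

/-- The scalar parts of the elements of `Γ` with vanishing exponent sums. -/
theorem IsSurfaceGroup.scalar_cases (hΓ : IsSurfaceGroup eqAngle m n Γ) {g : SL(2, ℝ)}
    (hg : g ∈ commGroup) (hgΓ : g ∈ Γ) {a : ℝ} {x : ℝ × ℝ × ℝ}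
    (hgx : (g : Matrix (Fin 2) (Fin 2) ℝ) = a • 1 + vmat x) :
    x = 0 ∨ (|a| = 3 + 2 * rt ∧ x ∈ lineNormals) ∨ 3 + 2 * rt < |a| := by
  obtain ⟨⟨b, y, hy, ⟨k, hk⟩, hl⟩, -⟩ | ⟨-, h⟩ := hΓ.parity hg
  swap; · exact absurd hgΓ h
  have htr : a = emb b ∧ x = embv y := by
    rw [IsIntegralElt, hgx] at hy
    have h1 := congrArg Matrix.trace hy
    simp only [Matrix.trace_add, Matrix.trace_smul, trace_vmat, Matrix.trace_one, smul_eq_mul] at h1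
    have h2 : a = emb b := by simpa using h1
    refine ⟨h2, vmat_injective ?_⟩
    rw [h2] at hy
    exact add_left_cancel hy
  obtain ⟨rfl, rfl⟩ := htr
  have hn := hy.norm
  have hc : cmb b ^ 2 + bil (-rt) (cmbv y) (cmbv y) = 1 := by
    rw [cmb_bil, ← map_pow, ← map_add, hn, map_one]
  have hb := abs_le_of_sq_le_sq (show cmb b ^ 2 ≤ 1 ^ 2 by
    linarith [bil_conj_nonneg (cmbv y)]) zero_le_one
  rw [cmb_apply] at hb
  obtain ⟨hb1, hb2⟩ := abs_le.1 hb
  have hre := congrArg Zsqrtd.re hk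
  have him := congrArg Zsqrtd.im hk
  simp only [Zsqrtd.re_add, Zsqrtd.re_mul, Zsqrtd.re_ofNat, Zsqrtd.im_ofNat, Zsqrtd.re_one] at hre
  simp only [Zsqrtd.im_add, Zsqrtd.im_mul, Zsqrtd.re_ofNat, Zsqrtd.im_ofNat, Zsqrtd.im_one] at him
  have hr := rt_bounds.1
  have hr' := rt_bounds.2
  -- The congruence makes `b.im` even and `b.re` odd, and the conjugate `b.re - b.im √3` has
  -- absolute value at most `1`. Hence `b` is `±1`, `±(3 + 2√3)`, or has `|b.im| ≥ 4`.
  have hsmall : b.im = 0 ∨ b.im = 2 ∨ b.im = -2 ∨ 4 ≤ b.im ∨ b.im ≤ -4 := by omega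
  have emem : b ^ 2 = ⟨21, 12⟩ → embv y ∈ lineNormals := by
    intro h
    refine ⟨y, ⟨?_, hl⟩, rfl⟩
    have : bil tz y y = 1 - b ^ 2 := by rw [← hn]; ring
    rw [this, h]
    decide
  rcases hsmall with h | h | h | h | h
  · left
    rw [h] at hb1 hb2
    push_cast at hb1 hb2
    have j1 : (b.re : ℝ) ≤ 1 := by linarith
    have j2 : (-1 : ℝ) ≤ b.re := by linarith
    have j1 : b.re ≤ 1 := by exact_mod_cast j1
    have j2 : -1 ≤ b.re := by exact_mod_cast j2
    have hre2 : b.re = 1 ∨ b.re = -1 := by omega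
    have hb' : cmb b ^ 2 = 1 := by
      rw [cmb_apply, h]
      rcases hre2 with e | e <;> rw [e] <;> norm_num
    -- Here the conjugate of the scalar part uses up the whole norm, so the conjugate vector has
    -- norm zero and vanishes.
    have h0 := eq_zero_of_cmbv (eq_zero_of_bil_conj (x := cmbv y) (by linarith))
    rw [h0]; simp [embv]
  · right; left
    rw [h] at hb1 hb2
    push_cast at hb1 hb2
    have j1 : (b.re : ℝ) < 5 := by linarith
    have j2 : (2 : ℝ) < b.re := by linarith
    have j1 : b.re < 5 := by exact_mod_cast j1
    have j2 : 2 < b.re := by exact_mod_cast j2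
    have e : b.re = 3 := by omega
    refine ⟨?_, emem ?_⟩
    · rw [emb_apply, h, e]; push_cast; exact abs_of_pos (by linarith)
    · rw [show b = ⟨3, 2⟩ from Zsqrtd.ext e h]; decide
  · right; left
    rw [h] at hb1 hb2
    push_cast at hb1 hb2
    have j1 : (b.re : ℝ) < -2 := by linarith
    have j2 : (-5 : ℝ) < b.re := by linarith
    have j1 : b.re < -2 := by exact_mod_cast j1
    have j2 : -5 < b.re := by exact_mod_cast j2
    have e : b.re = -3 := by omega
    refine ⟨?_, emem ?_⟩
    · rw [emb_apply, h, e]; push_cast; rw [abs_of_neg (by linarith)]; ring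
    · rw [show b = ⟨-3, -2⟩ from Zsqrtd.ext e h]; decide
  · right; right
    have h' : (4 : ℝ) ≤ b.im := by exact_mod_cast h
    rw [emb_apply, lt_abs]
    left; nlinarith
  · right; right
    have h' : (b.im : ℝ) ≤ -4 := by exact_mod_cast h
    rw [emb_apply, lt_abs]
    right; nlinarith

theorem conj_mul_conj (g : SL(2, ℝ)) (P Q : Matrix (Fin 2) (Fin 2) ℝ) :
    (g : Matrix (Fin 2) (Fin 2) ℝ) * P * ((g⁻¹ : SL(2, ℝ)) : Matrix (Fin 2) (Fin 2) ℝ) *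
      ((g : Matrix (Fin 2) (Fin 2) ℝ) * Q * ((g⁻¹ : SL(2, ℝ)) : Matrix (Fin 2) (Fin 2) ℝ)) =
    (g : Matrix (Fin 2) (Fin 2) ℝ) * (P * Q) *
      ((g⁻¹ : SL(2, ℝ)) : Matrix (Fin 2) (Fin 2) ℝ) := by
  rw [mul_assoc (_ * P), ← mul_assoc _ (_ * Q), ← mul_assoc _ _ Q, coe_inv_mul_coe, one_mul,
    ← mul_assoc, mul_assoc _ P Q]

/-- The translation along a line of the triangulation by twice the side length lies in `Γ`. -/
theorem IsSurfaceGroup.exists_of_lineNormals (hΓ : IsSurfaceGroup eqAngle m n Γ)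
    {x : ℝ × ℝ × ℝ} (hx : x ∈ lineNormals) {z : ℍ} (h : bil rt x (hv z) = 0) :
    ∃ g ∈ Γ, (g : Matrix (Fin 2) (Fin 2) ℝ) = (3 + 2 * rt) • 1 + vmat x := by
  have key : ∀ {v w : ℍ} {y : ℝ × ℝ × ℝ}, IsVertex v → IsVertex w →
      bil rt (hv v) (hv w) = 3 + 2 * rt → vcross rt (hv v) (hv w) = -y →
      ∃ g ∈ Γ, (g : Matrix (Fin 2) (Fin 2) ℝ) = (3 + 2 * rt) • 1 + vmat y := by
    intro v w y hv' hw' hb hy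
    refine ⟨-(turn v * turn w), hΓ.neg_mem (hΓ.turn_mul_turn_mem hv' hw'), ?_⟩
    rw [Matrix.SpecialLinearGroup.coe_neg, Matrix.SpecialLinearGroup.coe_mul, turn_coe, turn_coe,
      vmat_mul_vmat, hb, hy, vmat_neg]
    rw [neg_smul, neg_add, neg_neg, neg_neg]
  have key2 : ∀ {g : SL(2, ℝ)} {v w : ℍ} {y : ℝ × ℝ × ℝ}, g ∈ gridGroup → IsVertex v →
      IsVertex w → bil rt (hv v) (hv w) = 3 + 2 * rt → vcross rt (hv v) (hv w) = y →
      act g x = y ∨ act g x = -y →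
      ∃ g ∈ Γ, (g : Matrix (Fin 2) (Fin 2) ℝ) = (3 + 2 * rt) • 1 + vmat x := by
    intro g v w y hg hv' hw' hb hy hgx
    have hx' : x = act g⁻¹ y ∨ x = -act g⁻¹ y := by
      rw [← act_neg]
      exact hgx.imp (fun e => by rw [← e, act_inv_act]) (fun e => by rw [← e, act_inv_act])
    have hc : ∀ v w : ℍ, bil rt (hv v) (hv w) = 3 + 2 * rt →
        vcross rt (hv (g⁻¹ • v)) (hv (g⁻¹ • w)) = act g⁻¹ (vcross rt (hv v) (hv w)) := by
      intro v w hb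
      apply vmat_injective
      have e1 := vmat_mul_vmat (hv (g⁻¹ • v)) (hv (g⁻¹ • w))
      have e2 := vmat_mul_vmat (hv v) (hv w)
      rw [hv_smul, hv_smul, bil_act, vmat_act, vmat_act] at e1
      rw [conj_mul_conj, e2, mul_add, add_mul, mul_smul_comm, smul_mul_assoc, mul_one, coe_mul_coe_inv] at e1
      rw [hv_smul, hv_smul, vmat_act]
      exact (add_left_cancel e1).symm
    have hv2 := hv'.smul (inv_mem hg)
    have hw2 := hw'.smul (inv_mem hg)
    -- Exchanging the two vertices reverses the translation, which takes care of the sign of the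
    -- normal vector.
    rcases hx' with e | e
    · refine key hw2 hv2 ?_ ?_
      · rw [hv_smul, hv_smul, bil_act, bil_comm, hb]
      · rw [vcross_swap, hc _ _ hb, hy, e]
    · refine key hv2 hw2 ?_ ?_
      · rw [hv_smul, hv_smul, bil_act, hb]
      · rw [hc _ _ hb, hy, e, neg_neg]
  obtain ⟨g, hg, s, hs, hgs⟩ := exists_grid_side hx h
  simp only [Set.mem_insert_iff, Set.mem_singleton_iff] at hs
  rcases hs with rfl | rfl | rfl
  · refine key2 hg isVertex_A isVertex_B ?_ ?_ hgs
    · rw [hv_vertexA, hv_vertexB]; simp [bil, vsum]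
    · rw [hv_vertexA, hv_vertexB]; simp [vcross]
  · refine key2 hg isVertex_C isVertex_A ?_ ?_ hgs
    · rw [hv_vertexA, hv_vertexC]; simp [bil, vsum]
    · rw [hv_vertexA, hv_vertexC]; simp [vcross]
  · refine key2 hg isVertex_B isVertex_C ?_ ?_ hgs
    · rw [hv_vertexB, hv_vertexC]; simp [bil, vsum]
    · rw [hv_vertexB, hv_vertexC]; simp [vcross]

end

end BolzaLike

namespace BolzaLike

noncomputable section

/-! ### Disjoint lines cutting the torus into strips -/

/-- Integral normal vectors of lines with parity pattern `e`. -/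
def stripInt (e : Z3 × Z3 × Z3) : Set (Z3 × Z3 × Z3) :=
  {n | bil tz n n = ⟨0, -2⟩ ∧ ((∃ k, n.1 = e.1 + (1 + tz) * k) ∧
    (∃ k, n.2.1 = e.2.1 + (1 + tz) * k) ∧ ∃ k, n.2.2 = e.2.2 + (1 + tz) * k) ∧
    (∃ a, vsum n = (1 + tz) * (1 + 2 * a)) ∧ ∃ q, n.1 * n.2.1 * n.2.2 = 1 + tz * q}

/-- An admissible parity pattern. -/
structure IsPattern (e : Z3 × Z3 × Z3) : Prop where
  sum : vsum e = 2
  sq : e.1 * e.1 + e.2.1 * e.2.1 + e.2.2 * e.2.2 = 2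

/-- The congruence conditions on strip vectors are designed for this: products are determined modulo
`4`, while `strip_gap` bounds their conjugates by `2√3`. -/
theorem bil_stripInt {e n n' : Z3 × Z3 × Z3} (he : IsPattern e) (hn : n ∈ stripInt e)
    (hn' : n' ∈ stripInt e) : ∃ q, bil tz n n' = 2 * tz + 4 * q := by
  obtain ⟨-, ⟨⟨k0, h0⟩, ⟨k1, h1⟩, k2, h2⟩, ⟨a, ha⟩, -⟩ := hn
  obtain ⟨-, ⟨⟨l0, g0⟩, ⟨l1, g1⟩, l2, g2⟩, ⟨b, hb⟩, -⟩ := hn'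
  have ht := tz_sq
  have hsq := he.sq
  set K := e.1 * l0 + e.2.1 * l1 + e.2.2 * l2 + k0 * e.1 + k1 * e.2.1 + k2 * e.2.2 +
    (1 + tz) * (k0 * l0 + k1 * l1 + k2 * l2)
  have hdot : n.1 * n'.1 + n.2.1 * n'.2.1 + n.2.2 * n'.2.2 = 2 + (1 + tz) * K := by
    rw [h0, h1, h2, g0, g1, g2]
    linear_combination hsq
  have hss : vsum n * vsum n' = (4 + 2 * tz) * (1 + 2 * (a + b + 2 * a * b)) := by
    rw [ha, hb]
    linear_combination (1 + 2 * a) * (1 + 2 * b) * ht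
  refine ⟨5 + 2 * tz + (12 + 7 * tz) * (a + b + 2 * a * b) - (2 + tz) * K, ?_⟩
  rw [bil, hdot, hss]
  linear_combination (4 + 8 * (a + b + 2 * a * b) - 2 * K) * ht

/-- The midpoint half-turns carry strip normals to negatives of strip normals. The side pairings are
products of two of them up to sign, so they preserve the family with its orientation, as signed
crossing numbers require. -/
theorem neg_act_mem_stripInt {e n : Z3 × Z3 × Z3} (he : IsPattern e) (hn : n ∈ stripInt e) :
    -(n.2.2 + tz * n.2.1, -n.2.1, n.1 + tz * n.2.1) ∈ stripInt e ∧
    -(n.2.1 + tz * n.2.2, n.1 + tz * n.2.2, -n.2.2) ∈ stripInt e ∧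
    -(-n.1, n.2.2 + tz * n.1, n.2.1 + tz * n.1) ∈ stripInt e := by
  have h1' := bil_of_act_embv (act_mJ_embv n)
  have h2' := bil_of_act_embv (act_mJU_embv n)
  have h3' := bil_of_act_embv (act_mVJ_embv n)
  obtain ⟨hb, ⟨⟨k0, h0⟩, ⟨k1, h1⟩, k2, h2⟩, ⟨a, ha⟩, q, hq⟩ := hn
  have ht := tz_sq
  have hs := he.sum
  have hneg : ∀ x : Z3 × Z3 × Z3, bil tz (-x) (-x) = bil tz x x := fun x => by
    rw [bil_neg_left, bil_neg_right, neg_neg]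
  simp only [vsum] at hs ha
  refine ⟨⟨by rw [hneg, h1', hb], ⟨⟨-(tz - 1) - (2 - tz) * e.2.1 - (k2 + tz * k1), ?_⟩,
    ⟨k1, ?_⟩, ⟨-(tz - 1) - (2 - tz) * e.2.1 - (k0 + tz * k1), ?_⟩⟩,
    ⟨-1 - a - (2 - tz) * n.2.1, ?_⟩,
    ⟨q + n.2.1 * (n.2.1 * n.2.2 + n.2.1 * n.1 + tz * n.2.1 ^ 2), ?_⟩⟩,
    ⟨by rw [hneg, h2', hb], ⟨⟨-(tz - 1) - (2 - tz) * e.2.2 - (k1 + tz * k2), ?_⟩,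
    ⟨-(tz - 1) - (2 - tz) * e.2.2 - (k0 + tz * k2), ?_⟩, ⟨k2, ?_⟩⟩,
    ⟨-1 - a - (2 - tz) * n.2.2, ?_⟩,
    ⟨q + n.2.2 * (n.2.2 * n.2.1 + n.2.2 * n.1 + tz * n.2.2 ^ 2), ?_⟩⟩,
    ⟨by rw [hneg, h3', hb], ⟨⟨k0, ?_⟩,
    ⟨-(tz - 1) - (2 - tz) * e.1 - (k2 + tz * k0), ?_⟩,
    ⟨-(tz - 1) - (2 - tz) * e.1 - (k1 + tz * k0), ?_⟩⟩,
    ⟨-1 - a - (2 - tz) * n.1, ?_⟩,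
    ⟨q + n.1 * (n.1 * n.2.2 + n.1 * n.2.1 + tz * n.1 ^ 2), ?_⟩⟩⟩ <;>
    simp only [vsum, Prod.fst_neg, Prod.snd_neg]
  · linear_combination -h2 - tz * h1 - hs + (1 - e.2.1) * ht
  · linear_combination h1
  · linear_combination -h0 - tz * h1 - hs + (1 - e.2.1) * ht
  · linear_combination -ha - 2 * n.2.1 * ht
  · linear_combination hq
  · linear_combination -h1 - tz * h2 - hs + (1 - e.2.2) * ht
  · linear_combination -h0 - tz * h2 - hs + (1 - e.2.2) * ht
  · linear_combination h2
  · linear_combination -ha - 2 * n.2.2 * ht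
  · linear_combination hq
  · linear_combination h0
  · linear_combination -h2 - tz * h0 - hs + (1 - e.1) * ht
  · linear_combination -h1 - tz * h0 - hs + (1 - e.1) * ht
  · linear_combination -ha - 2 * n.1 * ht
  · linear_combination hq

/-- Real normal vectors of the strip lines. -/
def stripNormals (e : Z3 × Z3 × Z3) : Set (ℝ × ℝ × ℝ) := embv '' stripInt e

theorem bil_strip_self {e : Z3 × Z3 × Z3} {n : ℝ × ℝ × ℝ} (hn : n ∈ stripNormals e) :
    bil rt n n = -(2 * rt) := by
  obtain ⟨n, hn, rfl⟩ := hn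
  rw [emb_bil, hn.1, emb_apply]; push_cast; ring

theorem act_mem_strip {e : Z3 × Z3 × Z3} (he : IsPattern e) (w : FreeGroup (Fin 2))
    {x : ℝ × ℝ × ℝ} (hx : x ∈ stripNormals e) : act (word w) x ∈ stripNormals e := by
  have hJ : ∀ x ∈ stripNormals e, -act mJ x ∈ stripNormals e := by
    rintro _ ⟨n, hn, rfl⟩
    exact ⟨_, (neg_act_mem_stripInt he hn).1, by rw [embv_neg, act_mJ_embv]⟩
  have hJU : ∀ x ∈ stripNormals e, -act (mJ * mU) x ∈ stripNormals e := by
    rintro _ ⟨n, hn, rfl⟩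
    exact ⟨_, (neg_act_mem_stripInt he hn).2.1, by rw [embv_neg, act_mJU_embv]⟩
  have hVJ : ∀ x ∈ stripNormals e, -act (mV * mJ) x ∈ stripNormals e := by
    rintro _ ⟨n, hn, rfl⟩
    exact ⟨_, (neg_act_mem_stripInt he hn).2.2, by rw [embv_neg, act_mVJ_embv]⟩
  have inv_of : ∀ k : SL(2, ℝ), (∀ y, act k (act k y) = y) → ∀ y, act k⁻¹ y = act k y :=
    fun k hk y => by nth_rw 1 [← hk y]; rw [act_inv_act]
  have hU : ∀ x ∈ stripNormals e, act mU x ∈ stripNormals e := by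
    intro x hx
    have e1 : act mU x = -act mJ (-act (mJ * mU) x) := by
      rw [act_neg, neg_neg, act_mul, act_mJ_mJ]
    rw [e1]; exact hJ _ (hJU _ hx)
  have hU' : ∀ x ∈ stripNormals e, act mU⁻¹ x ∈ stripNormals e := by
    intro x hx
    have e1 : act mU⁻¹ x = -act (mJ * mU) (-act mJ x) := by
      rw [act_neg, neg_neg, ← inv_of _ act_mJU_mJU, ← act_mul]
      group
    rw [e1]; exact hJU _ (hJ _ hx)
  have hV : ∀ x ∈ stripNormals e, act mV x ∈ stripNormals e := by
    intro x hx
    have e1 : act mV x = -act (mV * mJ) (-act mJ x) := by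
      rw [act_neg, neg_neg, act_mV]
    rw [e1]; exact hVJ _ (hJ _ hx)
  have hV' : ∀ x ∈ stripNormals e, act mV⁻¹ x ∈ stripNormals e := by
    intro x hx
    have e1 : act mV⁻¹ x = -act mJ (-act (mV * mJ) x) := by
      rw [act_neg, neg_neg, ← inv_of _ act_mVJ_mVJ, ← act_mul]
      group
    rw [e1]; exact hJ _ (hVJ _ hx)
  induction w using FreeGroup.induction_on generalizing x with
  | C1 => rw [map_one, act_one]; exact hx
  | of i =>
    fin_cases i
    · exact word_zero ▸ hU x hx
    · exact word_one ▸ hV x hx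
  | inv_of i h =>
    rw [map_inv]
    fin_cases i
    · exact word_zero ▸ hU' x hx
    · exact word_one ▸ hV' x hx
  | mul a b ha hb => rw [map_mul, act_mul]; exact ha (hb hx)

/-- The conjugate product has absolute value at most `2√3`, with the extreme values only for equal
or opposite vectors. Among the values `2√3 + 4 q` the remaining ones have absolute value at least `4
+ 2√3`, so different strip lines are disjoint and uniformly far apart. -/
theorem strip_gap {e : Z3 × Z3 × Z3} (he : IsPattern e) {x x' : ℝ × ℝ × ℝ}
    (hx : x ∈ stripNormals e) (hx' : x' ∈ stripNormals e) (hne : x ≠ x') :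
    4 + 2 * rt ≤ |bil rt x x'| := by
  obtain ⟨n, hn, rfl⟩ := hx
  obtain ⟨n', hn', rfl⟩ := hx'
  obtain ⟨q, hq⟩ := bil_stripInt he hn hn'
  have hr := rt_bounds.1
  have hr' := rt_bounds.2
  have hself : ∀ n ∈ stripInt e, bil (-rt) (cmbv n) (cmbv n) = 2 * rt := fun n hn => by
    rw [cmb_bil, hn.1, cmb_apply]; push_cast; ring
  have hcm : bil (-rt) (cmbv n) (cmbv n') = -(2 * rt) + 4 * (q.re - q.im * rt) := by
    rw [cmb_bil, hq, map_add, map_mul, map_mul, cmb_tz, map_ofNat, map_ofNat, cmb_apply]; ring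
  have hsq := bil_conj_sq_le (cmbv n) (cmbv n')
  rw [hself n hn, hself n' hn', hcm] at hsq
  have hab : |-(2 * rt) + 4 * (q.re - q.im * rt)| ≤ 2 * rt :=
    abs_le_of_sq_le_sq (by rw [pow_two (2 * rt)]; exact hsq) (by linarith)
  have hab := abs_le.1 hab
  rw [emb_bil, hq, map_add, map_mul, map_mul, emb_tz, map_ofNat, map_ofNat, emb_apply]
  have n1 : ¬ (q.re = 0 ∧ q.im = 0) := by
    rintro ⟨h1, h2⟩
    rw [h1, h2] at hcm
    have h3 : bil (-rt) (cmbv (n + n')) (cmbv (n + n')) ≤ 0 := by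
      rw [cmbv_add, bil_add_left, bil_add_right, bil_add_right, bil_comm _ (cmbv n'), hself n hn,
        hself n' hn', hcm]
      push_cast
      linarith
    have h4 : n' = -n := eq_neg_of_add_eq_zero_right (eq_zero_of_cmbv (eq_zero_of_bil_conj h3))
    obtain ⟨-, -, -, a, ha⟩ := hn
    obtain ⟨-, -, -, b, hb⟩ := hn'
    rw [h4] at hb
    simp only [Prod.fst_neg, Prod.snd_neg] at hb
    -- Opposite vectors are excluded by the last strip condition: the product of the coordinates is
    -- `1` modulo `√3`, and changing signs would make it `-1`.
    have h5 : (2 : Z3) + tz * (a + b) = 0 := by linear_combination -ha - hb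
    have h6 := congrArg Zsqrtd.re h5
    simp only [Zsqrtd.re_add, Zsqrtd.re_mul, Zsqrtd.re_sqrtd, Zsqrtd.im_sqrtd, Zsqrtd.re_ofNat,
      Zsqrtd.im_add, Zsqrtd.re_zero] at h6
    omega
  have n2 : ¬ (q.re = 0 ∧ q.im = -1) := by
    rintro ⟨h1, h2⟩
    rw [h1, h2] at hcm
    have h3 : bil (-rt) (cmbv (n + -n')) (cmbv (n + -n')) ≤ 0 := by
      rw [cmbv_add, cmbv_neg, bil_add_left, bil_add_right, bil_add_right, bil_neg_left,
        bil_neg_left, bil_neg_right, bil_neg_right, bil_comm _ (cmbv n'), hself n hn,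
        hself n' hn', hcm]
      push_cast
      linarith
    exact hne (by rw [add_neg_eq_zero.1 (eq_zero_of_cmbv (eq_zero_of_bil_conj h3))])
  generalize q.re = i at *
  generalize q.im = j at *
  rcases lt_trichotomy j 0 with hj | hj | hj
  · rcases (show j ≤ -1 by omega).lt_or_eq with hj1 | rfl
    · have hj2 : (j : ℝ) ≤ -2 := by exact_mod_cast (show j ≤ -2 by omega)
      rw [le_abs]
      right
      nlinarith
    · have i1 : (i : ℝ) < 1 := by push_cast at *; linarith
      have i1 : i < 1 := by exact_mod_cast i1
      have i2 : i ≤ -1 := by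
        have : i ≠ 0 := fun h => n2 ⟨h, rfl⟩
        omega
      have i3 : (i : ℝ) ≤ -1 := by exact_mod_cast i2
      rw [le_abs]
      right
      push_cast
      linarith
  · subst hj
    have i1 : (-1 : ℝ) < i := by push_cast at *; linarith
    have i1 : -1 < i := by exact_mod_cast i1
    have i2 : 1 ≤ i := by
      have : i ≠ 0 := fun h => n1 ⟨h, rfl⟩
      omega
    have i3 : (1 : ℝ) ≤ i := by exact_mod_cast i2
    rw [le_abs]
    left
    push_cast
    linarith
  · have hj2 : (1 : ℝ) ≤ j := by exact_mod_cast (show 1 ≤ j by omega)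
    rw [le_abs]
    left
    nlinarith

/-! ### Signed crossing numbers -/

open Classical in
/-- The indicator of the positive side of a line. -/
def side (n : ℝ × ℝ × ℝ) (z : ℍ) : ℤ := if 0 < bil rt n (hv z) then 1 else 0

/-- The signed number of strip lines between two points. -/
def crossing (e : Z3 × Z3 × Z3) (z w : ℍ) : ℤ := ∑ᶠ n : stripNormals e, (side n w - side n z)

theorem mul_nonpos_of_side_ne {n : ℝ × ℝ × ℝ} {z w : ℍ} (h : side n w - side n z ≠ 0) :
    bil rt n (hv z) * bil rt n (hv w) ≤ 0 := by
  unfold side at h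
  split_ifs at h with h1 h2 h2
  · simp at h
  · exact mul_nonpos_of_nonpos_of_nonneg (not_lt.1 h2) h1.le
  · exact mul_nonpos_of_nonneg_of_nonpos h2.le (not_lt.1 h1)
  · simp at h

theorem finite_side_ne (e : Z3 × Z3 × Z3) (z w : ℍ) :
    (Function.support fun n : stripNormals e => side n w - side n z).Finite := by
  have h := (finite_separating ⟨0, -2⟩ z w).image embv
  refine Set.Finite.of_finite_image (f := Subtype.val) (h.subset ?_) Subtype.val_injective.injOn
  rintro _ ⟨⟨_, n, hn, rfl⟩, hne, rfl⟩
  exact ⟨n, ⟨hn.1, mul_nonpos_of_side_ne hne⟩, rfl⟩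

theorem crossing_add (e : Z3 × Z3 × Z3) (z w u : ℍ) :
    crossing e z w + crossing e w u = crossing e z u := by
  rw [crossing, crossing, crossing, ← finsum_add_distrib (finite_side_ne e z w)
    (finite_side_ne e w u)]
  exact finsum_congr fun n => by ring

theorem crossing_self (e : Z3 × Z3 × Z3) (z : ℍ) : crossing e z z = 0 := by
  simp [crossing]

theorem crossing_smul {e : Z3 × Z3 × Z3} (he : IsPattern e) (w : FreeGroup (Fin 2)) (z u : ℍ) :
    crossing e (word w • z) (word w • u) = crossing e z u := by
  let E : stripNormals e ≃ stripNormals e :=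
    { toFun := fun n => ⟨act (word w) n, act_mem_strip he w n.2⟩
      invFun := fun n => ⟨act (word w)⁻¹ n, map_inv word w ▸ act_mem_strip he w⁻¹ n.2⟩
      left_inv := fun n => Subtype.ext (act_inv_act _ _)
      right_inv := fun n => Subtype.ext (act_act_inv _ _) }
  rw [crossing, crossing, ← finsum_comp_equiv E]
  refine finsum_congr fun n => ?_
  simp only [side, E, Equiv.coe_fn_mk, hv_smul, bil_act]

/-- Additivity and invariance under words make the change of base point cancel, so a word has a
well-defined crossing number. -/
theorem crossing_indep {e : Z3 × Z3 × Z3} (he : IsPattern e) (w : FreeGroup (Fin 2)) (z u : ℍ) :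
    crossing e z (word w • z) = crossing e u (word w • u) := by
  have h1 := crossing_add e z u (word w • u)
  have h2 := crossing_add e z (word w • z) (word w • u)
  rw [crossing_smul he] at h2
  linarith

theorem crossing_word {e : Z3 × Z3 × Z3} (he : IsPattern e) {α β : ℤ} {z₀ : ℍ}
    (hα : crossing e z₀ (mU • z₀) = α) (hβ : crossing e z₀ (mV • z₀) = β)
    (w : FreeGroup (Fin 2)) (z : ℍ) : crossing e z (word w • z) =
      (intExp w).1.toAdd * α + (intExp w).2.toAdd * β := by
  have hof : ∀ (i : Fin 2) (z : ℍ), crossing e z (word (FreeGroup.of i) • z) =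
      (intExp (FreeGroup.of i)).1.toAdd * α + (intExp (FreeGroup.of i)).2.toAdd * β := by
    intro i z
    rw [crossing_indep he _ z z₀]
    fin_cases i
    · simp only [Fin.zero_eta, word_zero, hα]; simp [intExp]
    · simp only [Fin.mk_one, word_one, hβ]; simp [intExp]
  induction w using FreeGroup.induction_on generalizing z with
  | C1 => simp [crossing_self]
  | of i => exact hof i z
  | inv_of i h =>
    have h1 := hof i ((word (FreeGroup.of i))⁻¹ • z)
    rw [smul_inv_smul] at h1
    have h2 := crossing_add e z ((word (FreeGroup.of i))⁻¹ • z) z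
    rw [crossing_self, h1] at h2
    rw [map_inv, map_inv]
    simp only [Prod.fst_inv, Prod.snd_inv, toAdd_inv]
    linarith
  | mul a b ha hb =>
    have h := crossing_add e z (word a • z) (word a • word b • z)
    rw [crossing_smul he, ha, hb] at h
    rw [map_mul, map_mul, mul_smul, ← h]
    simp only [Prod.fst_mul, Prod.snd_mul, toAdd_mul]
    ring

/-! ### The two families of strips -/

/-- The pattern of the strips parallel to `V`. -/
def patV : Z3 × Z3 × Z3 := (1, 1, 0)

/-- The pattern of the strips parallel to `U`. -/
def patU : Z3 × Z3 × Z3 := (0, 1, 1)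

theorem isPattern_patV : IsPattern patV := ⟨by decide, by decide⟩

theorem isPattern_patU : IsPattern patU := ⟨by decide, by decide⟩

/-- This vector is fixed by `mV` and orthogonal to the midpoint of `AC`: it is normal to the axis of
`mV` through the centre of the square. `normalU_mem` is its counterpart for `mU`. -/
theorem normalV_mem : (2 - rt, 2 - rt, 1 - rt) ∈ stripNormals patV := by
  refine ⟨(2 - tz, 2 - tz, 1 - tz), ⟨by decide, ⟨⟨tz - 2, by decide⟩, ⟨tz - 2, by decide⟩,
    ⟨tz - 2, by decide⟩⟩, ⟨2 * tz - 4, by decide⟩, ⟨6 * tz - 11, by decide⟩⟩, ?_⟩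
  simp only [embv, map_sub, map_ofNat, map_one, emb_tz]

theorem normalU_mem : (1 - rt, 2 - rt, 2 - rt) ∈ stripNormals patU := by
  refine ⟨(1 - tz, 2 - tz, 2 - tz), ⟨by decide, ⟨⟨tz - 2, by decide⟩, ⟨tz - 2, by decide⟩,
    ⟨tz - 2, by decide⟩⟩, ⟨2 * tz - 4, by decide⟩, ⟨6 * tz - 11, by decide⟩⟩, ?_⟩
  simp only [embv, map_sub, map_ofNat, map_one, emb_tz]

theorem exists_midpoint : ∃ z : ℍ, ∃ l : ℝ, 0 < l ∧ hv z = l • (1, 0, 1) := by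
  have hr := rt_bounds.1
  set q := √(8 + 4 * rt) with hq
  have hq0 : 0 < q := Real.sqrt_pos.2 (by linarith)
  have hqq : q * q = 8 + 4 * rt := Real.mul_self_sqrt (by linarith)
  obtain ⟨z, hz⟩ := exists_hv_eq (x := q⁻¹ • ((1, 0, 1) : ℝ × ℝ × ℝ)) (by
      rw [bil_smul_left, bil_smul_right,
        show bil rt ((1, 0, 1) : ℝ × ℝ × ℝ) (1, 0, 1) = q * q by rw [hqq]; simp [bil, vsum]; ring]
      field_simp) (by simp [vsum]; positivity)
  exact ⟨z, q⁻¹, inv_pos.2 hq0, hz⟩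

theorem sq_ge_of_strip {e : Z3 × Z3 × Z3} (he : IsPattern e) {n n₀ : ℝ × ℝ × ℝ}
    (hn : n ∈ stripNormals e) (hn₀ : n₀ ∈ stripNormals e) (hne : n ≠ n₀) {z : ℍ}
    (hz : bil rt n₀ (hv z) = 0) : 12 ≤ bil rt n (hv z) ^ 2 := by
  have h1 := strip_gap he hn hn₀ hne
  have h2 := gram_nonneg n n₀ (hv z)
  rw [bil_strip_self hn, bil_strip_self hn₀, bil_hv_self, hz] at h2
  have hr := rt_bounds.1
  have hsq := rt_sq
  have h3 : (4 + 2 * rt) ^ 2 ≤ bil rt n n₀ ^ 2 := by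
    rw [← sq_abs (bil rt n n₀)]
    exact pow_le_pow_left₀ (by linarith) h1 2
  nlinarith

/-- Centres of adjacent squares have hyperbolic cosine of distance `1 + √3`. A third line of the
family keeps a definite distance from both, because each lies on a line of the family, and the Gram
inequality then shows that it cannot separate them. -/
theorem side_eq_of_strip {e : Z3 × Z3 × Z3} (he : IsPattern e) {n n₀ n₁ : ℝ × ℝ × ℝ}
    (hn : n ∈ stripNormals e) (hn₀ : n₀ ∈ stripNormals e) (hn₁ : n₁ ∈ stripNormals e)
    (h0 : n ≠ n₀) (h1 : n ≠ n₁) {z w : ℍ} (hz : bil rt n₀ (hv z) = 0)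
    (hw : bil rt n₁ (hv w) = 0) (hzw : bil rt (hv z) (hv w) = 1 + rt) :
    side n w - side n z = 0 := by
  by_contra hcon
  have h2 := mul_nonpos_of_side_ne hcon
  have a1 := sq_ge_of_strip he hn hn₀ h0 hz
  have a2 := sq_ge_of_strip he hn hn₁ h1 hw
  have h3 := gram_hv n z w
  rw [← bil_hv, hzw, bil_strip_self hn] at h3
  have hr := rt_bounds.1
  have hr' := rt_bounds.2
  have hsq := rt_sq
  nlinarith

end

end BolzaLike

namespace BolzaLike

noncomputable section

/-! ### Crossing numbers of the side pairings -/

theorem act_mJ_coord (x y z : ℝ) : act mJ (x, y, z) = (z + rt * y, -y, x + rt * y) := act_mJ _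

theorem act_mU_coord (x y z : ℝ) : act mU (x, y, z) =
    (2 * z + rt * x, -(x + rt * z), y + rt * z + rt * x + 3 * z) := by
  have hsq := rt_sq
  rw [act_mU, act_mJ]
  ext <;> simp <;> linear_combination z * hsq

theorem act_mV_coord (x y z : ℝ) : act mV (x, y, z) =
    (-(z + rt * y), x + rt * y + rt * z + 3 * y, 2 * y + rt * z) := by
  have hsq := rt_sq
  rw [act_mV, act_mJ_coord, act_mVJ]
  ext <;> simp <;> linear_combination y * hsq

theorem side_of_pos {n : ℝ × ℝ × ℝ} {z : ℍ} (h : 0 < bil rt n (hv z)) : side n z = 1 := if_pos h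

theorem side_of_nonpos {n : ℝ × ℝ × ℝ} {z : ℍ} (h : bil rt n (hv z) ≤ 0) : side n z = 0 :=
  if_neg h.not_gt

theorem crossing_eq_single {e : Z3 × Z3 × Z3} {m : ℝ × ℝ × ℝ} (hm : m ∈ stripNormals e) {z w : ℍ}
    (h : ∀ n ∈ stripNormals e, n ≠ m → side n w - side n z = 0) :
    crossing e z w = side m w - side m z :=
  finsum_eq_single (fun n : stripNormals e => side n.1 w - side n.1 z) ⟨m, hm⟩
    fun n hn => h n n.2 fun h' => hn (Subtype.ext h')

/-- At the centre of the square only the family lines through the point and through its image can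
contribute. A point on a line counts as not on its positive side, so just one of the two lines
contributes when they differ, and none when they coincide. -/
theorem exists_base_crossing : ∃ z : ℍ,
    (crossing patV z (mU • z) = 1 ∧ crossing patV z (mV • z) = 0) ∧
    crossing patU z (mU • z) = 0 ∧ crossing patU z (mV • z) = -1 := by
  obtain ⟨z, l, hl, hz⟩ := exists_midpoint
  have hsq := rt_sq
  have hr := rt_bounds.1
  have hU : hv (mU • z) = l • (2 + rt, -(1 + rt), 3 + 2 * rt) := by
    rw [hv_smul, hz, act_smul, act_mU_coord]
    congr 1
    ext <;> simp; ring
  have hV : hv (mV • z) = l • (-1, 1 + rt, rt) := by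
    rw [hv_smul, hz, act_smul, act_mV_coord]
    congr 1
    ext <;> simp
  have hll : l * l * (8 + 4 * rt) = 1 := by
    have h := bil_hv_self z
    rw [hz, bil_smul_left, bil_smul_right] at h
    rw [← h]; simp [bil, vsum]; ring
  have hzU : bil rt (hv z) (hv (mU • z)) = 1 + rt := by
    rw [hU, hz, bil_smul_left, bil_smul_right]
    simp only [bil, vsum]
    linear_combination (1 + rt) * hll - (2 * l * l) * hsq
  have hzV : bil rt (hv z) (hv (mV • z)) = 1 + rt := by
    rw [hV, hz, bil_smul_left, bil_smul_right]
    simp only [bil, vsum]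
    linear_combination (1 + rt) * hll + (2 * l * l) * hsq
  have memU : ∀ e, IsPattern e → ∀ x ∈ stripNormals e, act mU x ∈ stripNormals e :=
    fun e he x hx => word_zero ▸ act_mem_strip he (FreeGroup.of 0) hx
  have memV : ∀ e, IsPattern e → ∀ x ∈ stripNormals e, act mV x ∈ stripNormals e :=
    fun e he x hx => word_one ▸ act_mem_strip he (FreeGroup.of 1) hx
  have hg : ∀ (g : SL(2, ℝ)) n, bil rt n (hv z) = 0 → bil rt (act g n) (hv (g • z)) = 0 :=
    fun g n h => by rw [hv_smul, bil_act, h]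
  have v0 : bil rt (2 - rt, 2 - rt, 1 - rt) (hv z) = 0 := by
    rw [hz, bil_smul_right]; simp only [bil, vsum]; linear_combination (-8 * l) * hsq
  have u0 : bil rt (1 - rt, 2 - rt, 2 - rt) (hv z) = 0 := by
    rw [hz, bil_smul_right]; simp only [bil, vsum]; linear_combination (-8 * l) * hsq
  have vU : act mU (2 - rt, 2 - rt, 1 - rt) = (-1, 1, -1 - rt) := by
    rw [act_mU_coord]; ext <;> simp <;> linarith
  have vV : act mV (2 - rt, 2 - rt, 1 - rt) = (2 - rt, 2 - rt, 1 - rt) := by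
    rw [act_mV_coord]; ext <;> simp <;> linarith
  have uU : act mU (1 - rt, 2 - rt, 2 - rt) = (1 - rt, 2 - rt, 2 - rt) := by
    rw [act_mU_coord]; ext <;> simp <;> linarith
  have uV : act mV (1 - rt, 2 - rt, 2 - rt) = (1 - rt, 1, 1) := by
    rw [act_mV_coord]; ext <;> simp <;> linarith
  refine ⟨z, ⟨?_, ?_⟩, ?_, ?_⟩
  · have h1 := memU _ isPattern_patV _ normalV_mem
    have hz' := hg mU _ v0
    have e0 : side (2 - rt, 2 - rt, 1 - rt) (mU • z) = 1 := side_of_pos (by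
      rw [hU, bil_smul_right]
      refine mul_pos hl ?_
      simp only [bil, vsum]
      nlinarith)
    have e1 : side (act mU (2 - rt, 2 - rt, 1 - rt)) z = 0 := side_of_nonpos (by
      rw [vU, hz, bil_smul_right]
      refine mul_nonpos_of_nonneg_of_nonpos hl.le ?_
      simp only [bil, vsum]
      nlinarith)
    rw [crossing_eq_single normalV_mem, e0, side_of_nonpos v0.le, sub_zero]
    intro n hn hne
    by_cases h : n = act mU (2 - rt, 2 - rt, 1 - rt)
    · rw [h, e1, side_of_nonpos hz'.le, sub_zero]
    · exact side_eq_of_strip isPattern_patV hn normalV_mem h1 hne h v0 hz' hzU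
  · have hz' := hg mV _ v0
    rw [vV] at hz'
    rw [crossing_eq_single normalV_mem, side_of_nonpos hz'.le, side_of_nonpos v0.le, sub_zero]
    exact fun n hn hne =>
      side_eq_of_strip isPattern_patV hn normalV_mem normalV_mem hne hne v0 hz' hzV
  · have hz' := hg mU _ u0
    rw [uU] at hz'
    rw [crossing_eq_single normalU_mem, side_of_nonpos hz'.le, side_of_nonpos u0.le, sub_zero]
    exact fun n hn hne =>
      side_eq_of_strip isPattern_patU hn normalU_mem normalU_mem hne hne u0 hz' hzU
  · have h1 := memV _ isPattern_patU _ normalU_mem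
    have hz' := hg mV _ u0
    have e0 : side (1 - rt, 2 - rt, 2 - rt) (mV • z) = 0 := side_of_nonpos (by
      rw [hV, bil_smul_right]
      refine mul_nonpos_of_nonneg_of_nonpos hl.le ?_
      simp only [bil, vsum]
      nlinarith)
    have e1 : side (act mV (1 - rt, 2 - rt, 2 - rt)) z = 1 := side_of_pos (by
      rw [uV, hz, bil_smul_right]
      refine mul_pos hl ?_
      simp only [bil, vsum]
      nlinarith)
    rw [crossing_eq_single h1, side_of_nonpos hz'.le, e1]
    · norm_num
    intro n hn hne
    by_cases h : n = (1 - rt, 2 - rt, 2 - rt)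
    · rw [h, e0, side_of_nonpos u0.le, sub_zero]
    · exact side_eq_of_strip isPattern_patU hn normalU_mem h1 h hne u0 hz' hzV

theorem crossing_patV (w : FreeGroup (Fin 2)) (z : ℍ) :
    crossing patV z (word w • z) = (intExp w).1.toAdd := by
  obtain ⟨z₀, ⟨h1, h2⟩, -⟩ := exists_base_crossing
  rw [crossing_word isPattern_patV h1 h2]; ring

theorem crossing_patU (w : FreeGroup (Fin 2)) (z : ℍ) :
    crossing patU z (word w • z) = -(intExp w).2.toAdd := by
  obtain ⟨z₀, -, h1, h2⟩ := exists_base_crossing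
  rw [crossing_word isPattern_patU h1 h2]; ring

/-- Crossing numbers of a trivial motion vanish, and those of the square are, up to sign, twice the
exponent sums. -/
theorem intExp_eq_one_of_sq (w : FreeGroup (Fin 2)) (h : ∀ z : ℍ, (word w * word w) • z = z) :
    intExp w = 1 := by
  have h1 := crossing_patV (w * w) UpperHalfPlane.I
  have h2 := crossing_patU (w * w) UpperHalfPlane.I
  rw [map_mul, h, crossing_self, map_mul] at h1 h2
  simp only [Prod.fst_mul, Prod.snd_mul, toAdd_mul] at h1 h2
  refine Prod.ext (Multiplicative.toAdd.injective ?_) (Multiplicative.toAdd.injective ?_)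
  · change _ = (0 : ℤ); omega
  · change _ = (0 : ℤ); omega

end

end BolzaLike

namespace BolzaLike

noncomputable section

/-! ### Closed geodesics crossing many strips are long -/

/-- Two Gram inequalities: one for both lines and the second point, one for the first line and both
points. -/
theorem strip_dist {e : Z3 × Z3 × Z3} (he : IsPattern e) {n n' : ℝ × ℝ × ℝ}
    (hn : n ∈ stripNormals e) (hn' : n' ∈ stripNormals e) (hne : n ≠ n') {z z' : ℍ}
    (hz : bil rt n (hv z) = 0) (hz' : bil rt n' (hv z') = 0) :
    4 + 2 * rt ≤ 2 * rt * Real.cosh (dist z z') := by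
  have hr := rt_bounds.1
  have h1 := strip_gap he hn hn' hne
  have h2 := gram_nonneg n n' (hv z')
  have h3 := gram_nonneg n (hv z) (hv z')
  rw [bil_strip_self hn, bil_strip_self hn', bil_hv_self, hz'] at h2
  rw [bil_strip_self hn, bil_hv_self, bil_hv_self, hz, bil_hv] at h3
  refine h1.trans (abs_le_of_sq_le_sq ?_ (by positivity))
  nlinarith

theorem exists_zero_of_side_ne {c : ℝ → ℍ} (hc : Isometry c) {n : ℝ × ℝ × ℝ} {a b : ℝ}
    (hab : a ≤ b) (h : side n (c b) - side n (c a) ≠ 0) :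
    ∃ t ∈ Set.Icc a b, bil rt n (hv (c t)) = 0 := by
  obtain ⟨v, -, hv'⟩ := exists_frame_of_isometry hc
  have hcont : Continuous fun t => bil rt n (hv (c t)) := by
    rw [funext fun t => (congrArg (bil rt n) (hv' t)).trans (bil_hyp n _ v t)]
    exact (Real.continuous_cosh.mul continuous_const).add
      (Real.continuous_sinh.mul continuous_const)
  have hmul := mul_nonpos_of_side_ne h
  rcases mul_nonpos_iff.1 hmul with ⟨h1, h2⟩ | ⟨h1, h2⟩
  · exact intermediate_value_Icc' hab hcont.continuousOn ⟨h2, h1⟩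
  · exact intermediate_value_Icc hab hcont.continuousOn ⟨h1, h2⟩

theorem abs_crossing_le (e : Z3 × Z3 × Z3) (z w : ℍ) :
    |crossing e z w| ≤ ((finite_side_ne e z w).toFinset.card : ℤ) := by
  rw [crossing, finsum_eq_sum _ (finite_side_ne e z w)]
  refine (Finset.abs_sum_le_sum_abs _ _).trans ?_
  refine (Finset.sum_le_card_nsmul _ _ 1 fun n _ => ?_).trans (by simp)
  unfold side
  split_ifs <;> simp

theorem crossing_mul_le {c : ℝ → ℍ} (hc : Isometry c) {e : Z3 × Z3 × Z3} (he : IsPattern e)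
    {d b : ℝ} (hd : 0 < d) (hdr : 2 * rt * Real.cosh d ≤ 4 + 2 * rt) (hb : 0 ≤ b) :
    (|crossing e (c 0) (c b)| : ℝ) ≤ b / d + 1 := by
  have hr := rt_bounds.1
  set F := (finite_side_ne e (c 0) (c b)).toFinset
  have hF : ∀ n ∈ F, side n.1 (c b) - side n.1 (c 0) ≠ 0 := fun n hn => by
    simpa [F] using hn
  have hz : ∀ n : stripNormals e, ∃ t : ℝ, n ∈ F → t ∈ Set.Icc 0 b ∧
      bil rt n.1 (hv (c t)) = 0 := fun n => by
    by_cases h : n ∈ F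
    · obtain ⟨t, h1, h2⟩ := exists_zero_of_side_ne hc hb (hF n h)
      exact ⟨t, fun _ => ⟨h1, h2⟩⟩
    · exact ⟨0, fun h' => absurd h' h⟩
  choose t ht using hz
  -- Choose a crossing time for every counted line. Times for different lines differ by at least
  -- `d`, so they fall into different intervals of length `d`.
  have hcard : F.card ≤ (Finset.range (⌊b / d⌋₊ + 1)).card := by
    refine Finset.card_le_card_of_injOn (fun n => ⌊t n / d⌋₊) (fun n hn => ?_) ?_
    · have h := (ht n hn).1
      simp only [Finset.coe_range, Set.mem_Iio, Order.lt_add_one_iff]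
      exact Nat.floor_le_floor (div_le_div_of_nonneg_right h.2 hd.le)
    · intro n hn m hm hnm
      by_contra hne
      obtain ⟨hn1, hn2⟩ := ht n hn
      obtain ⟨hm1, hm2⟩ := ht m hm
      have h1 := strip_dist he n.2 m.2 (fun h => hne (Subtype.ext h)) hn2 hm2
      have h2 : Real.cosh d ≤ Real.cosh (dist (c (t n)) (c (t m))) := by
        nlinarith
      rw [Real.cosh_le_cosh, abs_of_pos hd, hc.dist_eq, Real.dist_eq, abs_abs] at h2
      simp only at hnm
      have a1 := Nat.floor_le (div_nonneg hn1.1 hd.le)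
      have a2 := Nat.lt_floor_add_one (t n / d)
      have a3 := Nat.floor_le (div_nonneg hm1.1 hd.le)
      have a4 := Nat.lt_floor_add_one (t m / d)
      rw [hnm] at a1 a2
      have h3 : |t n / d - t m / d| < 1 := by rw [abs_lt]; constructor <;> linarith
      rw [← sub_div, abs_div, abs_of_pos hd, div_lt_one hd] at h3
      linarith
  rw [Finset.card_range] at hcard
  have h1 := abs_crossing_le e (c 0) (c b)
  have h2 : |crossing e (c 0) (c b)| ≤ ((⌊b / d⌋₊ + 1 : ℕ) : ℤ) :=
    h1.trans (by exact_mod_cast hcard)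
  have h3 : (|crossing e (c 0) (c b)| : ℝ) ≤ ((⌊b / d⌋₊ + 1 : ℕ) : ℝ) := by exact_mod_cast h2
  refine h3.trans ?_
  push_cast
  have := Nat.floor_le (div_nonneg hb hd.le)
  linarith

theorem pow_smul_eq {G : Type*} [Group G] [MulAction G ℍ] {c : ℝ → ℍ} {L : ℝ} {g : G}
    (hg : ∀ t, g • c t = c (t + L)) (M : ℕ) (t : ℝ) : g ^ M • c t = c (t + M * L) := by
  induction M with
  | zero => simp
  | succ M ih => rw [pow_succ', mul_smul, ih, hg]; push_cast; ring_nf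

theorem long_of_crossing {c : ℝ → ℍ} (hc : Isometry c) {L : ℝ} (hL : 0 < L)
    {w : FreeGroup (Fin 2)} (hg : ∀ t, word w • c t = c (t + L)) {e : Z3 × Z3 × Z3}
    (he : IsPattern e) {k : ℤ}
    (hk : ∀ M : ℕ, crossing e (c 0) (word (w ^ M) • c 0) = M * k) (h4 : 4 ≤ |k|) :
    3 + 2 * rt < Real.cosh (L / 2) := by
  have hr := rt_bounds.1
  have hr' := rt_bounds.2
  have hsq := rt_sq
  have hD : 1 < (4 + 2 * rt) / (2 * rt) := by rw [lt_div_iff₀ (by linarith)]; linarith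
  set d := Real.arcosh ((4 + 2 * rt) / (2 * rt)) with hd
  have hcd : Real.cosh d = (4 + 2 * rt) / (2 * rt) := Real.cosh_arcosh hD.le
  have hcd' : 2 * rt * Real.cosh d = 4 + 2 * rt := by
    rw [hcd]; field_simp
  have hd0 : 0 < d := Real.arcosh_pos hD
  have h4d : 4 * d ≤ L := by
    by_contra! hlt
    -- Passing to a high power `M` makes the error `1` in `crossing_mul_le` negligible and yields `4
    -- d ≤ L`.
    obtain ⟨M, hM⟩ := exists_nat_gt (1 / (4 - L / d))
    have hpos : 0 < 4 - L / d := by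
      rw [sub_pos, div_lt_iff₀ hd0]; exact hlt
    rw [div_lt_iff₀ hpos] at hM
    have h1 := crossing_mul_le hc he hd0 hcd'.le (b := M * L) (by positivity)
    have h2 := hk M
    rw [map_pow, pow_smul_eq hg, zero_add] at h2
    rw [h2] at h1
    have h5 : (4 : ℝ) ≤ |(k : ℝ)| := by exact_mod_cast h4
    push_cast at h1
    rw [abs_mul, Nat.abs_cast, mul_div_assoc] at h1
    have h6 : (M : ℝ) * 4 ≤ M * |(k : ℝ)| := mul_le_mul_of_nonneg_left h5 (Nat.cast_nonneg M)
    linarith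
  have h1 : Real.cosh (2 * d) ≤ Real.cosh (L / 2) := by
    rw [Real.cosh_le_cosh, abs_of_pos (by linarith), abs_of_pos (by linarith)]
    linarith
  refine lt_of_lt_of_le ?_ h1
  rw [Real.cosh_two_mul, Real.sinh_sq]
  have h2 : 2.15 < Real.cosh d := by nlinarith
  nlinarith

-- The strips of pattern `patV` detect the first exponent sum, those of pattern `patU` the second.
theorem long_of_intExp {c : ℝ → ℍ} (hc : Isometry c) {L : ℝ} (hL : 0 < L)
    {w : FreeGroup (Fin 2)} (hg : ∀ t, word w • c t = c (t + L))
    (h4 : 4 ≤ |(intExp w).1.toAdd| ∨ 4 ≤ |(intExp w).2.toAdd|) :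
    3 + 2 * rt < Real.cosh (L / 2) := by
  rcases h4 with h4 | h4
  · refine long_of_crossing hc hL hg isPattern_patV (fun M => ?_) h4
    rw [crossing_patV, map_pow, Prod.pow_fst, toAdd_pow, nsmul_eq_mul]
  · refine long_of_crossing hc hL hg isPattern_patU (k := -(intExp w).2.toAdd) (fun M => ?_)
      (by rwa [abs_neg])
    rw [crossing_patU, map_pow, Prod.pow_snd, toAdd_pow, nsmul_eq_mul]
    ring

/-- The size of the grid enters here: the exponent sums are divisible by `2 * k` and `n`, both at
least `4`. -/
theorem intExp_cases {k n : ℕ} (hk : 2 ≤ k) (hn : 4 ≤ n) {w : FreeGroup (Fin 2)}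
    (hw : exponentSums (2 * k) n w = 1) :
    intExp w = 1 ∨ 4 ≤ |(intExp w).1.toAdd| ∨ 4 ≤ |(intExp w).2.toAdd| := by
  have h := exponentSums_eq (2 * k) n w
  rw [hw] at h
  have h' := congrArg Multiplicative.toAdd h
  rw [toAdd_one, toAdd_ofAdd, eq_comm, Prod.mk_eq_zero, ZMod.intCast_zmod_eq_zero_iff_dvd,
    ZMod.intCast_zmod_eq_zero_iff_dvd] at h'
  by_cases h1 : (intExp w).1.toAdd = 0
  · by_cases h2 : (intExp w).2.toAdd = 0
    · exact Or.inl (Prod.ext (Multiplicative.toAdd.injective h1)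
        (Multiplicative.toAdd.injective h2))
    · refine Or.inr (Or.inr (le_trans ?_ (Int.le_of_dvd (abs_pos.2 h2) ((dvd_abs _ _).2 h'.2))))
      exact_mod_cast hn
  · refine Or.inr (Or.inl (le_trans ?_ (Int.le_of_dvd (abs_pos.2 h1) ((dvd_abs _ _).2 h'.1))))
    exact_mod_cast (show 4 ≤ 2 * k by omega)

end

end BolzaLike

namespace BolzaLike

noncomputable section

/-! ### The systole and the systolic geodesics -/

variable {k n : ℕ} {Γ : Subgroup SL(2, ℝ)}

theorem IsSurfaceGroup.countable (hΓ : IsSurfaceGroup eqAngle k n Γ) : Countable Γ := by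
  have : Countable (FreeGroup (Fin 2)) := inferInstanceAs (Countable (Quot _))
  have h : (Γ : Set SL(2, ℝ)) ⊆ Set.range word := fun g hg => by
    obtain ⟨w, -, rfl⟩ := hΓ.le hg
    exact ⟨w, rfl⟩
  exact ((Set.countable_range word).mono h).to_subtype

theorem IsFrame.eq_smul_cross {p v m : ℝ × ℝ × ℝ} (h : IsFrame p v) (hp : bil rt m p = 0)
    (hv : bil rt m v = 0) : m = (-bil rt m (vcross rt p v)) • vcross rt p v := by
  set C := vcross rt p v with hC
  have c1 : bil rt C p = 0 := bil_vcross_left _ _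
  have c2 : bil rt C v = 0 := bil_vcross_right _ _
  have h1 := gram_nonneg v m C
  rw [h.vv, h.bil_cross, bil_comm _ v m, bil_comm _ v C, hv, c2] at h1
  have h2 : m + (bil rt m C) • C = 0 := by
    refine eq_zero_of_orthogonal (x := p) (by rw [h.pp]; exact one_pos) ?_ ?_
    · rw [bil_add_right, bil_smul_right, bil_comm _ p m, hp, bil_comm _ p C, c1]; ring
    · rw [bil_add_left, bil_add_right, bil_add_right, bil_smul_left, bil_smul_left,
        bil_smul_right, bil_smul_right, h.bil_cross, bil_comm _ C m]
      linarith
  rw [neg_smul]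
  exact eq_neg_of_add_eq_zero_left h2

/-- The length of the systolic geodesics. -/
def sysLen : ℝ := 2 * Real.arcosh (3 + 2 * rt)

theorem cosh_sysLen : Real.cosh (sysLen / 2) = 3 + 2 * rt := by
  have hr := rt_bounds.1
  rw [sysLen, mul_div_cancel_left₀ _ two_ne_zero, Real.cosh_arcosh (by linarith)]

theorem sysLen_pos : 0 < sysLen := by
  have hr := rt_bounds.1
  exact mul_pos two_pos (Real.arcosh_pos (by linarith))

theorem bil_eq_zero_of_line {p v m : ℝ × ℝ × ℝ} (h : ∀ t, bil rt m (hyp p v t) = 0) :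
    bil rt m p = 0 ∧ bil rt m v = 0 := by
  have h0 := h 0
  have h1 := h 1
  rw [hyp_eq_zero_smul] at h0
  rw [bil_hyp, h0, mul_zero, zero_add] at h1
  exact ⟨h0, (mul_eq_zero.1 h1).resolve_left (Real.sinh_pos_iff.2 one_pos).ne'⟩

theorem smul_eq_of_coe_eq_transl {c : ℝ → ℍ} {v : ℝ × ℝ × ℝ} (h : IsFrame (hv (c 0)) v)
    (hc : ∀ t, hv (c t) = hyp (hv (c 0)) v t) {g : SL(2, ℝ)} {L : ℝ}
    (hg : (g : Matrix (Fin 2) (Fin 2) ℝ) =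
      Real.cosh (L / 2) • 1 + vmat (Real.sinh (L / 2) • vcross rt (hv (c 0)) v)) (t : ℝ) :
    g • c t = c (t + L) := by
  have hgt : g = transl h L := Subtype.ext (by rw [hg, transl, slMk_coe])
  apply hv_injective
  rw [hv_smul, hc, hc (t + L), hgt, act_transl]

theorem IsSurfaceGroup.isClosedGeodesic_line (hΓ : IsSurfaceGroup eqAngle k n Γ)
    {m : ℝ × ℝ × ℝ} (hm : m ∈ lineNormals) {c : ℝ → ℍ} (hc : Isometry c)
    (h : ∀ t, bil rt m (hv (c t)) = 0) :
    IsClosedGeodesic Γ (fun t => proj Γ (c t)) sysLen := by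
  refine ⟨sysLen_pos, ⟨c, hc, fun _ => rfl⟩, ?_⟩
  obtain ⟨v, hf, hcv⟩ := exists_frame_of_isometry hc
  obtain ⟨g, hg, hgm⟩ := hΓ.exists_of_lineNormals hm (h 0)
  have hmt : ∀ t, bil rt m (hyp (hv (c 0)) v t) = 0 := fun t => by rw [← hcv]; exact h t
  obtain ⟨hmp, hmv⟩ := bil_eq_zero_of_line hmt
  have hmC := hf.eq_smul_cross hmp hmv
  set u := -bil rt m (vcross rt (hv (c 0)) v)
  have hu : u ^ 2 = Real.sinh (sysLen / 2) ^ 2 := by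
    have h1 := bil_lineNormals hm
    rw [hmC, bil_smul_left, bil_smul_right, hf.bil_cross] at h1
    rw [Real.sinh_sq, cosh_sysLen]
    linear_combination -h1 - 4 * rt_sq
  have hper : ∀ L, Real.cosh (L / 2) = 3 + 2 * rt → Real.sinh (L / 2) = u →
      Function.Periodic (fun t => proj Γ (c t)) L := fun L h1 h2 t => by
    refine proj_eq_iff.2 ⟨g, hg, smul_eq_of_coe_eq_transl hf hcv ?_ t⟩
    rw [hgm, h1, h2, ← hmC]
  -- The element of `Γ` may translate backwards along `c`, in which case the period appears with the
  -- opposite sign.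
  rcases sq_eq_sq_iff_eq_or_eq_neg.1 hu with h1 | h1
  · exact hper _ cosh_sysLen h1.symm
  · have h2 := hper (-sysLen) (by rw [neg_div, Real.cosh_neg, cosh_sysLen])
      (by rw [neg_div, Real.sinh_neg, h1])
    exact neg_neg sysLen ▸ h2.neg

/-- A lift of a closed geodesic together with the deck transformation along it. -/
structure IsLift (Γ : Subgroup SL(2, ℝ)) (γ : ℝ → Surface Γ) (L : ℝ) (c : ℝ → ℍ)
    (g : SL(2, ℝ)) : Prop where
  isom : Isometry c
  eq : ∀ t, γ t = proj Γ (c t)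
  mem : g ∈ Γ
  smul : ∀ t, g • c t = c (t + L)

theorem IsSurfaceGroup.exists_isLift (hΓ : IsSurfaceGroup eqAngle k n Γ) {γ : ℝ → Surface Γ}
    {L : ℝ} {c : ℝ → ℍ} (hc : Isometry c) (h : ∀ t, γ t = proj Γ (c t))
    (hper : Function.Periodic γ L) : ∃ g, IsLift Γ γ L c g := by
  have := hΓ.countable
  obtain ⟨g, hg, hgc⟩ := exists_deck_of_periodic hc (L := L) (Γ := Γ) fun t => by
    rw [← h, ← h, hper]
  exact ⟨g, hc, h, hg, hgc⟩

theorem IsSurfaceGroup.exists_lift (hΓ : IsSurfaceGroup eqAngle k n Γ) {γ : ℝ → Surface Γ}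
    {L : ℝ} (hγ : IsClosedGeodesic Γ γ L) : ∃ c g, IsLift Γ γ L c g := by
  obtain ⟨c, hc, h⟩ := hγ.lift
  exact ⟨c, hΓ.exists_isLift hc h hγ.periodic⟩

theorem IsLift.exists_normal {γ : ℝ → Surface Γ} {L : ℝ} {c : ℝ → ℍ} {g : SL(2, ℝ)}
    (h : IsLift Γ γ L c g) (hL : 0 < L) : ∃ (a : ℝ) (x : ℝ × ℝ × ℝ),
      (g : Matrix (Fin 2) (Fin 2) ℝ) = a • 1 + vmat x ∧ |a| = Real.cosh (L / 2) ∧ x ≠ 0 ∧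
      ∀ t, bil rt x (hv (c t)) = 0 := by
  obtain ⟨v, hf, hcv⟩ := exists_frame_of_isometry h.isom
  have hs : Real.sinh (L / 2) ≠ 0 := (Real.sinh_pos_iff.2 (by linarith)).ne'
  have hC : vcross rt (hv (c 0)) v ≠ 0 := fun h0 => by
    have h1 := hf.bil_cross
    rw [h0] at h1
    simp [bil, vsum] at h1
  have hCt : ∀ t, bil rt (vcross rt (hv (c 0)) v) (hv (c t)) = 0 := fun t => by
    rw [hcv t, bil_hyp, bil_vcross_left, bil_vcross_right]; ring
  have hg := hf.eq_transl_of_act (g := g) (L := L) fun t => by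
    rw [← hcv, ← hv_smul, h.smul, hcv]
  rcases hg with hg | hg
  · refine ⟨Real.cosh (L / 2), Real.sinh (L / 2) • vcross rt (hv (c 0)) v, ?_,
      abs_of_pos (Real.cosh_pos _), smul_ne_zero hs hC, fun t => ?_⟩
    · rw [hg, transl, slMk_coe]
    · rw [bil_smul_left, hCt, mul_zero]
  · refine ⟨-Real.cosh (L / 2), (-Real.sinh (L / 2)) • vcross rt (hv (c 0)) v, ?_,
      by rw [abs_neg, abs_of_pos (Real.cosh_pos _)], smul_ne_zero (neg_ne_zero.2 hs) hC,
      fun t => ?_⟩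
    · rw [hg, Matrix.SpecialLinearGroup.coe_neg, transl, slMk_coe, neg_add, neg_smul, neg_smul,
        vmat_neg]
    · rw [bil_smul_left, hCt, mul_zero]

theorem IsSurfaceGroup.mem_cases (hk : 2 ≤ k) (hn : 4 ≤ n)
    (hΓ : IsSurfaceGroup eqAngle (2 * k) n Γ) {g : SL(2, ℝ)} (hg : g ∈ Γ) :
    ∃ w, word w = g ∧
      (intExp w = 1 ∨ 4 ≤ |(intExp w).1.toAdd| ∨ 4 ≤ |(intExp w).2.toAdd|) := by
  obtain ⟨w, hw, rfl⟩ := hΓ.le hg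
  exact ⟨w, rfl, intExp_cases hk hn hw⟩

/-- The deck transformation has scalar part `±cosh (L/2)`. Parity and the conjugate bound treat zero
exponent sums, strips treat the rest. This gives both the systole and the shape of the geodesics
attaining it. -/
theorem IsLift.length_cases (hk : 2 ≤ k) (hn : 4 ≤ n) (hΓ : IsSurfaceGroup eqAngle (2 * k) n Γ)
    {γ : ℝ → Surface Γ} {L : ℝ} {c : ℝ → ℍ} {g : SL(2, ℝ)} (h : IsLift Γ γ L c g)
    (hL : 0 < L) : 3 + 2 * rt < Real.cosh (L / 2) ∨ Real.cosh (L / 2) = 3 + 2 * rt ∧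
      ∃ m ∈ lineNormals, ∀ t, bil rt m (hv (c t)) = 0 := by
  obtain ⟨a, x, hgx, ha, hx, hxt⟩ := h.exists_normal hL
  obtain ⟨w, hw, h1 | h4⟩ := hΓ.mem_cases hk hn h.mem
  · rcases hΓ.scalar_cases (hw ▸ ⟨w, h1, rfl⟩ : g ∈ commGroup) h.mem hgx with h2 | ⟨h2, h3⟩ | h2
    · exact absurd h2 hx
    · exact Or.inr ⟨ha ▸ h2, x, h3, hxt⟩
    · exact Or.inl (ha ▸ h2)
  · exact Or.inl (long_of_intExp h.isom hL (hw ▸ h.smul) h4)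

theorem exists_line_param {m : ℝ × ℝ × ℝ} (hm : m ∈ lineNormals) {z : ℍ}
    (hz : bil rt m (hv z) = 0) :
    ∃ c : ℝ → ℍ, Isometry c ∧ c 0 = z ∧ ∀ t, bil rt m (hv (c t)) = 0 := by
  obtain ⟨v, hf, hmv⟩ := exists_frame_of_orthogonal (bil_lineNormals_neg hm) hz
  obtain ⟨c, hc, hcv⟩ := exists_isometry_of_frame hf
  refine ⟨c, hc, hv_injective (by rw [hcv, hyp_eq_zero_smul]), fun t => ?_⟩
  rw [hcv, bil_hyp, hz, hmv]; ring

/-- The points of `ℍ` on the line with normal vector `m`. -/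
def line (m : ℝ × ℝ × ℝ) : Set ℍ := {z | bil rt m (hv z) = 0}

theorem range_eq_line {m : ℝ × ℝ × ℝ} (hm : m ∈ lineNormals) {c : ℝ → ℍ} (hc : Isometry c)
    (h : ∀ t, bil rt m (hv (c t)) = 0) : Set.range c = line m := by
  refine Set.Subset.antisymm (Set.range_subset_iff.2 h) fun z hz => ?_
  obtain ⟨v, hf, hcv⟩ := exists_frame_of_isometry hc
  obtain ⟨hmp, hmv⟩ := bil_eq_zero_of_line (p := hv (c 0)) (v := v) (m := m)
    fun t => by rw [← hcv]; exact h t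
  obtain ⟨t, ht⟩ := exists_mem_hyp hf (bil_lineNormals_neg hm) hmp hmv hz (bil_hv_self z)
    (bil_hv_pos _ _)
  exact ⟨t, hv_injective (by rw [ht, hcv])⟩

theorem edge_mem_lineNormals : (-rt, 2, -rt) ∈ lineNormals := by
  refine ⟨(-tz, 2, -tz), ⟨by decide, 1 - tz, by decide⟩, ?_⟩
  simp only [embv, map_neg, map_ofNat, emb_tz]

theorem systole_eq (hk : 2 ≤ k) (hn : 4 ≤ n) (hΓ : IsSurfaceGroup eqAngle (2 * k) n Γ) :
    systole Γ = sysLen := by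
  refine IsLeast.csInf_eq ⟨?_, ?_⟩
  · have h : bil rt (-rt, 2, -rt) (hv (vertexA eqAngle)) = 0 := by
      rw [hv_vertexA]; simp [bil, vsum]; linear_combination (-2) * rt_sq
    obtain ⟨c, hc, -, hcm⟩ := exists_line_param edge_mem_lineNormals h
    exact ⟨_, hΓ.isClosedGeodesic_line edge_mem_lineNormals hc hcm⟩
  · rintro L ⟨γ, hγ⟩
    obtain ⟨c, g, h⟩ := hΓ.exists_lift hγ
    have h1 : Real.cosh (sysLen / 2) ≤ Real.cosh (L / 2) := by
      rw [cosh_sysLen]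
      rcases h.length_cases hk hn hΓ hγ.pos with h2 | ⟨h2, -⟩
      · exact h2.le
      · exact h2.ge
    have hs := sysLen_pos
    have hL := hγ.pos
    rw [Real.cosh_le_cosh, abs_of_pos (by linarith), abs_of_pos (by linarith)] at h1
    linarith

theorem isSystolicGeodesic_line (hk : 2 ≤ k) (hn : 4 ≤ n)
    (hΓ : IsSurfaceGroup eqAngle (2 * k) n Γ) {m : ℝ × ℝ × ℝ} (hm : m ∈ lineNormals)
    {c : ℝ → ℍ} (hc : Isometry c) (h : ∀ t, bil rt m (hv (c t)) = 0) :
    IsSystolicGeodesic Γ (fun t => proj Γ (c t)) := by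
  rw [IsSystolicGeodesic, systole_eq hk hn hΓ]
  exact hΓ.isClosedGeodesic_line hm hc h

theorem IsSystolicGeodesic.exists_line (hk : 2 ≤ k) (hn : 4 ≤ n)
    (hΓ : IsSurfaceGroup eqAngle (2 * k) n Γ) {α : ℝ → Surface Γ}
    (h : IsSystolicGeodesic Γ α) : ∃ m ∈ lineNormals, Set.range α = proj Γ '' line m := by
  rw [IsSystolicGeodesic, systole_eq hk hn hΓ] at h
  obtain ⟨c, g, hc⟩ := hΓ.exists_lift h
  rcases hc.length_cases hk hn hΓ h.pos with h1 | ⟨-, m, hm, hmt⟩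
  · exact absurd cosh_sysLen h1.ne'
  · refine ⟨m, hm, ?_⟩
    rw [← range_eq_line hm hc.isom hmt, ← Set.range_comp]
    exact congrArg Set.range (funext hc.eq)

theorem IsSurfaceGroup.image_line_act {m : ℝ × ℝ × ℝ} {g : SL(2, ℝ)} (hg : g ∈ Γ) :
    proj Γ '' line (act g m) = proj Γ '' line m := by
  have key : ∀ (g : SL(2, ℝ)) (m : ℝ × ℝ × ℝ), g ∈ Γ →
      proj Γ '' line m ⊆ proj Γ '' line (act g m) := by
    rintro g m hg _ ⟨z, hz, rfl⟩
    refine ⟨g • z, ?_, proj_eq_iff.2 ⟨g, hg, rfl⟩⟩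
    rw [line, Set.mem_ofPred_eq, hv_smul, bil_act]
    exact hz
  refine Set.Subset.antisymm ?_ (key g m hg)
  have h := key g⁻¹ (act g m) (inv_mem hg)
  rwa [act_inv_act] at h

/-- The predicate `P` on images lets one statement cover both the union of all systolic geodesics
and the union of those different from `γ`. -/
theorem mem_systolicUnion (hk : 2 ≤ k) (hn : 4 ≤ n) (hΓ : IsSurfaceGroup eqAngle (2 * k) n Γ)
    (P : Set (Surface Γ) → Prop) (z : ℍ) :
    (∃ α, IsSystolicGeodesic Γ α ∧ P (Set.range α) ∧ proj Γ z ∈ Set.range α) ↔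
      ∃ m ∈ lineNormals, P (proj Γ '' line m) ∧ z ∈ line m := by
  constructor
  · rintro ⟨α, hα, hP, hz⟩
    obtain ⟨m, hm, hr⟩ := hα.exists_line hk hn hΓ
    rw [hr] at hz hP
    obtain ⟨w, hw, hwz⟩ := hz
    obtain ⟨g, hg, rfl⟩ := proj_eq_iff.1 hwz.symm
    refine ⟨act g m, act_mem_lineNormals (hΓ.le_grid hg) hm, ?_, ?_⟩
    · rwa [IsSurfaceGroup.image_line_act hg]
    · rw [line, Set.mem_ofPred_eq, hv_smul, bil_act]
      exact hw
  · rintro ⟨m, hm, hP, hz⟩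
    obtain ⟨c, hc, hc0, hcm⟩ := exists_line_param hm hz
    have hr : Set.range (fun t => proj Γ (c t)) = proj Γ '' line m := by
      rw [← range_eq_line hm hc hcm, ← Set.range_comp]; rfl
    exact ⟨_, isSystolicGeodesic_line hk hn hΓ hm hc hcm, hr ▸ hP, 0, by simp [hc0]⟩

end

end BolzaLike

namespace BolzaLike

noncomputable section

/-! ### The parity of the number of lines separating two points -/

/-- The edge lines separating two points, each with the normal vector towards the first one. -/
def sep (z w : ℍ) : Set (ℝ × ℝ × ℝ) :=
  {m | m ∈ lineNormals ∧ 0 < bil rt m (hv z) ∧ bil rt m (hv w) < 0}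

theorem finite_lineNormals_separating (z w : ℍ) :
    {m | m ∈ lineNormals ∧ bil rt m (hv z) * bil rt m (hv w) ≤ 0}.Finite := by
  refine ((finite_separating ⟨-20, -12⟩ z w).image embv).subset ?_
  rintro _ ⟨⟨n, hn, rfl⟩, h⟩
  exact ⟨n, ⟨hn.1, h⟩, rfl⟩

theorem finite_sep (z w : ℍ) : (sep z w).Finite :=
  (finite_lineNormals_separating z w).subset fun _ hm =>
    ⟨hm.1, (mul_neg_of_pos_of_neg hm.2.1 hm.2.2).le⟩

/-- The point lies on no edge line. -/
def OffLines (z : ℍ) : Prop := ∀ m ∈ lineNormals, bil rt m (hv z) ≠ 0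

theorem ncard_sep_comm (z w : ℍ) : (sep z w).ncard = (sep w z).ncard := by
  have key : ∀ z w, (sep z w).ncard ≤ (sep w z).ncard := fun z w =>
    Set.ncard_le_ncard_of_injOn Neg.neg (fun m hm => ⟨neg_mem_lineNormals hm.1,
      by rw [bil_neg_left]; linarith [hm.2.2], by rw [bil_neg_left]; linarith [hm.2.1]⟩)
      neg_injective.injOn (finite_sep w z)
  exact (key z w).antisymm (key w z)

/-- A line avoiding the corners of a triangle crosses either none or two of its sides. -/
theorem ncard_sep_add {x y z : ℍ} (hx : OffLines x) (hy : OffLines y) (hz : OffLines z) :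
    Even ((sep x y).ncard + (sep y z).ncard + (sep x z).ncard) := by
  have split : ∀ a b c : ℍ, OffLines c → (sep a b).ncard =
      (sep a b ∩ {m | 0 < bil rt m (hv c)}).ncard +
        (sep a b ∩ {m | bil rt m (hv c) < 0}).ncard := by
    intro a b c hc
    rw [← Set.ncard_union_eq _ ((finite_sep a b).inter_of_left _)
      ((finite_sep a b).inter_of_left _), ← Set.inter_union_distrib_left]
    · congr 1
      refine (Set.inter_eq_left.2 fun m hm => ?_).symm
      exact (hc m hm.1).lt_or_gt.symm
    · exact Set.disjoint_left.2 fun m h1 h2 =>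
        lt_asymm (show 0 < bil rt m (hv c) from h1.2) (show bil rt m (hv c) < 0 from h2.2)
  have e1 : sep x z ∩ {m | 0 < bil rt m (hv y)} = sep y z ∩ {m | 0 < bil rt m (hv x)} := by
    ext m; simp only [sep, Set.mem_inter_iff, Set.mem_ofPred_eq]; tauto
  have e2 : sep x z ∩ {m | bil rt m (hv y) < 0} = sep x y ∩ {m | bil rt m (hv z) < 0} := by
    ext m; simp only [sep, Set.mem_inter_iff, Set.mem_ofPred_eq]; tauto
  have e3 : (sep x y ∩ {m | 0 < bil rt m (hv z)}).ncard =
      (sep y z ∩ {m | bil rt m (hv x) < 0}).ncard := by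
    rw [← Set.ncard_image_of_injective _ (neg_injective (G := ℝ × ℝ × ℝ))]
    congr 1
    ext m
    simp only [Set.image_neg_eq_neg, Set.mem_neg, sep, Set.mem_inter_iff, Set.mem_ofPred_eq,
      bil_neg_left, Left.neg_pos_iff, Left.neg_neg_iff]
    have : -m ∈ lineNormals ↔ m ∈ lineNormals :=
      ⟨fun h => neg_neg m ▸ neg_mem_lineNormals h, neg_mem_lineNormals⟩
    tauto
  rw [split x y z hz, split y z x hx, split x z y hy, e1, e2, e3]
  exact ⟨(sep y z ∩ {m | bil rt m (hv x) < 0}).ncard +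
    (sep x y ∩ {m | bil rt m (hv z) < 0}).ncard +
    (sep y z ∩ {m | 0 < bil rt m (hv x)}).ncard, by ring⟩

theorem OffLines.smul {z : ℍ} (hz : OffLines z) {g : SL(2, ℝ)} (hg : g ∈ gridGroup) :
    OffLines (g • z) := fun m hm h => by
  refine hz (act g⁻¹ m) (act_mem_lineNormals (inv_mem hg) hm) ?_
  rw [← h, hv_smul, ← bil_act g, act_act_inv]

theorem ncard_sep_smul {g : SL(2, ℝ)} (hg : g ∈ gridGroup) (z w : ℍ) :
    (sep (g • z) (g • w)).ncard = (sep z w).ncard := by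
  rw [← Set.ncard_image_of_injective (sep z w) (act_injective g)]
  congr 1
  ext m
  constructor
  · rintro ⟨h1, h2, h3⟩
    refine ⟨act g⁻¹ m, ⟨act_mem_lineNormals (inv_mem hg) h1, ?_, ?_⟩, act_act_inv _ _⟩
    · rwa [← bil_act g, act_act_inv, ← hv_smul]
    · rwa [← bil_act g, act_act_inv, ← hv_smul]
  · rintro ⟨m, ⟨h1, h2, h3⟩, rfl⟩
    exact ⟨act_mem_lineNormals hg h1, by rwa [hv_smul, bil_act], by rwa [hv_smul, bil_act]⟩

theorem swap_mem_lineNormals {x y z : ℝ} (h : (x, y, z) ∈ lineNormals) :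
    (x, z, y) ∈ lineNormals ∧ (y, x, z) ∈ lineNormals := by
  obtain ⟨⟨a, b, c⟩, ⟨h1, k, hk⟩, he⟩ := h
  simp only [embv, Prod.mk.injEq] at he
  obtain ⟨rfl, rfl, rfl⟩ := he
  simp only [bil, vsum] at h1 hk
  exact ⟨⟨(a, c, b), ⟨by rw [← h1]; simp only [bil, vsum]; ring,
      k, by rw [← hk]; simp only [vsum]; ring⟩, rfl⟩,
    ⟨(b, a, c), ⟨by rw [← h1]; simp only [bil, vsum]; ring,
      k, by rw [← hk]; simp only [vsum]; ring⟩, rfl⟩⟩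

theorem exists_center : ∃ (z : ℍ) (l : ℝ), 0 < l ∧ hv z = l • (1, 1, 1) := by
  have hr := rt_bounds.1
  set q := √(21 + 12 * rt) with hq
  have hq0 : 0 < q := Real.sqrt_pos.2 (by linarith)
  have hqq : q * q = 21 + 12 * rt := Real.mul_self_sqrt (by linarith)
  obtain ⟨z, hz⟩ := exists_hv_eq (x := q⁻¹ • ((1, 1, 1) : ℝ × ℝ × ℝ)) (by
      rw [bil_smul_left, bil_smul_right,
        show bil rt ((1, 1, 1) : ℝ × ℝ × ℝ) (1, 1, 1) = q * q by rw [hqq]; simp [bil, vsum]; ring]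
      field_simp) (by simp [vsum]; positivity)
  exact ⟨z, q⁻¹, inv_pos.2 hq0, hz⟩

/-- Start at the centre of the base triangle. Permuting coordinates is a symmetry of the line
family, so the three neighbouring centres are separated from it by equally many lines. Each side
pairing acts as a product of two of the midpoint half-turns, so modulo `2` its count is twice this
common number. -/
theorem exists_base_parity : ∃ z : ℍ, OffLines z ∧ Even (sep z (mU • z)).ncard ∧
    Even (sep z (mV • z)).ncard := by
  obtain ⟨z, l, hl, hz⟩ := exists_center
  have hoff : OffLines z := fun m hm h => by
    rw [hz, bil_smul_right, mul_eq_zero] at h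
    have h1 := h.resolve_left hl.ne'
    rw [bil_eq_comb] at h1
    simp only [one_mul] at h1
    have h2 : bil rt m (1, 0, 0) = 0 ∧ bil rt m (0, 1, 0) = 0 ∧ bil rt m (0, 0, 1) = 0 := by
      rcases lineNormals_same_sign hm with ⟨a, b, c⟩ | ⟨a, b, c⟩ <;>
        refine ⟨?_, ?_, ?_⟩ <;> linarith
    have h3 := bil_lineNormals_neg hm
    rw [bil_eq_comb, h2.1, h2.2.1, h2.2.2] at h3
    simp at h3
  have hJ : hv (mJ • z) = l • (1 + rt, -1, 1 + rt) := by
    rw [hv_smul, hz, act_smul, act_mJ]; simp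
  have hJU : hv ((mJ * mU) • z) = l • (1 + rt, 1 + rt, -1) := by
    rw [hv_smul, hz, act_smul, act_mul, act_mU, act_mJ_mJ]; simp
  have hVJ : hv ((mV * mJ) • z) = l • (-1, 1 + rt, 1 + rt) := by
    rw [hv_smul, hz, act_smul, act_mVJ]; simp
  have mem_iff : ∀ (u : ℍ) (x : ℝ × ℝ × ℝ), hv u = l • x → ∀ m, m ∈ sep z u ↔
      m ∈ lineNormals ∧ 0 < bil rt m (1, 1, 1) ∧ bil rt m x < 0 := fun u x hu m => by
    rw [sep, Set.mem_ofPred_eq, hz, hu, bil_smul_right, bil_smul_right,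
      mul_pos_iff_of_pos_left hl, mul_neg_iff]
    simp only [hl, hl.not_gt, true_and, false_and, or_false]
  have swap : ∀ (f : ℝ × ℝ × ℝ → ℝ × ℝ × ℝ) (u u' : ℍ), Function.Involutive f →
      (∀ m, m ∈ sep z u → f m ∈ sep z u') → (∀ m, m ∈ sep z u' → f m ∈ sep z u) →
      (sep z u).ncard = (sep z u').ncard := fun f u u' hf h1 h2 =>
    (Set.ncard_le_ncard_of_injOn f h1 hf.injective.injOn (finite_sep _ _)).antisymm
      (Set.ncard_le_ncard_of_injOn f h2 hf.injective.injOn (finite_sep _ _))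
  have s1 : (sep z (mJ • z)).ncard = (sep z ((mJ * mU) • z)).ncard := by
    refine swap (fun m => (m.1, m.2.2, m.2.1)) _ _ (fun m => rfl) (fun m hm => ?_) fun m hm => ?_
    · rw [mem_iff _ _ hJ] at hm
      rw [mem_iff _ _ hJU]
      refine ⟨(swap_mem_lineNormals hm.1).1, ?_, ?_⟩
      · convert hm.2.1 using 1; simp only [bil, vsum]; ring
      · convert hm.2.2 using 1; simp only [bil, vsum]; ring
    · rw [mem_iff _ _ hJU] at hm
      rw [mem_iff _ _ hJ]
      refine ⟨(swap_mem_lineNormals hm.1).1, ?_, ?_⟩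
      · convert hm.2.1 using 1; simp only [bil, vsum]; ring
      · convert hm.2.2 using 1; simp only [bil, vsum]; ring
  have s2 : (sep z (mJ • z)).ncard = (sep z ((mV * mJ) • z)).ncard := by
    refine swap (fun m => (m.2.1, m.1, m.2.2)) _ _ (fun m => rfl) (fun m hm => ?_) fun m hm => ?_
    · rw [mem_iff _ _ hJ] at hm
      rw [mem_iff _ _ hVJ]
      refine ⟨(swap_mem_lineNormals hm.1).2, ?_, ?_⟩
      · convert hm.2.1 using 1; simp only [bil, vsum]; ring
      · convert hm.2.2 using 1; simp only [bil, vsum]; ring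
    · rw [mem_iff _ _ hVJ] at hm
      rw [mem_iff _ _ hJ]
      refine ⟨(swap_mem_lineNormals hm.1).2, ?_, ?_⟩
      · convert hm.2.1 using 1; simp only [bil, vsum]; ring
      · convert hm.2.2 using 1; simp only [bil, vsum]; ring
  have eU : mU • z = mJ • (mJ * mU) • z := hv_injective (by
    rw [hv_smul, hv_smul, hv_smul, act_mul, act_mJ_mJ])
  have eV : mV • z = (mV * mJ) • mJ • z := hv_injective (by
    rw [hv_smul, hv_smul, hv_smul, act_mV])
  refine ⟨z, hoff, ?_, ?_⟩
  · have h := ncard_sep_add hoff (hoff.smul mJ_mem) ((hoff.smul mJU_mem).smul mJ_mem)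
    rw [ncard_sep_smul mJ_mem, ← s1, ← eU] at h
    exact (Nat.even_add.1 h).1 ⟨_, rfl⟩
  · have h := ncard_sep_add hoff (hoff.smul mVJ_mem) ((hoff.smul mJ_mem).smul mVJ_mem)
    rw [ncard_sep_smul mVJ_mem, ← s2, ← eV] at h
    exact (Nat.even_add.1 h).1 ⟨_, rfl⟩

theorem even_ncard_sep_indep {g : SL(2, ℝ)} (hg : g ∈ gridGroup) {z w : ℍ} (hz : OffLines z)
    (hw : OffLines w) (h : Even (sep z (g • z)).ncard) : Even (sep w (g • w)).ncard := by
  have h1 := ncard_sep_add hw hz (hz.smul hg)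
  have h2 := ncard_sep_add hw (hz.smul hg) (hw.smul hg)
  rw [ncard_sep_smul hg, ncard_sep_comm z w] at h2
  simp only [Nat.even_add] at h1 h2
  tauto

/-- The parity of the number of separating lines is additive and invariant, hence a homomorphism on
words; it vanishes on both letters. -/
theorem even_ncard_sep (w : FreeGroup (Fin 2)) {z : ℍ} (hz : OffLines z) :
    Even (sep z (word w • z)).ncard := by
  obtain ⟨z₀, h0, hU, hV⟩ := exists_base_parity
  have hself : ∀ z, sep z z = ∅ := fun z =>
    Set.eq_empty_of_forall_notMem fun m hm => lt_asymm hm.2.1 hm.2.2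
  have hof : ∀ (i : Fin 2) {z : ℍ}, OffLines z →
      Even (sep z (word (FreeGroup.of i) • z)).ncard := by
    intro i z hz
    refine even_ncard_sep_indep (word_mem _) h0 hz ?_
    fin_cases i
    · simpa only [Fin.zero_eta, word_zero] using hU
    · simpa only [Fin.mk_one, word_one] using hV
  induction w using FreeGroup.induction_on generalizing z with
  | C1 => simp [hself]
  | of i => exact hof i hz
  | inv_of i h =>
    have h1 := hof i hz
    rw [← ncard_sep_smul (inv_mem (word_mem (FreeGroup.of i))), inv_smul_smul,
      ncard_sep_comm] at h1
    rwa [map_inv]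
  | mul a b ha hb =>
    have h := ncard_sep_add hz (hz.smul (word_mem a)) ((hz.smul (word_mem b)).smul (word_mem a))
    rw [ncard_sep_smul (word_mem a)] at h
    have h1 := ha hz
    have h2 := hb hz
    rw [map_mul, mul_smul]
    simp only [Nat.even_add] at h
    tauto

end

end BolzaLike

namespace BolzaLike

noncomputable section

/-! ### Intersections of a geodesic with the edge lines -/

variable {k n : ℕ} {Γ : Subgroup SL(2, ℝ)}

/-- Along a geodesic the product with a fixed vector is interpolated with hyperbolic sines. It
therefore has the zero and sign behaviour of an affine function. -/
theorem sinh_mul_bil {c : ℝ → ℍ} (hc : Isometry c) (m : ℝ × ℝ × ℝ) (s t u : ℝ) :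
    Real.sinh (t - s) * bil rt m (hv (c u)) = Real.sinh (t - u) * bil rt m (hv (c s)) +
      Real.sinh (u - s) * bil rt m (hv (c t)) := by
  obtain ⟨v, -, hcv⟩ := exists_frame_of_isometry hc
  rw [hcv u, hcv s, hcv t, ← bil_smul_right, hyp_interpolate, bil_add_right, bil_smul_right,
    bil_smul_right]

theorem mem_line_of_two {c : ℝ → ℍ} (hc : Isometry c) {m : ℝ × ℝ × ℝ} {s t : ℝ} (hst : s ≠ t)
    (hs : c s ∈ line m) (ht : c t ∈ line m) (u : ℝ) : c u ∈ line m := by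
  have h := sinh_mul_bil hc m s t u
  rw [show bil rt m (hv (c s)) = 0 from hs, show bil rt m (hv (c t)) = 0 from ht, mul_zero,
    mul_zero, add_zero, mul_eq_zero, Real.sinh_eq_zero, sub_eq_zero] at h
  exact h.resolve_left hst.symm

theorem mul_nonpos_of_mem_line {c : ℝ → ℍ} (hc : Isometry c) {m : ℝ × ℝ × ℝ} {a b t : ℝ}
    (ht : t ∈ Set.Icc a b) (h : c t ∈ line m) :
    bil rt m (hv (c a)) * bil rt m (hv (c b)) ≤ 0 := by
  by_contra! hpos
  have h0 : bil rt m (hv (c t)) = 0 := h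
  have hat : t ≠ a := fun e => by rw [e] at h0; rw [h0, zero_mul] at hpos; exact lt_irrefl _ hpos
  have h1 := sinh_mul_bil hc m a b t
  rw [h0, mul_zero] at h1
  have h2 : 0 < Real.sinh (t - a) :=
    Real.sinh_pos_iff.2 (sub_pos.2 (lt_of_le_of_ne ht.1 hat.symm))
  have h3 : 0 ≤ Real.sinh (b - t) := Real.sinh_nonneg_iff.2 (sub_nonneg.2 ht.2)
  have h4 : 0 = Real.sinh (b - t) * (bil rt m (hv (c a)) * bil rt m (hv (c a))) +
      Real.sinh (t - a) * (bil rt m (hv (c a)) * bil rt m (hv (c b))) := by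
    linear_combination bil rt m (hv (c a)) * h1
  linarith [mul_pos h2 hpos, mul_nonneg h3 (mul_self_nonneg (bil rt m (hv (c a))))]

theorem finite_hits {c : ℝ → ℍ} (hc : Isometry c) {R : ℝ × ℝ × ℝ → Prop}
    (hR : ∀ m ∈ lineNormals, R m → ¬ ∀ t, c t ∈ line m) (a b : ℝ) :
    ({t | ∃ m ∈ lineNormals, R m ∧ c t ∈ line m} ∩ Set.Icc a b).Finite := by
  have hch : ∀ t : ℝ, ∃ m, (∃ m ∈ lineNormals, R m ∧ c t ∈ line m) →
      m ∈ lineNormals ∧ R m ∧ c t ∈ line m := fun t => by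
    by_cases h : ∃ m ∈ lineNormals, R m ∧ c t ∈ line m
    · obtain ⟨m, hm⟩ := h
      exact ⟨m, fun _ => hm⟩
    · exact ⟨0, fun h' => absurd h' h⟩
  choose f hf using hch
  refine Set.Finite.of_injOn (f := f) (fun t ht => ?_) (fun s hs t ht hst => ?_)
    (finite_lineNormals_separating (c a) (c b))
  · obtain ⟨h1, -, h3⟩ := hf t ht.1
    exact ⟨h1, mul_nonpos_of_mem_line hc ht.2 h3⟩
  · by_contra hne
    obtain ⟨h1, h2, h3⟩ := hf s hs.1
    obtain ⟨-, -, h4⟩ := hf t ht.1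
    rw [← hst] at h4
    exact hR _ h1 h2 (mem_line_of_two hc hne h3 h4)

/-- A geodesic crosses a line at most once, and away from vertices only one line passes through a
point. So crossing times and separating lines correspond bijectively. A crossing at the endpoint `b`
is excluded on both sides of the count. -/
theorem ncard_hits_eq {c : ℝ → ℍ} (hc : Isometry c) (hvx : ∀ t, ¬ IsVertex (c t)) {a b : ℝ}
    (hab : a ≤ b) (ha : OffLines (c a)) :
    ({t | ∃ m ∈ lineNormals, c t ∈ line m} ∩ Set.Ico a b).ncard =
      (sep (c a) (c b)).ncard := by
  have hz : ∀ m ∈ sep (c a) (c b), ∃ t ∈ Set.Icc a b, c t ∈ line m := fun m hm => by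
    refine exists_zero_of_side_ne hc hab ?_
    rw [side_of_pos hm.2.1, side_of_nonpos hm.2.2.le]
    norm_num
  choose τ hτ hτm using hz
  symm
  refine Set.ncard_congr τ ?_ ?_ ?_
  · intro m hm
    refine ⟨⟨m, hm.1, hτm m hm⟩, (hτ m hm).1, lt_of_le_of_ne (hτ m hm).2 fun e => ?_⟩
    have h : bil rt m (hv (c (τ m hm))) = 0 := hτm m hm
    rw [e] at h
    exact hm.2.2.ne h
  · intro m m' hm hm' e
    have h' := hτm m' hm'
    rw [← e] at h'
    rcases lineNormals_unique (hvx _) hm.1 hm'.1 (hτm m hm) h' with h | h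
    · exact h.symm
    · have h1 := hm'.2.1
      rw [h, bil_neg_left] at h1
      linarith [hm.2.1]
  · rintro t ⟨⟨m, hm, hmt⟩, hta, htb⟩
    have key : ∀ m ∈ lineNormals, c t ∈ line m → 0 < bil rt m (hv (c a)) →
        ∃ m, ∃ hm : m ∈ sep (c a) (c b), τ m hm = t := by
      intro m hm hmt hpos
      have h0 : bil rt m (hv (c t)) = 0 := hmt
      have hat : a ≠ t := fun e => ha m hm (e ▸ h0)
      have h1 := sinh_mul_bil hc m a b t
      have h2 : 0 < Real.sinh (t - a) := Real.sinh_pos_iff.2 (sub_pos.2 (lt_of_le_of_ne hta hat))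
      have h3 : 0 < Real.sinh (b - t) := Real.sinh_pos_iff.2 (sub_pos.2 htb)
      have hneg : bil rt m (hv (c b)) < 0 := by
        rw [h0, mul_zero] at h1
        by_contra! hcon
        nlinarith [mul_pos h3 hpos, mul_nonneg h2.le hcon]
      refine ⟨m, ⟨hm, hpos, hneg⟩, ?_⟩
      by_contra hne
      exact hneg.ne (mem_line_of_two hc hne (hτm m ⟨hm, hpos, hneg⟩) hmt b)
    rcases (ha m hm).lt_or_gt with h | h
    · refine key (-m) (neg_mem_lineNormals hm) ?_ (by rw [bil_neg_left]; linarith)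
      rw [line, Set.mem_ofPred_eq, bil_neg_left, show bil rt m (hv (c t)) = 0 from hmt, neg_zero]
    · exact key m hm hmt h

/-! ### Reflection at a vertex -/

theorem turn_smul_reflect {c : ℝ → ℍ} (hc : Isometry c) (a t : ℝ) :
    turn (c a) • c t = c (2 * a - t) := by
  have hc' : Isometry fun s => c (s + a) := hc.comp (IsometryEquiv.addRight a).isometry
  obtain ⟨v, hf, hcv⟩ := exists_frame_of_isometry hc'
  simp only [zero_add] at hf hcv
  have hp : act (turn (c a)) (hv (c a)) = hv (c a) := by rw [← hv_smul, turn_smul_self]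
  have hv' : act (turn (c a)) v = -v := by
    apply act_eq_of_mul_eq
    rw [turn_coe, vmat_neg, neg_mul, vmat_mul_of_orthogonal hf.pv,
      vmat_mul_of_orthogonal (by rw [bil_comm, hf.pv]), vcross_swap, vmat_neg]
  apply hv_injective
  have h1 := hcv (t - a)
  have h2 := hcv (2 * a - t - a)
  rw [sub_add_cancel] at h1 h2
  rw [hv_smul, h1, h2, hyp, act_add, act_smul, act_smul, hp, hv', hyp,
    show 2 * a - t - a = -(t - a) by ring, Real.cosh_neg, Real.sinh_neg, smul_neg, neg_smul]

theorem IsSurfaceGroup.conj_mem (hΓ : IsSurfaceGroup eqAngle k n Γ) {x g : SL(2, ℝ)}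
    (hx : x ∈ torusGroup eqAngle k n) (hg : g ∈ Γ) : x * g * x⁻¹ ∈ Γ := by
  rw [hΓ.mul_mem_iff (mul_mem hx (hΓ.le hg)) (inv_mem hx), hΓ.mul_mem_iff hx (hΓ.le hg),
    inv_mem_iff]
  tauto

/-- The square lies in `Γ` and has a fixed point, so it acts trivially. This kills the scalar part
of `x`; what remains is an integral vector equal to plus or minus the fixed point, which makes that
point a vertex. -/
theorem IsSurfaceGroup.isVertex_of_odd_fixed (hΓ : IsSurfaceGroup eqAngle k n Γ)
    {x : SL(2, ℝ)} (hx : x ∈ commGroup) (hxΓ : x ∉ Γ) {q : ℍ} (hq : x • q = q) : IsVertex q := by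
  have hxT := commGroup_le k n hx
  have hsq : x * x ∈ Γ := (hΓ.mul_mem_iff hxT hxT).2 Iff.rfl
  have htriv := hΓ.free _ hsq q (by rw [mul_smul, hq, hq])
  obtain ⟨-, h⟩ | ⟨hodd, -⟩ := hΓ.parity hx
  · exact absurd h hxΓ
  obtain ⟨a, y, hxy, -⟩ := hodd
  have hxy : (x : Matrix (Fin 2) (Fin 2) ℝ) = emb a • 1 + vmat (embv y) := hxy
  set α := emb a
  set N := embv y with hN
  have comm : ∀ (β : ℝ) (M z : ℝ × ℝ × ℝ) (h : SL(2, ℝ)), act h z = z →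
      (h : Matrix (Fin 2) (Fin 2) ℝ) = β • 1 + vmat M → vmat M * vmat z = vmat z * vmat M := by
    intro β M z h h1 h2
    have h3 := act_eq_iff_commute.1 h1
    rw [h2, add_mul, mul_add, smul_mul_assoc, mul_smul_comm, one_mul, mul_one] at h3
    exact add_left_cancel h3
  have hxx : ((x * x : SL(2, ℝ)) : Matrix (Fin 2) (Fin 2) ℝ) =
      (α ^ 2 - bil rt N N) • 1 + vmat ((2 * α) • N) := by
    rw [Matrix.SpecialLinearGroup.coe_mul, hxy, add_mul, mul_add, mul_add, vmat_mul_self,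
      vmat_smul]
    simp only [smul_mul_assoc, mul_smul_comm, one_mul, mul_one]
    module
  -- A vector commuting with two different basis vectors is a multiple of both, hence zero.
  have h0 : (2 * α) • N = 0 := by
    have hA := vector_part_of_commute (bil_hv_self (vertexA eqAngle)) one_ne_zero
      (comm _ _ _ _ (by rw [← hv_smul, htriv]) hxx)
    have hB := vector_part_of_commute (bil_hv_self (vertexB eqAngle)) one_ne_zero
      (comm _ _ _ _ (by rw [← hv_smul, htriv]) hxx)
    rw [hv_vertexA] at hA
    rw [hv_vertexB] at hB
    generalize (2 * α) • N = w at hA hB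
    generalize bil rt w (1, 0, 0) / 1 = s at hA
    generalize bil rt w (0, 1, 0) / 1 = s' at hB
    ext
    · rw [hB]; simp
    · rw [hA]; simp
    · rw [hA]; simp
  have hdet := det_scalar_add_vmat α N
  rw [← hxy, x.det_coe] at hdet
  have hNq := vector_part_of_commute (bil_hv_self q) one_ne_zero
    (comm _ _ _ _ (by rw [← hv_smul, hq]) hxy)
  have hN0 : N ≠ 0 := fun h => by
    rw [h, vmat_zero, add_zero] at hxy
    rcases eq_one_or_eq_neg_one hxy with h | h
    · exact hxΓ (h ▸ one_mem _)
    · exact hxΓ (h ▸ hΓ.neg_one_mem)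
  have hα : α = 0 := by
    simpa using (smul_eq_zero.1 h0).resolve_right hN0
  generalize bil rt N (hv q) / 1 = s at hNq
  rw [hα, hNq, bil_smul_left, bil_smul_right, bil_hv_self] at hdet
  have hs : s = 1 ∨ s = -1 := mul_self_eq_one_iff.1 (by linarith)
  rcases hs with rfl | rfl
  · exact ⟨y, by rw [← hN, hNq, one_smul]⟩
  · exact ⟨-y, by rw [embv_neg, ← hN, hNq, neg_one_smul, neg_neg]⟩

/-- Reflecting at the vertex and then translating by `g` fixes the point half a period later. This
motion is outside `Γ` with trivial square, so its exponent sums vanish and it is an odd element of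
`commGroup`. -/
theorem IsLift.isVertex_half (hΓ : IsSurfaceGroup eqAngle k n Γ) {γ : ℝ → Surface Γ} {L : ℝ} {c : ℝ → ℍ}
    {g : SL(2, ℝ)} (h : IsLift Γ γ L c g) {a : ℝ} (ha : IsVertex (c a)) :
    IsVertex (c (a + L / 2)) := by
  have hρ := ha.turn_mem
  have hρT := commGroup_le k n hρ
  have hgT := hΓ.le h.mem
  have hxΓ : g * turn (c a) ∉ Γ := by
    rw [hΓ.mul_mem_iff hgT hρT]
    exact fun h' => hΓ.turn_notMem _ (h'.1 h.mem)
  have hq : (g * turn (c a)) • c (a + L / 2) = c (a + L / 2) := by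
    rw [mul_smul, turn_smul_reflect h.isom, h.smul]
    congr 1
    ring
  refine hΓ.isVertex_of_odd_fixed ?_ hxΓ hq
  have hxT := mul_mem hgT hρT
  have hsq := (hΓ.mul_mem_iff hxT hxT).2 Iff.rfl
  have htriv := hΓ.free _ hsq _ (by rw [mul_smul, hq, hq])
  obtain ⟨w, -, hw⟩ := hxT
  rw [← hw] at htriv ⊢
  exact ⟨w, intExp_eq_one_of_sq w htriv, rfl⟩

theorem IsVertex.exists_line_ne {z : ℍ} (hz : IsVertex z) (m₀ : ℝ × ℝ × ℝ) :
    ∃ m ∈ lineNormals, z ∈ line m ∧ m ≠ m₀ ∧ m ≠ -m₀ := by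
  have hr := rt_bounds.1
  have hsq := rt_sq
  obtain ⟨g, hg, hgz⟩ := hz.exists_grid
  have key : ∀ s ∈ lineNormals, ∀ s' ∈ lineNormals, s ≠ s' → s ≠ -s' →
      bil rt s (hv (g • z)) = 0 → bil rt s' (hv (g • z)) = 0 →
      ∃ m ∈ lineNormals, z ∈ line m ∧ m ≠ m₀ ∧ m ≠ -m₀ := by
    intro s hs s' hs' h1 h2 h3 h4
    have hl : ∀ s, bil rt s (hv (g • z)) = 0 → z ∈ line (act g⁻¹ s) := fun s h => by
      rw [line, Set.mem_ofPred_eq, ← h, ← bil_act g, act_act_inv, hv_smul]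
    by_cases h : act g⁻¹ s ≠ m₀ ∧ act g⁻¹ s ≠ -m₀
    · exact ⟨_, act_mem_lineNormals (inv_mem hg) hs, hl s h3, h.1, h.2⟩
    · refine ⟨_, act_mem_lineNormals (inv_mem hg) hs', hl s' h4, fun e => h ⟨?_, ?_⟩,
        fun e => h ⟨?_, ?_⟩⟩
      · exact fun e' => h1 (act_injective _ (e'.trans e.symm))
      · exact fun e' => h2 (act_injective _ (by rw [act_neg, e, e']))
      · exact fun e' => h2 (act_injective _ (by rw [act_neg, e, e', neg_neg]))
      · exact fun e' => h1 (act_injective _ (e'.trans e.symm))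
  have s2 := edge_mem_lineNormals
  have s1 := (swap_mem_lineNormals s2).1
  have s3 := (swap_mem_lineNormals s2).2
  rcases hgz with h | h | h <;> rw [h] at key
  · rw [hv_vertexA] at key
    refine key _ s1 _ s2 ?_ ?_ ?_ ?_
    · simp only [ne_eq, Prod.mk.injEq, not_and]; intros; linarith
    · simp only [Prod.neg_mk, ne_eq, Prod.mk.injEq, not_and]; intros; linarith
    · simp only [bil, vsum]; linarith
    · simp only [bil, vsum]; linarith
  · rw [hv_vertexB] at key
    refine key _ s1 _ s3 ?_ ?_ ?_ ?_
    · simp only [ne_eq, Prod.mk.injEq, not_and]; intros; linarith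
    · simp only [Prod.neg_mk, ne_eq, Prod.mk.injEq, not_and]; intros; linarith
    · simp only [bil, vsum]; linarith
    · simp only [bil, vsum]; linarith
  · rw [hv_vertexC] at key
    refine key _ s2 _ s3 ?_ ?_ ?_ ?_
    · simp only [ne_eq, Prod.mk.injEq, not_and]; intros; linarith
    · simp only [Prod.neg_mk, ne_eq, Prod.mk.injEq, not_and]; intros; linarith
    · simp only [bil, vsum]; linarith
    · simp only [bil, vsum]; linarith

end

end BolzaLike

namespace BolzaLike

noncomputable section

/-! ### Counting intersection points -/

variable {k n : ℕ} {Γ : Subgroup SL(2, ℝ)}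

/-- Modulo `L` the reflection has the two fixed points `a` and `a + L / 2`. Both belong to the set,
and the two open half-periods are exchanged. -/
theorem even_ncard_of_reflection {P : Set ℝ} {a L : ℝ} (hL : 0 < L)
    (hfin : (P ∩ Set.Ico a (a + L)).Finite) (hrefl : ∀ t ∈ P, 2 * a + L - t ∈ P) (ha : a ∈ P)
    (ha' : a + L / 2 ∈ P) : Even (P ∩ Set.Ico a (a + L)).ncard := by
  set A := P ∩ Set.Ioo a (a + L / 2) with hA
  set B := P ∩ Set.Ioo (a + L / 2) (a + L) with hB
  have hfA : A.Finite := hfin.subset fun t ht => ⟨ht.1, ht.2.1.le, by linarith [ht.2.2]⟩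
  have hfB : B.Finite := hfin.subset fun t ht => ⟨ht.1, by linarith [ht.2.1], ht.2.2⟩
  have hBA : B.ncard = A.ncard := by
    rw [← Set.ncard_image_of_injective A (sub_right_injective (b := 2 * a + L))]
    congr 1
    ext t
    constructor
    · rintro ⟨h1, h2, h3⟩
      exact ⟨2 * a + L - t, ⟨hrefl t h1, by linarith, by linarith⟩, by ring⟩
    · rintro ⟨s, ⟨h1, h2, h3⟩, rfl⟩
      exact ⟨hrefl s h1, by dsimp only; linarith, by dsimp only; linarith⟩
  have hS : P ∩ Set.Ico a (a + L) = insert a (insert (a + L / 2) (A ∪ B)) := by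
    ext t
    simp only [Set.mem_insert_iff, Set.mem_union, hA, hB, Set.mem_inter_iff, Set.mem_Ioo,
      Set.mem_Ico]
    constructor
    · rintro ⟨h1, h2, h3⟩
      rcases h2.eq_or_lt with h2 | h2
      · exact Or.inl h2.symm
      · rcases lt_trichotomy t (a + L / 2) with h4 | h4 | h4
        · exact Or.inr (Or.inr (Or.inl ⟨h1, h2, h4⟩))
        · exact Or.inr (Or.inl h4)
        · exact Or.inr (Or.inr (Or.inr ⟨h1, h4, h3⟩))
    · rintro (rfl | rfl | ⟨h1, h2, h3⟩ | ⟨h1, h2, h3⟩)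
      · exact ⟨ha, le_rfl, by linarith⟩
      · exact ⟨ha', by linarith, by linarith⟩
      · exact ⟨h1, h2.le, by linarith⟩
      · exact ⟨h1, by linarith, h3⟩
  have n1 : a + L / 2 ∉ A ∪ B := by
    rintro (h | h)
    · exact lt_irrefl _ h.2.2
    · exact lt_irrefl _ h.2.1
  have n2 : a ∉ insert (a + L / 2) (A ∪ B) := by
    rintro (h | h | h)
    · linarith
    · exact lt_irrefl _ h.2.1
    · linarith [h.2.1]
  have hd : Disjoint A B := Set.disjoint_left.2 fun t h1 h2 => by linarith [h1.2.2, h2.2.1]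
  rw [hS, Set.ncard_insert_of_notMem n2 ((hfA.union hfB).insert _),
    Set.ncard_insert_of_notMem n1 (hfA.union hfB), Set.ncard_union_eq hd hfA hfB, hBA]
  exact ⟨A.ncard + 1, by ring⟩

/-- Simplicity is what allows counting parameters in one period instead of points on the surface. -/
theorem IsSimpleClosedGeodesic.range_inter {γ : ℝ → Surface Γ} {L : ℝ}
    (h : IsSimpleClosedGeodesic Γ γ L) (U : Set (Surface Γ)) (a : ℝ) :
    Set.range γ ∩ U = γ '' ({t | γ t ∈ U} ∩ Set.Ico a (a + L)) ∧
      Set.InjOn γ ({t | γ t ∈ U} ∩ Set.Ico a (a + L)) := by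
  constructor
  · ext x
    constructor
    · rintro ⟨⟨t, rfl⟩, hx⟩
      obtain ⟨j, hj, -⟩ := existsUnique_add_zsmul_mem_Ico h.pos t a
      have hper : γ (t + j • L) = γ t := h.periodic.zsmul j t
      refine ⟨t + j • L, ⟨?_, hj⟩, hper⟩
      rw [Set.mem_ofPred_eq, hper]
      exact hx
    · rintro ⟨t, ⟨h1, -⟩, rfl⟩
      exact ⟨⟨t, rfl⟩, h1⟩
  · rintro s ⟨-, hs⟩ t ⟨-, ht⟩ hst
    obtain ⟨j, hj⟩ := h.simple s t hst
    have hL := h.pos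
    have h1 : (j : ℝ) < 1 := by nlinarith [hs.1, ht.2]
    have h2 : (-1 : ℝ) < j := by nlinarith [hs.2, ht.1]
    have h3 : j = 0 := by
      have h4 : j < 1 := by exact_mod_cast h1
      have h5 : -1 < j := by exact_mod_cast h2
      omega
    rw [hj, h3]
    simp

theorem IsLift.zpow_smul {γ : ℝ → Surface Γ} {L : ℝ} {c : ℝ → ℍ} {g : SL(2, ℝ)}
    (h : IsLift Γ γ L c g) (j : ℤ) (t : ℝ) : g ^ j • c t = c (t + j * L) := by
  obtain ⟨M, rfl | rfl⟩ := j.eq_nat_or_neg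
  · rw [zpow_natCast, pow_smul_eq h.smul]; simp
  · rw [zpow_neg, zpow_natCast, inv_smul_eq_iff, pow_smul_eq h.smul]
    push_cast
    congr 1
    ring

theorem IsLift.range_eq {γ : ℝ → Surface Γ} {L : ℝ} {c : ℝ → ℍ} {g : SL(2, ℝ)}
    (h : IsLift Γ γ L c g) : Set.range γ = proj Γ '' Set.range c := by
  rw [← Set.range_comp]
  exact congrArg Set.range (funext h.eq)

/-- The half-turn normalises `Γ`, which has index two, and maps the lift of `γ` to itself. It thus
induces an involution of the surface preserving `γ`, and so permutes the images different from `γ`.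
-/
theorem IsSurfaceGroup.image_line_turn_ne (hΓ : IsSurfaceGroup eqAngle k n Γ)
    {γ : ℝ → Surface Γ} {L : ℝ} {c : ℝ → ℍ} {g : SL(2, ℝ)} (h : IsLift Γ γ L c g) {a : ℝ}
    (ha : IsVertex (c a)) {m : ℝ × ℝ × ℝ} (hm : proj Γ '' line m ≠ Set.range γ) :
    proj Γ '' line (act (turn (c a)) m) ≠ Set.range γ := by
  intro he
  apply hm
  rw [h.range_eq] at he ⊢
  have hT := commGroup_le k n ha.turn_mem
  set ρ := turn (c a)
  have hline : ∀ z, z ∈ line m ↔ ρ • z ∈ line (act ρ m) := fun z => by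
    rw [line, line, Set.mem_ofPred_eq, Set.mem_ofPred_eq, hv_smul, bil_act]
  have hrange : ∀ z, z ∈ Set.range c ↔ ρ • z ∈ Set.range c := by
    have h1 : ∀ z ∈ Set.range c, ρ • z ∈ Set.range c := by
      rintro _ ⟨t, rfl⟩
      exact ⟨_, (turn_smul_reflect h.isom a t).symm⟩
    refine fun z => ⟨h1 z, fun h2 => ?_⟩
    obtain ⟨t, ht⟩ := h2
    refine ⟨2 * a - t, ?_⟩
    rw [← turn_smul_reflect h.isom, ht, ← mul_smul, turn_mul_self]
    apply hv_injective
    rw [hv_smul, act_neg_group, act_one]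
  have key : ∀ A B A' B' : Set ℍ, (∀ z, z ∈ A ↔ ρ • z ∈ A') → (∀ z, z ∈ B ↔ ρ • z ∈ B') →
      proj Γ '' A' ⊆ proj Γ '' B' → proj Γ '' A ⊆ proj Γ '' B := by
    rintro A B A' B' hA hB hsub _ ⟨z, hz, rfl⟩
    obtain ⟨w, hw, hwz⟩ := hsub ⟨ρ • z, (hA z).1 hz, rfl⟩
    obtain ⟨κ, hκ, hκz⟩ := proj_eq_iff.1 hwz
    refine ⟨ρ⁻¹ • w, (hB _).2 (by rwa [smul_inv_smul]), proj_eq_iff.2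
      ⟨ρ⁻¹ * κ * ρ, ?_, ?_⟩⟩
    · have := hΓ.conj_mem (inv_mem hT) hκ
      rwa [inv_inv] at this
    · rw [mul_smul, mul_smul, hκz]
  exact Set.Subset.antisymm (key _ _ _ _ hline hrange he.subset)
    (key _ _ _ _ hrange hline he.superset)

/-- If a second line through the vertex also projected onto `γ`, countability would give one element
of `Γ` carrying the lift of `γ` to it. As `γ` is simple, that element, corrected by a power of `g`,
would fix the vertex; as `Γ` acts freely, the two lines would coincide. -/
theorem IsSurfaceGroup.exists_line_image_ne (hΓ : IsSurfaceGroup eqAngle k n Γ)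
    {γ : ℝ → Surface Γ} {L : ℝ} (hγ : IsSimpleClosedGeodesic Γ γ L) {c : ℝ → ℍ} {g : SL(2, ℝ)}
    (h : IsLift Γ γ L c g) {m₀ : ℝ × ℝ × ℝ} (hm₀ : m₀ ∈ lineNormals)
    (hc : ∀ t, c t ∈ line m₀) {a : ℝ} (ha : IsVertex (c a)) :
    ∃ m ∈ lineNormals, c a ∈ line m ∧ proj Γ '' line m ≠ Set.range γ := by
  obtain ⟨m, hm, ham, hne, hne'⟩ := ha.exists_line_ne m₀
  refine ⟨m, hm, ham, fun he => ?_⟩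
  obtain ⟨c', hc', hc'0, hcm⟩ := exists_line_param hm ham
  have hk : ∀ t, ∃ κ : Γ, ∃ s, κ.1 • c s = c' t := fun t => by
    have h1 : proj Γ (c' t) ∈ Set.range γ := he ▸ ⟨c' t, hcm t, rfl⟩
    obtain ⟨s, hs⟩ := h1
    rw [h.eq] at hs
    obtain ⟨κ, hκ, hκs⟩ := proj_eq_iff.1 hs.symm
    exact ⟨⟨κ, hκ⟩, s, hκs⟩
  choose f s hf using hk
  have := hΓ.countable
  obtain ⟨t₁, t₂, ht, hft⟩ := exists_ne_of_countable f
  set κ := (f t₁).1 with hκ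
  have hκΓ : κ ∈ Γ := (f t₁).2
  have hline : ∀ z, z ∈ line (act κ m₀) ↔ κ⁻¹ • z ∈ line m₀ := fun z => by
    rw [line, line, Set.mem_ofPred_eq, Set.mem_ofPred_eq, hv_smul, ← bil_act κ m₀, act_act_inv]
  have hall : ∀ u, κ⁻¹ • c' u ∈ line m₀ := fun u => (hline _).1 <| by
    refine mem_line_of_two hc' ht ((hline _).2 ?_) ((hline _).2 ?_) u
    · rw [← hf t₁, inv_smul_smul]; exact hc _
    · rw [← hf t₂, ← hft, inv_smul_smul]; exact hc _
  rw [← range_eq_line hm₀ h.isom hc] at hall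
  obtain ⟨s₀, hs₀⟩ := hall 0
  have hs₁ : γ s₀ = γ a := by
    rw [h.eq, h.eq, hs₀, hc'0]
    exact proj_eq_iff.2 ⟨κ⁻¹, inv_mem hκΓ, rfl⟩
  obtain ⟨j, hj⟩ := hγ.simple _ _ hs₁
  have hfix : (g ^ j * κ⁻¹) • c a = c a := by
    rw [mul_smul, ← hc'0, ← hs₀, h.zpow_smul, ← hj, hc'0]
  have htriv := hΓ.free _ (mul_mem (zpow_mem h.mem j) (inv_mem hκΓ)) _ hfix
  have hcc : ∀ t, c' t ∈ line m₀ := fun t => by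
    obtain ⟨u, hu⟩ := hall t
    rw [← htriv (c' t), mul_smul, ← hu, h.zpow_smul]
    exact hc _
  obtain ⟨t, hvt⟩ := exists_not_isVertex hc'
  rcases lineNormals_unique hvt hm₀ hm (hcc t) (hcm t) with h' | h'
  · exact hne h'
  · exact hne' h'

/-- The predicate `Q` selects the relevant lines, so both halves of the theorem share the reflection
argument at a vertex. Only the vertex-free case is left to the caller. -/
theorem even_inter_of_lines (hΓ : IsSurfaceGroup eqAngle k n Γ) {γ : ℝ → Surface Γ} {L : ℝ}
    (hγ : IsSimpleClosedGeodesic Γ γ L) {c : ℝ → ℍ} {g : SL(2, ℝ)} (h : IsLift Γ γ L c g)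
    (U : Set (Surface Γ)) (Q : ℝ × ℝ × ℝ → Prop)
    (hU : ∀ z, proj Γ z ∈ U ↔ ∃ m ∈ lineNormals, Q m ∧ z ∈ line m)
    (hQ : ∀ m ∈ lineNormals, Q m → ¬ ∀ t, c t ∈ line m)
    (hvert : ∀ a, IsVertex (c a) → ∃ m ∈ lineNormals, Q m ∧ c a ∈ line m)
    (hturn : ∀ a, IsVertex (c a) → ∀ m, Q m → Q (act (turn (c a)) m))
    (hfree : (∀ t, ¬ IsVertex (c t)) → ∃ a, Even ({t | γ t ∈ U} ∩ Set.Ico a (a + L)).ncard) :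
    (Set.range γ ∩ U).Finite ∧ Even (Set.range γ ∩ U).ncard := by
  have hP : {t | γ t ∈ U} = {t | ∃ m ∈ lineNormals, Q m ∧ c t ∈ line m} := by
    ext t
    rw [Set.mem_ofPred_eq, Set.mem_ofPred_eq, h.eq, hU]
  have hfin : ∀ a, ({t | γ t ∈ U} ∩ Set.Ico a (a + L)).Finite := fun a => by
    rw [hP]
    exact (finite_hits h.isom hQ a (a + L)).subset
      (Set.inter_subset_inter_right _ Set.Ico_subset_Icc_self)
  refine ⟨(hγ.range_inter U 0).1 ▸ (hfin 0).image γ, ?_⟩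
  suffices hs : ∃ a, Even ({t | γ t ∈ U} ∩ Set.Ico a (a + L)).ncard by
    obtain ⟨a, hev⟩ := hs
    obtain ⟨h1, h2⟩ := hγ.range_inter U a
    rwa [h1, h2.ncard_image]
  by_cases hv' : ∀ t, ¬ IsVertex (c t)
  · exact hfree hv'
  push Not at hv'
  obtain ⟨a, ha⟩ := hv'
  refine ⟨a, even_ncard_of_reflection hγ.pos (hfin a) (fun t ht => ?_) ?_ ?_⟩
  · have h1 : 2 * a - t ∈ {t | γ t ∈ U} := by
      rw [hP] at ht ⊢
      obtain ⟨m, hm, hQm, hmt⟩ := ht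
      refine ⟨act (turn (c a)) m, act_mem_lineNormals ?_ hm, hturn a ha m hQm, ?_⟩
      · obtain ⟨w, -, hw⟩ := ha.turn_mem
        exact hw ▸ word_mem w
      · rw [← turn_smul_reflect h.isom, line, Set.mem_ofPred_eq, hv_smul, bil_act]
        exact hmt
    have h2 : γ (2 * a + L - t) = γ (2 * a - t) := by
      rw [show 2 * a + L - t = 2 * a - t + L by ring, hγ.periodic]
    rw [Set.mem_ofPred_eq, h2]
    exact h1
  · rw [hP]; exact hvert a ha
  · rw [hP]; exact hvert _ (h.isVertex_half hΓ ha)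

theorem IsLift.even_hits (hΓ : IsSurfaceGroup eqAngle k n Γ) {γ : ℝ → Surface Γ} {L : ℝ}
    (hL : 0 < L) {c : ℝ → ℍ} {g : SL(2, ℝ)} (h : IsLift Γ γ L c g)
    (hline : ∀ m ∈ lineNormals, ¬ ∀ t, c t ∈ line m) (hvx : ∀ t, ¬ IsVertex (c t)) :
    ∃ a, Even ({t | ∃ m ∈ lineNormals, c t ∈ line m} ∩ Set.Ico a (a + L)).ncard := by
  have hfin := finite_hits h.isom (R := fun _ => True) (fun m hm _ => hline m hm) 0 1
  -- The starting time must lie off all lines; only finitely many times in an interval fail.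
  obtain ⟨a, ha, hna⟩ := (Set.Icc_infinite (zero_lt_one' ℝ)).exists_notMem_finite hfin
  have hoff : OffLines (c a) := fun m hm h0 => hna ⟨⟨m, hm, trivial, h0⟩, ha⟩
  refine ⟨a, ?_⟩
  rw [ncard_hits_eq h.isom hvx (by linarith) hoff, ← h.smul]
  obtain ⟨w, -, hw⟩ := hΓ.le h.mem
  rw [← hw]
  exact even_ncard_sep w hoff

end

end BolzaLike

theorem mainTheorem2 (k n : ℕ) (hk : 2 ≤ k) (hn : 4 ≤ n) (Γ : Subgroup SL(2, ℝ))
    (hΓ : BolzaLike.IsSurfaceGroup (Real.pi / 12) (2 * k) n Γ)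
    (γ : ℝ → BolzaLike.Surface Γ) (L : ℝ) (hγ : BolzaLike.IsSimpleClosedGeodesic Γ γ L) :
    (¬ BolzaLike.IsSystolicGeodesic Γ γ →
      (Set.range γ ∩ BolzaLike.systolicUnion Γ).Finite ∧
        Even (Set.range γ ∩ BolzaLike.systolicUnion Γ).ncard) ∧
    (BolzaLike.IsSystolicGeodesic Γ γ →
      (Set.range γ ∩ BolzaLike.otherSystolicUnion Γ γ).Finite ∧
        Even (Set.range γ ∩ BolzaLike.otherSystolicUnion Γ γ).ncard) := by
  open BolzaLike in
  obtain ⟨c, g, h⟩ := IsSurfaceGroup.exists_lift hΓ hγ.toIsClosedGeodesic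
  have hfun : (fun t => proj Γ (c t)) = γ := (funext h.eq).symm
  constructor
  · intro hns
    have hline : ∀ m ∈ lineNormals, ¬ ∀ t, c t ∈ line m := fun m hm hall =>
      hns (hfun ▸ isSystolicGeodesic_line hk hn hΓ hm h.isom hall)
    have hU : ∀ z, proj Γ z ∈ systolicUnion Γ ↔ ∃ m ∈ lineNormals, True ∧ z ∈ line m := fun z => by
      rw [← mem_systolicUnion hk hn hΓ (fun _ => True)]
      simp only [true_and]
      rfl
    refine even_inter_of_lines hΓ hγ h _ (fun _ => True) hU (fun m hm _ => hline m hm)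
      (fun a ha => ?_) (fun _ _ _ _ => trivial) fun hvx => ?_
    · obtain ⟨m, hm, ham, -⟩ := ha.exists_line_ne 0
      exact ⟨m, hm, trivial, ham⟩
    · have hP : {t | γ t ∈ systolicUnion Γ} = {t | ∃ m ∈ lineNormals, c t ∈ line m} := by
        ext t
        rw [Set.mem_ofPred_eq, Set.mem_ofPred_eq, h.eq, hU]
        simp only [true_and]
      rw [hP]
      exact h.even_hits hΓ hγ.pos hline hvx
  · intro hs
    -- The period `L` of `γ` is not known to be the systole, so the same lift is used again with the
    -- systole as period.
    obtain ⟨m₀, hm₀, hc⟩ : ∃ m ∈ lineNormals, ∀ t, c t ∈ line m := by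
      rw [IsSystolicGeodesic, systole_eq hk hn hΓ] at hs
      obtain ⟨g', h'⟩ := IsSurfaceGroup.exists_isLift hΓ h.isom h.eq hs.periodic
      rcases h'.length_cases hk hn hΓ hs.pos with h1 | ⟨-, hm⟩
      · exact absurd cosh_sysLen h1.ne'
      · exact hm
    have hU : ∀ z, proj Γ z ∈ otherSystolicUnion Γ γ ↔
        ∃ m ∈ lineNormals, proj Γ '' line m ≠ Set.range γ ∧ z ∈ line m := fun z =>
      mem_systolicUnion hk hn hΓ (fun R => R ≠ Set.range γ) z
    have himage : ∀ m ∈ lineNormals, (∀ t, c t ∈ line m) → proj Γ '' line m = Set.range γ :=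
      fun m hm hall => by rw [h.range_eq, range_eq_line hm h.isom hall]
    refine even_inter_of_lines hΓ hγ h _ (fun m => proj Γ '' line m ≠ Set.range γ) hU
      (fun m hm hne hall => hne (himage m hm hall))
      (fun a ha => ?_) (fun a ha m hm => hΓ.image_line_turn_ne h ha hm) fun hvx => ⟨0, ?_⟩
    · obtain ⟨m, hm, ham, hne⟩ := hΓ.exists_line_image_ne hγ h hm₀ hc ha
      exact ⟨m, hm, hne, ham⟩
    · have hP : {t | γ t ∈ otherSystolicUnion Γ γ} = ∅ := by
        refine Set.eq_empty_of_forall_notMem fun t ht => ?_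
        rw [Set.mem_ofPred_eq, h.eq, hU] at ht
        obtain ⟨m, hm, hne, htm⟩ := ht
        refine hne (himage m hm fun u => ?_)
        rcases lineNormals_unique (hvx t) hm₀ hm (hc t) htm with rfl | rfl
        · exact hc u
        · rw [line, Set.mem_ofPred_eq, bil_neg_left, show bil rt m₀ (hv (c u)) = 0 from hc u,
            neg_zero]
      rw [hP, Set.empty_inter, Set.ncard_empty]
      exact Even.zero
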